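/- Let $M$ be an oriented paracompact smooth Hausdorff manifold of finite dimension $n$, $I=(0,1]$, and let $(U,\varphi)$ be a chart of $M$ with $U\neq\emptyset$ and $\varphi\colon U\to\Omega:=\varphi(U)\subseteq\mathbb{R}^n$ orientation preserving. $\Omega^n_c(U)$ (compactly supported smooth $n$-forms on $U$) and $\mathcal{D}(\Omega)$ (test functions) carry their LF topologies; spaces $C^\infty(I\times X,F)$ carry the bornology of sets for which every iterated derivative is bounded in $F$, uniformly over the set and over compact subsets of $I\times X$ in charts. $\mathrm{L}_X$ is the Lie derivative of forms, $(\mathrm{L}_X\Phi)(\varepsilon,p)=\mathrm{L}_X(\Phi(\varepsilon,p))$, and $(\mathrm{L}'_X\Phi)(\varepsilon,p)=\frac{d}{dt}\big|_{t=0}\Phi(\varepsilon,\mathrm{Fl}^X_t p)$. For $\Phi\in C^\infty(I\times U,\Omega^n_c(U))$ and a Riemannian metric $g$ on $U$ consider (N) $\int_U\Phi(\varepsilon,p)=1$ for all $\varepsilon,p$; (S$_g$) for each compact $K\subseteq U$ there are $\varepsilon_0,C>0$ such that $\operatorname{supp}\Phi(\varepsilon,p)\subseteq B^g_{\varepsilon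 C}(p)$ for all $p\in K$, $\varepsilon\le\varepsilon_0$; (D$_g$) for each compact $K\subseteq U$ and all smooth vector fields $\theta_1,\dots,\theta_m,\zeta_1,\dots,\zeta_l$ on $U$ ($l,m\ge0$), $\|(\mathrm{L}_{\theta_1}\cdots\mathrm{L}_{\theta_m}(\mathrm{L}'_{\zeta_1}+\mathrm{L}_{\zeta_1})\cdots(\mathrm{L}'_{\zeta_l}+\mathrm{L}_{\zeta_l})\Phi)(\varepsilon,p)(q)\|_g=O(\varepsilon^{-n-m})$ as $\varepsilon\to0$, uniformly for $p\in K$, $q\in U$; (A$_k$) for each $f\in C^\infty(U)$ and compact $K\subseteq U$, $|f(p)-\int_U f\,\Phi(\varepsilon,p)|=O(\varepsilon^{k+1})$ as $\varepsilon\to0$, uniformly for $p\in K$. For $\tilde\phi\in C^\infty(I\times\Omega,\mathcal{D}(\Omega))$ consider ($\tilde{\mathrm N}$) $\int_\Omega\tilde\phi(\varepsilon,x)(y)\,dy=1$ for all $\varepsilon,x$; ($\tilde{\mathrm S}$) for each compact $K\subseteq\Omega$ there are $\varepsilon_0,C>0$ such that $\operatorname{supp}\tilde\phi(\varepsilon,x)\subseteq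 B_{\varepsilon C}(x)\subseteq\Omega$ (Euclidean ball) for all $x\in K$, $\varepsilon\le\varepsilon_0$; ($\tilde{\mathrm D}$) for each compact $K\subseteq\Omega$ and $\alpha,\beta\in\mathbb{N}_0^n$, $|(\partial_y^\beta(\partial_x+\partial_y)^\alpha\tilde\phi)(\varepsilon,x)(y)|=O(\varepsilon^{-n-|\beta|})$ as $\varepsilon\to0$, uniformly for $x\in K$, $y\in\Omega$; ($\tilde{\mathrm A}_k$) for each $f\in C^\infty(\Omega)$ and compact $K\subseteq\Omega$, $|f(x)-\int_\Omega f(y)\tilde\phi(\varepsilon,x)(y)\,dy|=O(\varepsilon^{k+1})$ as $\varepsilon\to0$, uniformly for $x\in K$. Let $\hat{\mathcal S}_k(U)$ be the set of all $\Phi$ satisfying (N), (S$_g$) and (D$_g$) for every Riemannian metric $g$ on $U$ and, if $k\ge1$, (A$_k$); let $\tilde{\mathcal S}_k(\Omega)$ be the set of all $\tilde\phi$ satisfying ($\tilde{\mathrm N}$), ($\tilde{\mathrm S}$), ($\tilde{\mathrm D}$) and, if $k\ge1$, ($\tilde{\mathrm A}_k$). Let $\hat\lambda$ send an $n$-form $\omega$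 on $\Omega$ to the function $x\mapsto\omega(x)(e_1,\dots,e_n)$. Then $T\Phi:=\hat\lambda_*(\varphi_*\Phi)$, i.e. $(T\Phi)(\varepsilon,x)=\hat\lambda\big(\varphi_*(\Phi(\varepsilon,\varphi^{-1}(x)))\big)$, defines a bornological vector space isomorphism $T\colon C^\infty(I\times U,\Omega^n_c(U))\to C^\infty(I\times\Omega,\mathcal{D}(\Omega))$ (linear, bijective, a set $B$ being bounded if and only if $T(B)$ is), and $T(\hat{\mathcal S}_k(U))=\tilde{\mathcal S}_k(\Omega)$ for all $k\in\mathbb{N}_0$. Moreover, for every $\Phi\in C^\infty(I\times U,\Omega^n_c(U))$, every $k\in\mathbb{N}_0$ and every Riemannian metric $g$ on $U$: $\Phi$ satisfies (N) iff $T\Phi$ satisfies ($\tilde{\mathrm N}$); (A$_k$) iff ($\tilde{\mathrm A}_k$); (S$_g$) iff ($\tilde{\mathrm S}$); and if (S$_g$) holds, then $\Phi$ satisfies (D$_g$) iff $T\Phi$ satisfies ($\tilde{\mathrm D}$). -/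

import Mathlib

open Set Filter Topology Manifold ContDiff Bundle Distributions TopologicalSpace MeasureTheory

noncomputable section

namespace SmoothingKernel

/-- Euclidean space `ℝⁿ`, the model of all manifolds below. -/
abbrev Eu (n : ℕ) : Type := EuclideanSpace ℝ (Fin n)

/-- The parameter interval `I = (0,1]`. -/
abbrev Param : Type := Set.Ioc (0 : ℝ) 1

/-- `n`-covectors at a point. The tangent space of an `n`-manifold at a point is, by definition in
Mathlib, the model space `ℝⁿ` (read through the preferred chart at that point), so an `n`-form on
`X` is a map from `X` into this space. -/
abbrev Covec (n : ℕ) : Type := Eu n [⋀^Fin n]→L[ℝ] ℝ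

/-- The standard basis `e₁, …, eₙ` of `ℝⁿ`. -/
def stdFrame (n : ℕ) : Fin n → Eu n := fun i => EuclideanSpace.single i (1 : ℝ)

section Forms

variable {n : ℕ} {X Y : Type*} [TopologicalSpace X] [ChartedSpace (Eu n) X]
  [TopologicalSpace Y] [ChartedSpace (Eu n) Y]

/-- Pullback `μ^* σ` of an `n`-form along `μ : X → Y`. -/
def pullbackForm (μ : X → Y) (σ : Y → Covec n) : X → Covec n := fun p =>
  (σ (μ p)).compContinuousLinearMap (mfderiv 𝓘(ℝ, Eu n) 𝓘(ℝ, Eu n) μ p : Eu n →L[ℝ] Eu n)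

/-- `λ̂`: the function `x ↦ σ(x)(e₁, …, eₙ)` belonging to an `n`-form on (an open set of) `ℝⁿ`. -/
def lambdaHat (σ : Eu n → Covec n) : Eu n → ℝ := fun x => σ x (stdFrame n)

/-- Push-forward `e_* σ = (e⁻¹)^* σ` of a form along a chart; meaningful on `e.target`. -/
def pushForm (e : OpenPartialHomeomorph X (Eu n)) (σ : X → Covec n) : Eu n → Covec n :=
  pullbackForm e.symm σ

/-- Coefficient of `σ` in the chart `e`: the function `f` with `e_* σ = f dx¹ ∧ ⋯ ∧ dxⁿ`. -/
def coeff (e : OpenPartialHomeomorph X (Eu n)) (σ : X → Covec n) : Eu n → ℝ :=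
  lambdaHat (pushForm e σ)

/-- The charts of the smooth manifold `X` (all charts compatible with its smooth structure). -/
def charts (n : ℕ) (X : Type*) [TopologicalSpace X] [ChartedSpace (Eu n) X] :
    Set (OpenPartialHomeomorph X (Eu n)) :=
  IsManifold.maximalAtlas 𝓘(ℝ, Eu n) ∞ X

/-- Smoothness of an `n`-form: its coefficient is smooth in every chart. -/
def IsSmoothForm (σ : X → Covec n) : Prop :=
  ∀ e ∈ charts n X, ContDiffOn ℝ ∞ (coeff e σ) e.target

theorem coeff_add (e : OpenPartialHomeomorph X (Eu n)) (σ η : X → Covec n) :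
    coeff e (σ + η) = coeff e σ + coeff e η := rfl

theorem coeff_smul (e : OpenPartialHomeomorph X (Eu n)) (c : ℝ) (σ : X → Covec n) :
    coeff e (c • σ) = c • coeff e σ := rfl

theorem coeff_zero (e : OpenPartialHomeomorph X (Eu n)) :
    coeff e (0 : X → Covec n) = 0 := rfl

variable (n X) in
/-- Compactly supported smooth `n`-forms on `X`, as a subspace of all `n`-forms. -/
def compactFormSubmodule : Submodule ℝ (X → Covec n) where
  carrier := {σ | IsSmoothForm σ ∧ HasCompactSupport σ}
  add_mem' := by
    rintro σ η ⟨h1, h2⟩ ⟨h3, h4⟩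
    refine ⟨fun e he => ?_, h2.add h4⟩
    rw [coeff_add]
    exact (h1 e he).add (h3 e he)
  zero_mem' := by
    refine ⟨fun e _ => ?_, HasCompactSupport.zero⟩
    rw [coeff_zero]
    exact contDiffOn_const
  smul_mem' := by
    rintro c σ ⟨h1, h2⟩
    refine ⟨fun e he => ?_, h2.smul_left (f := fun _ => c)⟩
    rw [coeff_smul]
    exact (h1 e he).const_smul c

variable (n X) in
/-- The space `Ω^n_c(X)` of compactly supported smooth `n`-forms. (A type of its own, so that it
carries its LF topology and not the topology of pointwise convergence.) -/
def CompactForm : Type _ := compactFormSubmodule n X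

instance : AddCommGroup (CompactForm n X) :=
  inferInstanceAs (AddCommGroup (compactFormSubmodule n X))

instance : Module ℝ (CompactForm n X) :=
  inferInstanceAs (Module ℝ (compactFormSubmodule n X))

/-- The underlying form of an element of `Ω^n_c(X)`. -/
def CompactForm.form (σ : CompactForm n X) : X → Covec n := σ.1

/-- The seminorms that are continuous on each of the Fréchet spaces `Ω^n_K(X)`, `K` compact.
The topology of `Ω^n_K(X)` is that of uniform convergence of all derivatives of the coefficients in
charts `e` on compact sets `L ⊆ e.target`. -/
def IsLFSeminorm (q : Seminorm ℝ (CompactForm n X)) : Prop :=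
  ∀ K : Set X, IsCompact K →
    ∃ (C : ℝ) (s : List (OpenPartialHomeomorph X (Eu n) × Set (Eu n) × ℕ)),
      (∀ a ∈ s, a.1 ∈ charts n X ∧ IsCompact a.2.1 ∧ a.2.1 ⊆ a.1.target) ∧
      ∀ σ : CompactForm n X, tsupport σ.form ⊆ K → ∀ b : ℝ, 0 ≤ b →
        (∀ a ∈ s, ∀ x ∈ a.2.1, ‖iteratedFDeriv ℝ a.2.2 (coeff a.1 σ.form) x‖ ≤ b) →
        q σ ≤ C * b

theorem isLFSeminorm_zero : IsLFSeminorm (0 : Seminorm ℝ (CompactForm n X)) := fun _ _ =>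
  ⟨0, [], by simp, by intros; simp⟩

instance : Nonempty {q : Seminorm ℝ (CompactForm n X) // IsLFSeminorm q} :=
  ⟨⟨0, isLFSeminorm_zero⟩⟩

variable (n X) in
/-- The family of all seminorms that are continuous on each `Ω^n_K(X)`. -/
def lfSeminorms :
    SeminormFamily ℝ (CompactForm n X) {q : Seminorm ℝ (CompactForm n X) // IsLFSeminorm q} :=
  fun q => q.1

/-- The LF topology of `Ω^n_c(X)`: the finest locally convex topology that makes all inclusions
`Ω^n_K(X) → Ω^n_c(X)` continuous. -/
instance : TopologicalSpace (CompactForm n X) :=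
  (lfSeminorms n X).moduleFilterBasis.topology

theorem withSeminorms_compactForm : WithSeminorms (lfSeminorms n X) := ⟨rfl⟩

instance : IsTopologicalAddGroup (CompactForm n X) :=
  withSeminorms_compactForm.topologicalAddGroup

instance : ContinuousSMul ℝ (CompactForm n X) :=
  withSeminorms_compactForm.continuousSMul

end Forms

section SmoothMaps

variable {n : ℕ}

/-- `D` is the family of all iterated directional derivatives (indexed by the list of directions,
the outermost one first) of the map `D []` on `S`, and all of them exist and are continuous on `S`.
At boundary points of `S` the derivatives are one-sided. -/
def IsDerivFamily {V F : Type*} [NormedAddCommGroup V] [NormedSpace ℝ V]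
    [AddCommGroup F] [Module ℝ F] [TopologicalSpace F] (S : Set V) (D : List V → V → F) : Prop :=
  ∀ l : List V, ContinuousOn (D l) S ∧ ∀ v : V, ∀ x ∈ S,
    Tendsto (fun t : ℝ => t⁻¹ • (D l (x + t • v) - D l x))
      (𝓝[{t : ℝ | t ≠ 0 ∧ x + t • v ∈ S}] 0) (𝓝 (D (v :: l) x))

variable {X : Type*} [TopologicalSpace X] [ChartedSpace (Eu n) X]
  {F : Type*} [AddCommGroup F] [Module ℝ F] [TopologicalSpace F]

/-- `D` consists of the iterated derivatives of `f : I × X → F` read in the chart `e`. -/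
def IsDerivFamilyOf (f : Param → X → F) (e : OpenPartialHomeomorph X (Eu n))
    (D : List (ℝ × Eu n) → ℝ × Eu n → F) : Prop :=
  IsDerivFamily (Set.Ioc (0 : ℝ) 1 ×ˢ e.target) D ∧
    ∀ ε : Param, ∀ x ∈ e.target, D [] ((ε : ℝ), x) = f ε (e.symm x)

/-- Smoothness of a map `I × X → F` into a topological vector space. -/
def IsSmoothMap (f : Param → X → F) : Prop :=
  ∀ e ∈ charts n X, ∃ D, IsDerivFamilyOf f e D

variable (n X F) in
/-- The vector space `C^∞(I × X, F)`, in curried form. -/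
def SmoothMaps [IsTopologicalAddGroup F] [ContinuousSMul ℝ F] : Submodule ℝ (Param → X → F) where
  carrier := {f | IsSmoothMap (n := n) f}
  add_mem' := by
    intro f g hf hg e he
    obtain ⟨D, hD, hD'⟩ := hf e he
    obtain ⟨D₂, hE, hE'⟩ := hg e he
    refine ⟨fun l z => D l z + D₂ l z, fun l => ⟨(hD l).1.add (hE l).1, fun v x hx => ?_⟩, ?_⟩
    · refine (((hD l).2 v x hx).add ((hE l).2 v x hx)).congr fun t => ?_
      rw [← smul_add]
      congr 1
      rw [add_sub_add_comm]
    · intro ε x hx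
      change D [] ((ε : ℝ), x) + D₂ [] ((ε : ℝ), x) = f ε (e.symm x) + g ε (e.symm x)
      rw [hD' ε x hx, hE' ε x hx]
  zero_mem' := by
    intro e _
    refine ⟨fun _ _ => 0, fun l => ⟨continuousOn_const, fun v x _ => ?_⟩, fun _ _ _ => rfl⟩
    simpa using tendsto_const_nhds
  smul_mem' := by
    intro c f hf e he
    obtain ⟨D, hD, hD'⟩ := hf e he
    refine ⟨fun l z => c • D l z, fun l => ⟨(hD l).1.const_smul c, fun v x hx => ?_⟩, ?_⟩
    · refine (((hD l).2 v x hx).const_smul c).congr fun t => ?_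
      rw [← smul_sub, smul_comm]
    · intro ε x hx
      change c • D [] ((ε : ℝ), x) = c • f ε (e.symm x)
      rw [hD' ε x hx]

/-- The bounded subsets of `C^∞(I × X, F)`: every iterated derivative is bounded in `F`, uniformly
over the set, on every compact subset of `I × X` inside a chart domain. -/
def IsBoundedSet [IsTopologicalAddGroup F] [ContinuousSMul ℝ F]
    (B : Set (SmoothMaps n X F)) : Prop :=
  ∀ e ∈ charts n X, ∀ L : Set (ℝ × Eu n), IsCompact L → L ⊆ Set.Ioc (0 : ℝ) 1 ×ˢ e.target →
    ∀ l : List (ℝ × Eu n),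
      Bornology.IsVonNBounded ℝ
        {y : F | ∃ f ∈ B, ∃ D, IsDerivFamilyOf f.1 e D ∧ ∃ z ∈ L, y = D l z}

end SmoothMaps

section Orientation

variable {n : ℕ} {X : Type*} [TopologicalSpace X] [ChartedSpace (Eu n) X]

/-- A nowhere vanishing smooth `n`-form; it represents an orientation of `X`. -/
def IsOrientationForm (o : X → Covec n) : Prop :=
  IsSmoothForm o ∧ ∀ p, o p ≠ 0

/-- The chart `e` is orientation preserving for the orientation represented by `o`. -/
def IsPositiveChart (o : X → Covec n) (e : OpenPartialHomeomorph X (Eu n)) : Prop :=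
  ∀ x ∈ e.target, 0 < coeff e o x

/-- `c` is the value of the integral of the compactly supported `n`-form `σ` computed by means of
some finite family of functions `ρ i` with supports in domains of positively oriented charts `e i`
and with sum `1` on the support of `σ`. -/
def HasFormIntegral (o : X → Covec n) (σ : X → Covec n) (c : ℝ) : Prop :=
  ∃ (N : ℕ) (e : Fin N → OpenPartialHomeomorph X (Eu n)) (ρ : Fin N → X → ℝ),
    (∀ i, e i ∈ charts n X ∧ IsPositiveChart o (e i)) ∧
    (∀ i, ContMDiff 𝓘(ℝ, Eu n) 𝓘(ℝ, ℝ) ∞ (ρ i) ∧ tsupport (ρ i) ⊆ (e i).source) ∧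
    (∀ p ∈ tsupport σ, ∑ i, ρ i p = 1) ∧
    c = ∑ i, ∫ x in (e i).target, ρ i ((e i).symm x) * coeff (e i) σ x

open Classical in
/-- The integral `∫_X σ` over the manifold `X` oriented by `o`. -/
def formIntegral (o : X → Covec n) (σ : X → Covec n) : ℝ :=
  if h : ∃ c, HasFormIntegral o σ c then h.choose else 0

end Orientation

section LieDerivatives

variable {n : ℕ}

/-- The action `(A · η)(v₁, …, vₙ) = ∑ᵢ η(v₁, …, A vᵢ, …, vₙ)` of an endomorphism on covectors. -/
def endAction (η : Covec n) (A : Eu n →L[ℝ] Eu n) : Covec n where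
  toContinuousMultilinearMap := ∑ i : Fin n,
    η.toContinuousMultilinearMap.compContinuousLinearMap
      (Function.update (fun _ => ContinuousLinearMap.id ℝ (Eu n)) i A)
  map_eq_zero_of_eq' := by
    intro v a b hv hab
    have key : ∀ i : Fin n, (fun k => (Function.update (fun _ => ContinuousLinearMap.id ℝ (Eu n)) i A
        : Fin n → (Eu n →L[ℝ] Eu n)) k (v k)) = Function.update v i (A (v i)) := by
      intro i
      funext k
      by_cases h : k = i
      · subst h; simp
      · simp [h]
    change (∑ i : Fin n, η.toContinuousMultilinearMap.compContinuousLinearMap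
      (Function.update (fun _ => ContinuousLinearMap.id ℝ (Eu n)) i A)) v = 0
    rw [_root_.sum_apply]
    simp only [ContinuousMultilinearMap.compContinuousLinearMap_apply, key]
    rw [Finset.sum_eq_add_of_mem a b (Finset.mem_univ _) (Finset.mem_univ _) hab]
    · have hsw : Function.update v b (A (v b)) =
          Function.update v a (A (v a)) ∘ Equiv.swap a b := by
        funext k
        rcases eq_or_ne k b with rfl | hkb
        · simp [hv]
        rcases eq_or_ne k a with rfl | hka
        · simp [hab, hab.symm, hv]
        · simp [Equiv.swap_apply_of_ne_of_ne hka hkb, hka, hkb]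
      rw [hsw]
      have := η.toAlternatingMap.map_swap (Function.update v a (A (v a))) hab
      change η.toAlternatingMap _ + η.toAlternatingMap _ = 0
      rw [this]
      simp
    · intro c _ hc
      exact η.map_eq_zero_of_eq _ (by simp [hc.1.symm, hc.2.symm, hv]) hab

/-- The Lie derivative of an `n`-form `η` along a vector field `W` on (an open set of) `ℝⁿ`:
`(L_W η)(v₁, …, vₙ) = (Dη · W)(v₁, …, vₙ) + ∑ᵢ η(v₁, …, DW · vᵢ, …, vₙ)`. -/
def lieFormFlat (W : Eu n → Eu n) (η : Eu n → Covec n) : Eu n → Covec n := fun x =>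
  fderiv ℝ η x (W x) + endAction (η x) (fderiv ℝ W x)

variable {X : Type*} [TopologicalSpace X] [ChartedSpace (Eu n) X] [IsManifold 𝓘(ℝ, Eu n) ∞ X]

variable (n X) in
/-- The space `𝔛(X)` of smooth vector fields. -/
abbrev VectorField : Type _ :=
  ContMDiffSection 𝓘(ℝ, Eu n) (Eu n) ∞ (fun p : X => TangentSpace 𝓘(ℝ, Eu n) p)

/-- The Lie derivative `L_V σ` of an `n`-form on `X`; at `p` it is computed in the preferred chart
at `p`. -/
def lieForm (V : VectorField n X) (σ : X → Covec n) : X → Covec n := fun p =>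
  let e := chartAt (Eu n) p
  pullbackForm e
    (lieFormFlat
      (fun x => mfderiv 𝓘(ℝ, Eu n) 𝓘(ℝ, Eu n) e (e.symm x) (V (e.symm x))) (pushForm e σ)) p

open Classical in
/-- A curve `t ↦ Fl^V_t p`, defined for small `|t|`. -/
def flowCurve (V : VectorField n X) (p : X) : ℝ → X :=
  if h : ∃ γ : ℝ → X, γ 0 = p ∧ IsMIntegralCurveAt γ (fun q => V q) 0 then h.choose else fun _ => p

/-- `(L_V Φ)(p) = L_V (Φ(p))` for a two-point form `Φ`. -/
def lieSnd (V : VectorField n X) (Φ : X → X → Covec n) : X → X → Covec n := fun p =>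
  lieForm V (Φ p)

/-- `(L'_V Φ)(p) = d/dt Φ(Fl^V_t p)` at `t = 0` for a two-point form `Φ`, evaluated at `q`. -/
def lieFst (V : VectorField n X) (Φ : X → X → Covec n) : X → X → Covec n := fun p q =>
  deriv (fun t : ℝ => Φ (flowCurve V p t) q) 0

/-- `L_{θ₁} ⋯ L_{θₘ} (L'_{ζ₁} + L_{ζ₁}) ⋯ (L'_{ζₗ} + L_{ζₗ}) Φ`. -/
def iteratedLie (θ ζ : List (VectorField n X)) (Φ : X → X → Covec n) : X → X → Covec n :=
  θ.foldr lieSnd (ζ.foldr (fun V Ψ => lieFst V Ψ + lieSnd V Ψ) Φ)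

end LieDerivatives

section GlobalKernels

variable {n : ℕ} {X : Type*} [TopologicalSpace X] [ChartedSpace (Eu n) X]
  [IsManifold 𝓘(ℝ, Eu n) ∞ X]

variable (n X) in
/-- Smooth Riemannian metrics on `X`. -/
abbrev Metric : Type _ :=
  ContMDiffRiemannianMetric 𝓘(ℝ, Eu n) ∞ (Eu n) (fun p : X => TangentSpace 𝓘(ℝ, Eu n) p)

/-- The open ball of radius `r` around `p` for the geodesic distance of `g`. -/
def metricBall (g : Metric n X) (p : X) (r : ℝ) : Set X :=
  letI : RiemannianBundle (fun p : X => TangentSpace 𝓘(ℝ, Eu n) p) := ⟨g.toRiemannianMetric⟩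
  {q | riemannianEDist 𝓘(ℝ, Eu n) p q < ENNReal.ofReal r}

/-- The norm of an `n`-covector at `q` with respect to `g`. -/
def covecNorm (g : Metric n X) (q : X) (η : Covec n) : ℝ :=
  letI : RiemannianBundle (fun p : X => TangentSpace 𝓘(ℝ, Eu n) p) := ⟨g.toRiemannianMetric⟩
  letI ν : TangentSpace 𝓘(ℝ, Eu n) q [⋀^Fin n]→L[ℝ] ℝ := η
  ‖ν‖

/-- Condition on supports: for compact `K` there are `ε₀, C > 0` with
`supp Φ(ε, p) ⊆ B^g_{εC}(p)` for all `p ∈ K` and `ε ≤ ε₀`. -/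
def SupportCondition (g : Metric n X) (Φ : Param → X → CompactForm n X) : Prop :=
  ∀ K : Set X, IsCompact K → ∃ ε₀ > (0 : ℝ), ∃ C > (0 : ℝ), ∀ p ∈ K, ∀ ε : Param, (ε : ℝ) ≤ ε₀ →
    tsupport (Φ ε p).form ⊆ metricBall g p (ε * C)

/-- Condition on derivatives: for compact `K` and vector fields `θ₁, …, θₘ`, `ζ₁, …, ζₗ`, the
`g`-norm of `(L_{θ₁} ⋯ L_{θₘ} (L'_{ζ₁} + L_{ζ₁}) ⋯ (L'_{ζₗ} + L_{ζₗ}) Φ)(ε, p)(q)` is `O(ε^{-n-m})`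
as `ε → 0`, uniformly for `p ∈ K` and `q ∈ X`. -/
def DerivCondition (g : Metric n X) (Φ : Param → X → CompactForm n X) : Prop :=
  ∀ K : Set X, IsCompact K → ∀ θ ζ : List (VectorField n X),
    ∃ ε₀ > (0 : ℝ), ∃ C : ℝ, ∀ ε : Param, (ε : ℝ) ≤ ε₀ → ∀ p ∈ K, ∀ q : X,
      covecNorm g q (iteratedLie θ ζ (fun p' => (Φ ε p').form) p q) ≤
        C / (ε : ℝ) ^ (n + θ.length)

/-- Approximation condition of order `k`: `|f(p) - ∫ f Φ(ε, p)| = O(ε^{k+1})` as `ε → 0`, uniformly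
for `p` in compact sets, for all smooth functions `f`. -/
def ApproxCondition (o : X → Covec n) (k : ℕ) (Φ : Param → X → CompactForm n X) : Prop :=
  ∀ f : X → ℝ, ContMDiff 𝓘(ℝ, Eu n) 𝓘(ℝ, ℝ) ∞ f → ∀ K : Set X, IsCompact K →
    ∃ ε₀ > (0 : ℝ), ∃ C : ℝ, ∀ ε : Param, (ε : ℝ) ≤ ε₀ → ∀ p ∈ K,
      |f p - formIntegral o (fun q => f q • (Φ ε p).form q)| ≤ C * (ε : ℝ) ^ (k + 1)

/-- `Φ` takes values in the compactly supported `n`-forms with integral `1`. -/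
def Normalized (o : X → Covec n) (Φ : Param → X → CompactForm n X) : Prop :=
  ∀ ε p, formIntegral o (Φ ε p).form = 1

/-- The (global) smoothing kernels of order `k` on the manifold `X` oriented by `o`. The conditions
on supports and derivatives are required with respect to any Riemannian metric; the approximation
condition is required only for `k ≥ 1`. -/
def globalKernels (o : X → Covec n) (k : ℕ) : Set (SmoothMaps n X (CompactForm n X)) :=
  {Φ | Normalized o Φ.1 ∧
    (∀ g : Metric n X, SupportCondition g Φ.1 ∧ DerivCondition g Φ.1) ∧
    (1 ≤ k → ApproxCondition o k Φ.1)}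

end GlobalKernels

section LocalKernels

variable {n : ℕ} {Ω : Opens (Eu n)}

/-- The partial derivative `∂_{x_i}` of a function of two variables `x, y`. -/
def partialFst (i : Fin n) (ψ : Eu n → Eu n → ℝ) : Eu n → Eu n → ℝ := fun x y =>
  lineDeriv ℝ (fun z => ψ z y) x (stdFrame n i)

/-- The partial derivative `∂_{y_i}` of a function of two variables `x, y`. -/
def partialSnd (i : Fin n) (ψ : Eu n → Eu n → ℝ) : Eu n → Eu n → ℝ := fun x y =>
  lineDeriv ℝ (fun z => ψ x z) y (stdFrame n i)

/-- `∂_{(x+y)_i} = ∂_{x_i} + ∂_{y_i}`. -/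
def partialSum (i : Fin n) (ψ : Eu n → Eu n → ℝ) : Eu n → Eu n → ℝ :=
  partialFst i ψ + partialSnd i ψ

/-- The operator `op₁^{α₁} ⋯ opₙ^{αₙ}` belonging to a multi-index `α`. -/
def multiPower {G : Type*} (op : Fin n → G → G) (α : Fin n → ℕ) (ψ : G) : G :=
  (List.finRange n).foldr (fun i χ => (op i)^[α i] χ) ψ

open Classical in
/-- The function `(x, y) ↦ ψ(x)(y)`, extended by zero to `x ∉ Ω`. -/
def toTwoPoint (ψ : Ω → 𝓓(Ω, ℝ)) : Eu n → Eu n → ℝ := fun x y =>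
  if h : x ∈ Ω then ψ ⟨x, h⟩ y else 0

/-- Local condition on supports: `supp ψ(ε, x) ⊆ B_{εC}(x) ⊆ Ω` for `x ∈ K` and `ε ≤ ε₀`. -/
def LocalSupportCondition (ψ : Param → Ω → 𝓓(Ω, ℝ)) : Prop :=
  ∀ K : Set Ω, IsCompact K → ∃ ε₀ > (0 : ℝ), ∃ C > (0 : ℝ), ∀ x ∈ K, ∀ ε : Param, (ε : ℝ) ≤ ε₀ →
    tsupport (ψ ε x) ⊆ Metric.ball (x : Eu n) (ε * C) ∧
      Metric.ball (x : Eu n) (ε * C) ⊆ (Ω : Set (Eu n))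

/-- Local condition on derivatives: `|(∂_y^β ∂_{x+y}^α ψ)(ε, x)(y)| = O(ε^{-n-|β|})` as `ε → 0`,
uniformly for `x ∈ K` and `y ∈ Ω`. -/
def LocalDerivCondition (ψ : Param → Ω → 𝓓(Ω, ℝ)) : Prop :=
  ∀ K : Set Ω, IsCompact K → ∀ α β : Fin n → ℕ,
    ∃ ε₀ > (0 : ℝ), ∃ C : ℝ, ∀ ε : Param, (ε : ℝ) ≤ ε₀ → ∀ x ∈ K, ∀ y : Ω,
      |multiPower partialSnd β (multiPower partialSum α (toTwoPoint (ψ ε))) x y| ≤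
        C / (ε : ℝ) ^ (n + ∑ i, β i)

/-- Local approximation condition of order `k`: `|f(x) - ∫_Ω f(y) ψ(ε, x)(y) dy| = O(ε^{k+1})` as
`ε → 0`, uniformly for `x` in compact sets, for all smooth `f` on `Ω`. -/
def LocalApproxCondition (k : ℕ) (ψ : Param → Ω → 𝓓(Ω, ℝ)) : Prop :=
  ∀ f : Eu n → ℝ, ContDiffOn ℝ ∞ f Ω → ∀ K : Set Ω, IsCompact K →
    ∃ ε₀ > (0 : ℝ), ∃ C : ℝ, ∀ ε : Param, (ε : ℝ) ≤ ε₀ → ∀ x ∈ K,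
      |f x - ∫ y in (Ω : Set (Eu n)), f y * ψ ε x y| ≤ C * (ε : ℝ) ^ (k + 1)

/-- `ψ` takes values in the test functions with integral `1`. -/
def LocalNormalized (ψ : Param → Ω → 𝓓(Ω, ℝ)) : Prop :=
  ∀ ε x, ∫ y in (Ω : Set (Eu n)), ψ ε x y = 1

variable (Ω) in
/-- The local smoothing kernels of order `k` on `Ω`; the approximation condition is required only
for `k ≥ 1`. -/
def localKernels (k : ℕ) : Set (SmoothMaps n Ω 𝓓(Ω, ℝ)) :=
  {ψ | LocalNormalized ψ.1 ∧ (LocalSupportCondition ψ.1 ∧ LocalDerivCondition ψ.1) ∧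
    (1 ≤ k → LocalApproxCondition k ψ.1)}

end LocalKernels

section Chart

variable {n : ℕ} {M : Type*} [TopologicalSpace M] [ChartedSpace (Eu n) M]

/-- The domain `U` of the chart `φ`, as an open submanifold of `M`. -/
def chartDomain (φ : OpenPartialHomeomorph M (Eu n)) : Opens M := ⟨φ.source, φ.open_source⟩

/-- The image `φ(U)`, as an open subset of `ℝⁿ`. -/
def chartImage (φ : OpenPartialHomeomorph M (Eu n)) : Opens (Eu n) := ⟨φ.target, φ.open_target⟩

/-- The chart `φ`, as a (globally defined) chart of the manifold `U`. -/
def chartOnDomain (φ : OpenPartialHomeomorph M (Eu n)) (hφ : φ.source.Nonempty) :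
    OpenPartialHomeomorph (chartDomain φ) (Eu n) :=
  φ.subtypeRestr hφ.to_subtype

/-- The orientation which an open submanifold inherits from `M`: pullback along the inclusion. -/
def restrictForm (U : Opens M) (o : M → Covec n) : U → Covec n :=
  pullbackForm (Subtype.val : U → M) o

/-- The local expression `λ̂_*(φ_* Φ) : (ε, x) ↦ λ̂(φ_*(Φ(ε, φ⁻¹(x))))` with respect to a chart. -/
def localExpression {X : Type*} [TopologicalSpace X] [ChartedSpace (Eu n) X]
    (e : OpenPartialHomeomorph X (Eu n)) (Φ : Param → X → CompactForm n X) (ε : Param) (x : Eu n) :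
    Eu n → ℝ :=
  lambdaHat (pushForm e (Φ ε (e.symm x)).form)

end Chart

end SmoothingKernel

end

/-!
A chart with domain `U` is a global chart of the manifold `U`, with image `Ω`. In it an `n`-form is
determined by its coefficient, a function on `Ω`, and the theorem says that each of the structures
in question depends only on this coefficient.

*The isomorphism.* In another chart the coefficient of a form is multiplied by a Jacobian
determinant and composed with a transition map (`coeff_transform`). The Leibniz and chain rules
therefore bound its derivatives on compact sets by those of the coefficient in the global chart, so
that the LF topology of `Ω^n_c(U)` corresponds to that of `𝓓(Ω)` (`testEquiv`). Being given by a
homeomorphism of the base that matches charts and an isomorphism of the target spaces, the map on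
`C^∞(I × U, Ω^n_c(U))` preserves smoothness and bounded sets (`kernelEquiv`,
`isBoundedSet_kernelEquiv_iff`).

*Integrals.* By the change of variables formula and a partition of unity the integral of a form is
the integral of its coefficient in a positive global chart (`formIntegral_eq`), which settles the
normalization and the moment conditions (`normalized_iff`, `approxCondition_iff`).

*Supports.* On compact sets the norm of a Riemannian metric is equivalent to the Euclidean norm in
the chart, hence small geodesic balls are comparable with Euclidean balls
(`exists_chartD_compare`, `exists_metricBall_compare`, `supportCondition_iff`).

*Derivatives.* For fixed `ε` the coefficient `F(x, y)` of a kernel is a smooth function of both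
variables (`contDiffOn_of_isDerivFamily`). In the chart `L_Z` acts on it as
`∑ Z_i(y) ∂_{y_i} + (div Z)(y)` and `L'_Z` as `∑ Z_i(x) ∂_{x_i}` (`coeff_lieForm`, `coeff_lieFst`),
so that
`L'_Z + L_Z = ∑ Z_i(x) (∂_{x_i} + ∂_{y_i}) + ∑ (Z_i(y) - Z_i(x)) ∂_{y_i} + (div Z)(y)`
(`flatLieSum_eq_sum`). The derivative `∂_{y_i}` costs one power of `ε`, but the factor
`Z_i(y) - Z_i(x)` vanishes on the diagonal, to which the supports shrink linearly in `ε`, and wins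
it back (`HasOrder.mul_of_diagonal`). The estimates on partial derivatives thus imply those on Lie
derivatives. Conversely, partial derivatives are Lie derivatives along constant fields
(`constField`, `flatIteratedLie_eq_wordDeriv`). Together these give `derivCondition_iff`.

The equality of the sets of kernels also needs that `U` carries some Riemannian metric, such as the
Euclidean metric of the chart (`chartMetric`).
-/

noncomputable section

set_option linter.unusedSectionVars false

namespace SmoothingKernel

/-! ### Forms of top degree in charts -/

section ChartCalculus

/-- The volume form `dx¹ ∧ ⋯ ∧ dxⁿ` of `ℝⁿ`, normalised by the value `1` on the standard basis. -/
def volForm (n : ℕ) : Covec n :=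
  { (EuclideanSpace.basisFun (Fin n) ℝ).toBasis.det with
    cont := by
      change Continuous fun v : Fin n → Eu n =>
        Matrix.det ((EuclideanSpace.basisFun (Fin n) ℝ).toBasis.toMatrix v)
      refine Continuous.matrix_det ?_
      refine continuous_pi fun i => continuous_pi fun j => ?_
      simp only [Module.Basis.toMatrix_apply, OrthonormalBasis.coe_toBasis_repr_apply,
        EuclideanSpace.basisFun_repr]
      fun_prop }

theorem stdFrame_eq_basis (n : ℕ) :
    stdFrame n = ⇑(EuclideanSpace.basisFun (Fin n) ℝ).toBasis := by
  funext i
  simp [stdFrame]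

theorem volForm_apply {n : ℕ} (v : Fin n → Eu n) :
    volForm n v = (EuclideanSpace.basisFun (Fin n) ℝ).toBasis.det v := rfl

theorem volForm_stdFrame (n : ℕ) : volForm n (stdFrame n) = 1 := by
  rw [volForm_apply, stdFrame_eq_basis, Module.Basis.det_self]

theorem covec_eq_smul_volForm {n : ℕ} (η : Covec n) : η = η (stdFrame n) • volForm n := by
  ext v
  have := congrArg (fun f => f v)
    (AlternatingMap.eq_smul_basis_det (EuclideanSpace.basisFun (Fin n) ℝ).toBasis
      η.toAlternatingMap)
  rw [stdFrame_eq_basis]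
  exact this

theorem volForm_comp {n : ℕ} (A : Eu n →L[ℝ] Eu n) (v : Fin n → Eu n) :
    volForm n (fun i => A (v i)) = A.det * volForm n v :=
  Module.Basis.det_comp _ (A : Eu n →ₗ[ℝ] Eu n) v

theorem covec_comp_apply {n : ℕ} (η : Covec n) (A : Eu n →L[ℝ] Eu n) (v : Fin n → Eu n) :
    η (fun i => A (v i)) = A.det * η v := by
  rw [covec_eq_smul_volForm η]
  change η (stdFrame n) * volForm n (fun i => A (v i)) = A.det * (η (stdFrame n) * volForm n v)
  rw [volForm_comp]
  ring

variable {n : ℕ} {X : Type*} [TopologicalSpace X] [ChartedSpace (Eu n) X]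

/-- The differential of a chart at a point, as an endomorphism of the model space. -/
def chartD (e : OpenPartialHomeomorph X (Eu n)) (p : X) : Eu n →L[ℝ] Eu n :=
  mfderiv 𝓘(ℝ, Eu n) 𝓘(ℝ, Eu n) e p

/-- The differential of the inverse of a chart, as an endomorphism of the model space. -/
def chartDSymm (e : OpenPartialHomeomorph X (Eu n)) (x : Eu n) : Eu n →L[ℝ] Eu n :=
  mfderiv 𝓘(ℝ, Eu n) 𝓘(ℝ, Eu n) e.symm x

theorem coeff_apply (e : OpenPartialHomeomorph X (Eu n)) (σ : X → Covec n) (x : Eu n) :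
    coeff e σ x = σ (e.symm x) (fun i => chartDSymm e x (stdFrame n i)) := rfl

theorem pushForm_eq (e : OpenPartialHomeomorph X (Eu n)) (σ : X → Covec n) (x : Eu n) :
    pushForm e σ x = coeff e σ x • volForm n :=
  covec_eq_smul_volForm _

variable {e e' : OpenPartialHomeomorph X (Eu n)}

theorem mdifferentiable_of_mem_charts (he : e ∈ charts n X) :
    e.MDifferentiable 𝓘(ℝ, Eu n) 𝓘(ℝ, Eu n) :=
  ⟨(contMDiffOn_of_mem_maximalAtlas he).mdifferentiableOn (by simp),
    (contMDiffOn_symm_of_mem_maximalAtlas he).mdifferentiableOn (by simp)⟩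

theorem chartDSymm_chartD (he : e ∈ charts n X) {p : X} (hp : p ∈ e.source) (v : Eu n) :
    chartDSymm e (e p) (chartD e p v) = v :=
  congrArg (fun A : Eu n →L[ℝ] Eu n => A v)
    ((mdifferentiable_of_mem_charts he).symm_comp_deriv hp)

theorem chartD_chartDSymm (he : e ∈ charts n X) {x : Eu n} (hx : x ∈ e.target) (v : Eu n) :
    chartD e (e.symm x) (chartDSymm e x v) = v :=
  congrArg (fun A : Eu n →L[ℝ] Eu n => A v)
    ((mdifferentiable_of_mem_charts he).comp_symm_deriv hx)

theorem contDiffOn_transition (he : e ∈ charts n X) (he' : e' ∈ charts n X) :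
    ContDiffOn ℝ ∞ (e' ∘ e.symm) (e.target ∩ e.symm ⁻¹' e'.source) :=
  contMDiffOn_iff_contDiffOn.1 <|
    (contMDiffOn_of_mem_maximalAtlas he').comp
      ((contMDiffOn_symm_of_mem_maximalAtlas he).mono inter_subset_left) fun _ hx => hx.2

theorem isOpen_transition_source (e e' : OpenPartialHomeomorph X (Eu n)) :
    IsOpen (e.target ∩ e.symm ⁻¹' e'.source) :=
  e.isOpen_inter_preimage_symm e'.open_source

theorem differentiableAt_transition (he : e ∈ charts n X) (he' : e' ∈ charts n X) {x : Eu n}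
    (hx : x ∈ e.target ∩ e.symm ⁻¹' e'.source) : DifferentiableAt ℝ (e' ∘ e.symm) x :=
  ((contDiffOn_transition he he').contDiffAt
    ((isOpen_transition_source e e').mem_nhds hx)).differentiableAt (by simp)

theorem chartD_eq_comp (he : e ∈ charts n X) (he' : e' ∈ charts n X) {p : X} (hp : p ∈ e.source)
    (hp' : p ∈ e'.source) (v : Eu n) :
    chartD e' p v = fderiv ℝ (e' ∘ e.symm) (e p) (chartD e p v) := by
  have hx : e p ∈ e.target := e.map_source hp
  have h1 : mfderiv 𝓘(ℝ, Eu n) 𝓘(ℝ, Eu n) (e' ∘ e.symm) (e p) =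
      (mfderiv 𝓘(ℝ, Eu n) 𝓘(ℝ, Eu n) e' (e.symm (e p))).comp
        (mfderiv 𝓘(ℝ, Eu n) 𝓘(ℝ, Eu n) e.symm (e p)) :=
    mfderiv_comp _ ((mdifferentiable_of_mem_charts he').mdifferentiableAt (by rwa [e.left_inv hp]))
      ((mdifferentiable_of_mem_charts he).mdifferentiableAt_symm hx)
  rw [← mfderiv_eq_fderiv, h1, e.left_inv hp]
  exact (congrArg (chartD e' p) (chartDSymm_chartD he hp v)).symm

theorem chartDSymm_eq_comp (he : e ∈ charts n X) (he' : e' ∈ charts n X) {x : Eu n}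
    (hx : x ∈ e.target) (hx' : e.symm x ∈ e'.source) (v : Eu n) :
    chartDSymm e x v = chartDSymm e' (e' (e.symm x)) (fderiv ℝ (e' ∘ e.symm) x v) := by
  have h := chartD_eq_comp he he' (e.map_target hx) hx' (chartDSymm e x v)
  rw [e.right_inv hx, chartD_chartDSymm he hx] at h
  rw [← h, chartDSymm_chartD he' hx']

/-- Under a change of charts the coefficient of an `n`-form is multiplied by the Jacobian
determinant. -/
theorem coeff_transform (he : e ∈ charts n X) (he' : e' ∈ charts n X) (σ : X → Covec n) {x : Eu n}
    (hx : x ∈ e.target) (hx' : e.symm x ∈ e'.source) :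
    coeff e σ x = (fderiv ℝ (e' ∘ e.symm) x).det * coeff e' σ (e' (e.symm x)) := by
  simp only [coeff_apply]
  rw [e'.left_inv hx']
  simp only [chartDSymm_eq_comp he he' hx hx']
  let η : Covec n := (σ (e.symm x)).compContinuousLinearMap (chartDSymm e' (e' (e.symm x)))
  exact covec_comp_apply η (fderiv ℝ (e' ∘ e.symm) x) (stdFrame n)

theorem form_eq_coeff (he : e ∈ charts n X) (σ : X → Covec n) {p : X} (hp : p ∈ e.source)
    (v : Fin n → Eu n) :
    σ p v = coeff e σ (e p) * volForm n (fun i => chartD e p (v i)) := by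
  let η : Covec n := (σ p).compContinuousLinearMap (chartDSymm e (e p))
  have h := congrArg (fun f : Covec n => f (fun i => chartD e p (v i))) (covec_eq_smul_volForm η)
  have h1 : η (fun i => chartD e p (v i)) = σ p v := by
    change σ p (fun i => chartDSymm e (e p) (chartD e p (v i))) = _
    simp only [chartDSymm_chartD he hp]
  have h2 : coeff e σ (e p) = η (stdFrame n) := by
    rw [coeff_apply, e.left_inv hp]
    rfl
  rw [← h1, h2]
  exact h

/-- The `n`-form with coefficient `f` in the chart `e`. -/
def formOf (e : OpenPartialHomeomorph X (Eu n)) (f : Eu n → ℝ) : X → Covec n := fun p =>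
  f (e p) • (volForm n).compContinuousLinearMap (chartD e p)

theorem coeff_formOf (he : e ∈ charts n X) (f : Eu n → ℝ) {x : Eu n} (hx : x ∈ e.target) :
    coeff e (formOf e f) x = f x := by
  rw [coeff_apply]
  change f (e (e.symm x)) * volForm n (fun i => chartD e (e.symm x) (chartDSymm e x _)) = f x
  simp only [chartD_chartDSymm he hx]
  rw [e.right_inv hx]
  exact (congrArg (f x * ·) (volForm_stdFrame n)).trans (mul_one _)

theorem eq_of_coeff_eq (he : e ∈ charts n X) {σ η : X → Covec n} {p : X} (hp : p ∈ e.source)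
    (h : coeff e σ (e p) = coeff e η (e p)) : σ p = η p := by
  ext v
  rw [form_eq_coeff he σ hp, form_eq_coeff he η hp, h]

theorem contDiffOn_det_transition (he : e ∈ charts n X) (he' : e' ∈ charts n X) :
    ContDiffOn ℝ ∞ (fun x => (fderiv ℝ (e' ∘ e.symm) x).det)
      (e.target ∩ e.symm ⁻¹' e'.source) := by
  have h1 : ContDiffOn ℝ ∞ (fderiv ℝ (e' ∘ e.symm)) (e.target ∩ e.symm ⁻¹' e'.source) :=
    (contDiffOn_transition he he').fderiv_of_isOpen (isOpen_transition_source e e') (by simp)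
  have h2 : (fun x => (fderiv ℝ (e' ∘ e.symm) x).det) = fun x => Matrix.det (Matrix.of fun i j =>
      (fderiv ℝ (e' ∘ e.symm) x (stdFrame n j)) i) := by
    funext x
    have := volForm_comp (fderiv ℝ (e' ∘ e.symm) x) (stdFrame n)
    rw [volForm_stdFrame, mul_one] at this
    rw [← this, volForm_apply, Module.Basis.det_apply]
    congr 1
  rw [h2]
  simp only [Matrix.det_apply]
  refine ContDiffOn.sum fun s _ => ContDiffOn.const_smul _ ?_
  refine contDiffOn_prod fun i _ => ?_
  simp only [Matrix.of_apply]
  have h3 : ContDiffOn ℝ ∞ (fun x => fderiv ℝ (e' ∘ e.symm) x (stdFrame n i))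
      (e.target ∩ e.symm ⁻¹' e'.source) := h1.clm_apply contDiffOn_const
  exact (contDiffOn_euclidean.1 h3) (s i)

/-- A form with smooth coefficient in one global chart is smooth. -/
theorem isSmoothForm_of_global (he : e ∈ charts n X) (hs : e.source = univ) {σ : X → Covec n}
    (h : ContDiffOn ℝ ∞ (coeff e σ) e.target) : IsSmoothForm σ := by
  intro e' he'
  have hdom : e'.target ∩ e'.symm ⁻¹' e.source = e'.target := by simp [hs]
  have h1 := contDiffOn_det_transition he' he
  have h2 := contDiffOn_transition he' he
  rw [hdom] at h1 h2
  have h3 : ContDiffOn ℝ ∞ (fun x => coeff e σ ((e ∘ e'.symm) x)) e'.target :=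
    h.comp h2 fun x _ => e.map_source (by simp [hs])
  exact (h1.mul h3).congr fun x hx => coeff_transform he' he σ hx (by simp [hs])

end ChartCalculus

/-! ### Compactly supported forms and test functions -/

section Estimates

variable {E F : Type*} [NormedAddCommGroup E] [NormedSpace ℝ E]
  [NormedAddCommGroup F] [NormedSpace ℝ F]

theorem exists_bound_iteratedFDerivWithin {S L : Set E} (hS : IsOpen S) (hL : IsCompact L)
    (hLS : L ⊆ S) {g : E → F} (hg : ContDiffOn ℝ ∞ g S) (k : ℕ) :
    ∃ D : ℝ, 1 ≤ D ∧ ∀ i ≤ k, ∀ x ∈ L, ‖iteratedFDerivWithin ℝ i g S x‖ ≤ D := by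
  have h : ∀ i : ℕ, ∃ C : ℝ, ∀ x ∈ L, ‖iteratedFDerivWithin ℝ i g S x‖ ≤ C := fun i =>
    hL.exists_bound_of_continuousOn
      ((hg.continuousOn_iteratedFDerivWithin (m := i) (mod_cast le_top) hS.uniqueDiffOn).mono hLS)
  choose C hC using h
  refine ⟨1 + ∑ i ∈ Finset.range (k + 1), |C i|, ?_, fun i hi x hx => ?_⟩
  · have : 0 ≤ ∑ i ∈ Finset.range (k + 1), |C i| := Finset.sum_nonneg fun i _ => abs_nonneg _
    linarith
  · have h1 : |C i| ≤ ∑ i ∈ Finset.range (k + 1), |C i| :=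
      Finset.single_le_sum (f := fun i => |C i|) (fun i _ => abs_nonneg _)
        (Finset.mem_range.2 (Nat.lt_succ_of_le hi))
    linarith [hC i x hx, le_abs_self (C i)]

/-- On compact sets the derivatives of `J · (f ∘ τ)` are controlled by those of `f`, with a
constant that does not depend on `f`. -/
theorem exists_bound_mul_comp {S L : Set E} (hS : IsOpen S) (hL : IsCompact L) (hLS : L ⊆ S)
    {J : E → ℝ} {τ : E → F} (hJ : ContDiffOn ℝ ∞ J S) (hτ : ContDiffOn ℝ ∞ τ S) (k : ℕ) :
    ∃ C : ℝ, 0 ≤ C ∧ ∀ f : F → ℝ, ContDiff ℝ ∞ f → ∀ b : ℝ, 0 ≤ b →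
      (∀ j ≤ k, ∀ y, ‖iteratedFDeriv ℝ j f y‖ ≤ b) →
        ∀ x ∈ L, ‖iteratedFDeriv ℝ k (fun x => J x * f (τ x)) x‖ ≤ C * b := by
  obtain ⟨D, hD1, hD⟩ := exists_bound_iteratedFDerivWithin hS hL hLS hτ k
  obtain ⟨B, hB1, hB⟩ := exists_bound_iteratedFDerivWithin hS hL hLS hJ k
  refine ⟨∑ i ∈ Finset.range (k + 1), (k.choose i : ℝ) * B * (k.factorial * D ^ k), by positivity,
    fun f hf b hb hfb x hx => ?_⟩
  have hxS := hLS hx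
  have hcomp : ContDiffOn ℝ ∞ (f ∘ τ) S := hf.comp_contDiffOn hτ
  rw [← iteratedFDerivWithin_of_isOpen k hS hxS]
  refine (norm_iteratedFDerivWithin_mul_le hJ hcomp hS.uniqueDiffOn hxS
    (n := k) (mod_cast le_top)).trans ?_
  rw [Finset.sum_mul]
  refine Finset.sum_le_sum fun i hi => ?_
  have hik : i ≤ k := Nat.lt_succ_iff.1 (Finset.mem_range.1 hi)
  have h1 : ‖iteratedFDerivWithin ℝ (k - i) (f ∘ τ) S x‖ ≤
      (k - i).factorial * b * D ^ (k - i) := by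
    refine norm_iteratedFDerivWithin_comp_le (contDiffOn_univ.2 hf) hτ (N := ∞)
      (WithTop.coe_le_coe.2 le_top)
      uniqueDiffOn_univ hS.uniqueDiffOn (mapsTo_univ _ _) hxS (fun j hj => ?_) fun j hj hj' => ?_
    · rw [iteratedFDerivWithin_univ]
      exact hfb j (hj.trans (Nat.sub_le _ _)) _
    · exact (hD j (hj'.trans (Nat.sub_le _ _)) x hx).trans (le_self_pow₀ hD1 (by omega))
  have h2 : ((k - i).factorial : ℝ) ≤ k.factorial :=
    mod_cast Nat.factorial_le (Nat.sub_le _ _)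
  have h3 : D ^ (k - i) ≤ D ^ k := pow_le_pow_right₀ hD1 (Nat.sub_le _ _)
  calc (k.choose i : ℝ) * ‖iteratedFDerivWithin ℝ i J S x‖ *
        ‖iteratedFDerivWithin ℝ (k - i) (f ∘ τ) S x‖
      ≤ (k.choose i : ℝ) * B * (k.factorial * b * D ^ k) := by
        gcongr
        · exact hB i hik x hx
        · exact h1.trans (by gcongr)
    _ = _ := by ring

end Estimates

section Iso

variable {n : ℕ} {X : Type*} [TopologicalSpace X] [ChartedSpace (Eu n) X]
  {e : OpenPartialHomeomorph X (Eu n)}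

theorem coeff_eq_zero_of_notMem_tsupport {σ : X → Covec n} {y : Eu n}
    (hy : e.symm y ∉ tsupport σ) : coeff e σ y = 0 := by
  rw [coeff_apply, image_eq_zero_of_notMem_tsupport hy]
  rfl

theorem continuous_of_source_eq_univ (hs : e.source = univ) : Continuous e := by
  have := e.continuousOn
  rwa [hs, ← continuousOn_univ.symm] at this

theorem isCompact_image_chart (hs : e.source = univ) {K : Set X} (hK : IsCompact K) :
    IsCompact (e '' K) :=
  hK.image (continuous_of_source_eq_univ hs)

theorem isCompact_preimage_chart (hs : e.source = univ) {K : Set (Eu n)} (hK : IsCompact K)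
    (hKt : K ⊆ e.target) : IsCompact (e ⁻¹' K) := by
  have h : e ⁻¹' K = e.symm '' K := by
    ext p
    constructor
    · intro hp
      exact ⟨e p, hp, e.left_inv (by simp [hs])⟩
    · rintro ⟨y, hy, rfl⟩
      rwa [mem_preimage, e.right_inv (hKt hy)]
  rw [h]
  exact hK.image_of_continuousOn (e.continuousOn_symm.mono hKt)

theorem mem_target_of_global (hs : e.source = univ) (p : X) : e p ∈ e.target :=
  e.map_source (by simp [hs])

theorem symm_apply_of_global (hs : e.source = univ) (p : X) : e.symm (e p) = p :=
  e.left_inv (by simp [hs])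

theorem support_indicator_coeff_subset (e : OpenPartialHomeomorph X (Eu n)) (σ : X → Covec n) :
    Function.support (e.target.indicator (coeff e σ)) ⊆ e '' tsupport σ := by
  intro y hy
  rw [Function.mem_support] at hy
  have hyt : y ∈ e.target := by
    by_contra h
    exact hy (indicator_of_notMem h _)
  rw [indicator_of_mem hyt] at hy
  refine ⟨e.symm y, ?_, e.right_inv hyt⟩
  by_contra h
  exact hy (coeff_eq_zero_of_notMem_tsupport h)

theorem tsupport_indicator_coeff_subset (hs : e.source = univ) {σ : X → Covec n}
    (hσ : HasCompactSupport σ) :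
    tsupport (e.target.indicator (coeff e σ)) ⊆ e '' tsupport σ :=
  closure_minimal (support_indicator_coeff_subset e σ) (isCompact_image_chart hs hσ).isClosed

theorem image_subset_target (hs : e.source = univ) (K : Set X) : e '' K ⊆ e.target := by
  rintro _ ⟨p, _, rfl⟩
  exact mem_target_of_global hs p

theorem indicator_coeff_eventuallyEq (σ : X → Covec n) {y : Eu n} (hy : y ∈ e.target) :
    e.target.indicator (coeff e σ) =ᶠ[𝓝 y] coeff e σ := by
  filter_upwards [e.open_target.mem_nhds hy] with z hz
  exact indicator_of_mem hz _

theorem contDiff_indicator_coeff (hs : e.source = univ) {σ : X → Covec n}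
    (h : ContDiffOn ℝ ∞ (coeff e σ) e.target) (hσ : HasCompactSupport σ) :
    ContDiff ℝ ∞ (e.target.indicator (coeff e σ)) := by
  rw [contDiff_iff_contDiffAt]
  intro y
  by_cases hy : y ∈ e.target
  · exact (h.contDiffAt (e.open_target.mem_nhds hy)).congr_of_eventuallyEq
      (indicator_coeff_eventuallyEq σ hy)
  · have h0 : y ∉ tsupport (e.target.indicator (coeff e σ)) := fun h' =>
      hy (image_subset_target hs _ (tsupport_indicator_coeff_subset hs hσ h'))
    exact contDiffAt_const.congr_of_eventuallyEq
      (notMem_tsupport_iff_eventuallyEq.1 h0)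

theorem tsupport_formOf_subset (hs : e.source = univ) (f : Eu n → ℝ) :
    tsupport (formOf e f) ⊆ e ⁻¹' tsupport f := by
  refine closure_minimal ?_ ((isClosed_tsupport f).preimage (continuous_of_source_eq_univ hs))
  intro p hp
  refine subset_tsupport f fun h => hp ?_
  change f (e p) • _ = _
  rw [h, zero_smul]

variable {Ω : Opens (Eu n)}

/-- The test function on the chart image belonging to a compactly supported form: its coefficient,
continued by zero. -/
def toTest (he : e ∈ charts n X) (hs : e.source = univ) (hΩ : e.target = Ω) (σ : CompactForm n X) :
    𝓓(Ω, ℝ) where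
  toFun := e.target.indicator (coeff e σ.form)
  contDiff' := contDiff_indicator_coeff hs (σ.2.1 e he) σ.2.2
  hasCompactSupport' := (isCompact_image_chart hs σ.2.2).of_isClosed_subset (isClosed_tsupport _)
    (tsupport_indicator_coeff_subset hs σ.2.2)
  tsupport_subset' := by
    rw [← hΩ]
    exact (tsupport_indicator_coeff_subset hs σ.2.2).trans (image_subset_target hs _)

theorem toTest_apply (he : e ∈ charts n X) (hs : e.source = univ) (hΩ : e.target = Ω)
    (σ : CompactForm n X) {y : Eu n} (hy : y ∈ e.target) :
    toTest he hs hΩ σ y = coeff e σ.form y :=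
  indicator_of_mem hy _

/-- The compactly supported form whose coefficient is a given test function. -/
def ofTest (he : e ∈ charts n X) (hs : e.source = univ) (hΩ : e.target = Ω) (f : 𝓓(Ω, ℝ)) :
    CompactForm n X :=
  ⟨formOf e f, isSmoothForm_of_global he hs (f.contDiff.contDiffOn.congr fun _ hx =>
    coeff_formOf he f hx), by
    have h : IsCompact (e ⁻¹' tsupport f) := isCompact_preimage_chart hs f.hasCompactSupport
      (by rw [hΩ]; exact f.tsupport_subset)
    exact h.of_isClosed_subset (isClosed_tsupport _) (tsupport_formOf_subset hs f)⟩

/-- The linear isomorphism between compactly supported forms and test functions. -/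
def testLinearEquiv (he : e ∈ charts n X) (hs : e.source = univ) (hΩ : e.target = Ω) :
    CompactForm n X ≃ₗ[ℝ] 𝓓(Ω, ℝ) where
  toFun := toTest he hs hΩ
  map_add' σ η := by
    ext y
    change e.target.indicator (coeff e (σ.form + η.form)) y =
      e.target.indicator (coeff e σ.form) y + e.target.indicator (coeff e η.form) y
    rw [coeff_add, indicator_add']
    rfl
  map_smul' c σ := by
    ext y
    change e.target.indicator (coeff e (c • σ.form)) y = c • e.target.indicator (coeff e σ.form) y
    rw [coeff_smul]
    exact congrFun (indicator_const_smul e.target c (coeff e σ.form)) y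
  invFun := ofTest he hs hΩ
  left_inv σ := by
    refine Subtype.ext (funext fun p => ?_)
    have hp := mem_target_of_global hs p
    refine eq_of_coeff_eq he (by simp [hs]) ?_
    exact (coeff_formOf he _ hp).trans (toTest_apply he hs hΩ σ hp)
  right_inv f := by
    ext y
    by_cases hy : y ∈ e.target
    · rw [toTest_apply he hs hΩ _ hy]
      exact coeff_formOf he f hy
    · change e.target.indicator _ y = _
      rw [indicator_of_notMem hy]
      refine (image_eq_zero_of_notMem_tsupport fun h => hy ?_).symm
      rw [hΩ]
      exact f.tsupport_subset h

/-- Continuity of the map from forms to test functions: a continuous seminorm on `𝓓(Ω)` is, on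
functions supported in `e '' K`, bounded by finitely many suprema of derivatives over that compact
set, hence by suprema in the single chart `e`. -/
theorem isLFSeminorm_comp_toTest (he : e ∈ charts n X) (hs : e.source = univ)
    (hΩ : e.target = Ω) {p : Seminorm ℝ 𝓓(Ω, ℝ)} (hp : Continuous p) :
    IsLFSeminorm (p.comp (testLinearEquiv he hs hΩ).toLinearMap) := by
  intro K hK
  let L : Compacts (Eu n) := ⟨e '' K, isCompact_image_chart hs hK⟩
  have hLt : (L : Set (Eu n)) ⊆ e.target := image_subset_target hs K
  have hLΩ : (L : Set (Eu n)) ⊆ Ω := hΩ ▸ hLt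
  let p' : Seminorm ℝ 𝓓_{L}(Eu n, ℝ) :=
    p.comp (TestFunction.ofSupportedInCLM ℝ hLΩ).toLinearMap
  have hp' : Continuous p' := hp.comp (TestFunction.continuous_ofSupportedIn hLΩ)
  obtain ⟨s, C, -, hC⟩ := Seminorm.bound_of_continuous
    (ContDiffMapSupportedIn.withSeminorms ℝ (Eu n) ℝ ⊤ L) p' hp'
  refine ⟨C, s.toList.map fun k => (e, (L : Set (Eu n)), k), ?_, ?_⟩
  · intro a ha
    obtain ⟨k, -, rfl⟩ := List.mem_map.1 ha
    exact ⟨he, L.isCompact, hLt⟩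
  · intro σ hσ b hb hbd
    have hsupp : Function.support (toTest he hs hΩ σ) ⊆ L :=
      (support_indicator_coeff_subset e σ.form).trans (image_mono hσ)
    let f : 𝓓_{L}(Eu n, ℝ) := ContDiffMapSupportedIn.of_support_subset
      (toTest he hs hΩ σ).contDiff hsupp
    have hf : p (testLinearEquiv he hs hΩ σ) = p' f := rfl
    change p (testLinearEquiv he hs hΩ σ) ≤ _
    rw [hf]
    refine (hC f).trans ?_
    rw [smul_apply, NNReal.smul_def, smul_eq_mul]
    refine mul_le_mul_of_nonneg_left ?_ C.2
    refine Seminorm.finset_sup_apply_le hb fun k hk => ?_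
    rw [ContDiffMapSupportedIn.seminorm_top_le_iff ℝ hb]
    intro x hx
    have h1 := hbd (e, (L : Set (Eu n)), k)
      (List.mem_map.2 ⟨k, Finset.mem_toList.2 hk, rfl⟩) x hx
    have h2 : iteratedFDeriv ℝ k f x = iteratedFDeriv ℝ k (coeff e σ.form) x :=
      ((indicator_coeff_eventuallyEq σ.form (hLt hx)).iteratedFDeriv ℝ k).self_of_nhds
    rw [h2]
    exact h1

theorem continuous_toTest (he : e ∈ charts n X) (hs : e.source = univ) (hΩ : e.target = Ω) :
    Continuous (testLinearEquiv he hs hΩ) := by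
  have hq := with_gaugeSeminormFamily (𝕜 := ℝ) (E := 𝓓(Ω, ℝ))
  refine hq.continuous_of_continuous_comp (testLinearEquiv he hs hΩ).toLinearMap fun i => ?_
  have h := isLFSeminorm_comp_toTest he hs hΩ (hq.continuous_seminorm i)
  exact withSeminorms_compactForm.continuous_seminorm ⟨_, h⟩

/-- Continuity of the inverse map, one seminorm at a time: in another chart `e'` the coefficient of
the form belonging to `f` is the Jacobian determinant times `f` composed with the transition map. -/
theorem exists_bound_coeff_ofTest (he : e ∈ charts n X) (hs : e.source = univ) (hΩ : e.target = Ω)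
    {K : Compacts (Eu n)} (hK : (K : Set (Eu n)) ⊆ Ω) {e' : OpenPartialHomeomorph X (Eu n)}
    (he' : e' ∈ charts n X) {L : Set (Eu n)} (hL : IsCompact L) (hLt : L ⊆ e'.target) (k : ℕ) :
    ∃ C : ℝ, 0 ≤ C ∧ ∀ f : 𝓓_{K}(Eu n, ℝ), ∀ x ∈ L,
      ‖iteratedFDeriv ℝ k (coeff e' (ofTest he hs hΩ (TestFunction.ofSupportedIn hK f)).form) x‖ ≤
        C * ContDiffMapSupportedIn.supSeminorm ℝ (Eu n) ℝ ⊤ K k f := by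
  have hdom : e'.target ∩ e'.symm ⁻¹' e.source = e'.target := by simp [hs]
  have h1 := contDiffOn_det_transition he' he
  have h2 := contDiffOn_transition he' he
  rw [hdom] at h1 h2
  obtain ⟨C, hC0, hC⟩ := exists_bound_mul_comp e'.open_target hL hLt h1 h2 k
  refine ⟨C, hC0, fun f x hx => ?_⟩
  have h3 : iteratedFDeriv ℝ k
      (coeff e' (ofTest he hs hΩ (TestFunction.ofSupportedIn hK f)).form) x =
      iteratedFDeriv ℝ k (fun x => (fderiv ℝ (e ∘ e'.symm) x).det * f ((e ∘ e'.symm) x)) x := by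
    refine (Filter.EventuallyEq.iteratedFDeriv ℝ ?_ k).self_of_nhds
    filter_upwards [e'.open_target.mem_nhds (hLt hx)] with z hz
    rw [coeff_transform he' he _ hz (by simp [hs])]
    congr 1
    exact coeff_formOf he _ (mem_target_of_global hs _)
  rw [h3]
  refine hC f f.contDiff _ (apply_nonneg _ _) (fun j hj y => ?_) x hx
  refine (ContDiffMapSupportedIn.norm_iteratedFDeriv_apply_le_seminorm_top ℝ).trans ?_
  exact Seminorm.le_finset_sup_apply (p := ContDiffMapSupportedIn.seminorm ℝ (Eu n) ℝ ⊤ K)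
    (Finset.mem_Iic.2 hj)

theorem continuous_ofTest (he : e ∈ charts n X) (hs : e.source = univ) (hΩ : e.target = Ω) :
    Continuous (testLinearEquiv he hs hΩ).symm := by
  have hlc : LocallyConvexSpace ℝ (CompactForm n X) :=
    withSeminorms_compactForm.toLocallyConvexSpace
  refine (TestFunction.continuous_iff_continuous_comp
    (testLinearEquiv he hs hΩ).symm.toLinearMap).2 fun K hK => ?_
  let A : 𝓓_{K}(Eu n, ℝ) →ₗ[ℝ] CompactForm n X :=
    (testLinearEquiv he hs hΩ).symm.toLinearMap ∘ₗ (TestFunction.ofSupportedInCLM ℝ hK).toLinearMap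
  refine withSeminorms_compactForm.continuous_of_continuous_comp A fun q => ?_
  have hKt : (K : Set (Eu n)) ⊆ e.target := hΩ ▸ hK
  obtain ⟨C, s, hsl, hbd⟩ := q.2 (e ⁻¹' K) (isCompact_preimage_chart hs K.isCompact hKt)
  have key : ∀ t : List (OpenPartialHomeomorph X (Eu n) × Set (Eu n) × ℕ),
      (∀ a ∈ t, a.1 ∈ charts n X ∧ IsCompact a.2.1 ∧ a.2.1 ⊆ a.1.target) →
      ∃ (B : ℝ) (N : ℕ), 0 ≤ B ∧ ∀ f : 𝓓_{K}(Eu n, ℝ), ∀ a ∈ t, ∀ x ∈ a.2.1,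
        ‖iteratedFDeriv ℝ a.2.2 (coeff a.1 (A f).form) x‖ ≤
          B * ContDiffMapSupportedIn.supSeminorm ℝ (Eu n) ℝ ⊤ K N f := by
    intro t
    induction t with
    | nil => exact fun _ => ⟨0, 0, le_rfl, by simp⟩
    | cons a t ih =>
      intro ht
      obtain ⟨B, N, hB, hBN⟩ := ih fun b hb => ht b (List.mem_cons_of_mem _ hb)
      obtain ⟨ha1, ha2, ha3⟩ := ht a List.mem_cons_self
      obtain ⟨B', hB', hBN'⟩ := exists_bound_coeff_ofTest he hs hΩ hK ha1 ha2 ha3 a.2.2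
      have hmono : ∀ (i j : ℕ) (f : 𝓓_{K}(Eu n, ℝ)), i ≤ j →
          ContDiffMapSupportedIn.supSeminorm ℝ (Eu n) ℝ ⊤ K i f ≤
            ContDiffMapSupportedIn.supSeminorm ℝ (Eu n) ℝ ⊤ K j f := fun i j f hij =>
        (Finset.sup_mono (Finset.Iic_subset_Iic.2 hij) :
          ContDiffMapSupportedIn.supSeminorm ℝ (Eu n) ℝ ⊤ K i ≤
            ContDiffMapSupportedIn.supSeminorm ℝ (Eu n) ℝ ⊤ K j) f
      refine ⟨max B B', max N a.2.2, le_max_of_le_left hB, fun f b hb x hx => ?_⟩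
      rcases List.mem_cons.1 hb with rfl | hb
      · refine (hBN' f x hx).trans ?_
        exact mul_le_mul (le_max_right _ _) (hmono _ _ f (le_max_right _ _)) (apply_nonneg _ _)
          (le_max_of_le_left hB)
      · refine (hBN f b hb x hx).trans ?_
        exact mul_le_mul (le_max_left _ _) (hmono _ _ f (le_max_left _ _)) (apply_nonneg _ _)
          (le_max_of_le_left hB)
  obtain ⟨B, N, hB, hBN⟩ := key s hsl
  have hcont : Continuous fun f : 𝓓_{K}(Eu n, ℝ) =>
      |C| * B * ContDiffMapSupportedIn.supSeminorm ℝ (Eu n) ℝ ⊤ K N f :=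
    continuous_const.mul
      ((ContDiffMapSupportedIn.withSeminorms' ℝ (Eu n) ℝ ⊤ K).continuous_seminorm N)
  have hle : ∀ f : 𝓓_{K}(Eu n, ℝ), q.1 (A f) ≤
      |C| * B * ContDiffMapSupportedIn.supSeminorm ℝ (Eu n) ℝ ⊤ K N f := by
    intro f
    have hnn : 0 ≤ B * ContDiffMapSupportedIn.supSeminorm ℝ (Eu n) ℝ ⊤ K N f :=
      mul_nonneg hB (apply_nonneg _ _)
    have hsub : tsupport (A f).form ⊆ e ⁻¹' K :=
      (tsupport_formOf_subset hs _).trans (preimage_mono f.tsupport_subset)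
    have := hbd (A f) hsub _ hnn (fun a ha x hx => hBN f a ha x hx)
    rw [mul_assoc]
    exact this.trans (mul_le_mul_of_nonneg_right (le_abs_self C) hnn)
  refine Seminorm.continuous_of_continuousAt_zero (p := q.1.comp A) ?_
  have h0 : Tendsto (fun f : 𝓓_{K}(Eu n, ℝ) =>
      |C| * B * ContDiffMapSupportedIn.supSeminorm ℝ (Eu n) ℝ ⊤ K N f) (𝓝 0) (𝓝 0) := by
    have := hcont.tendsto 0
    simpa using this
  have h1 : (q.1.comp A) 0 = 0 := map_zero _
  rw [ContinuousAt, h1]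
  exact squeeze_zero (fun f => apply_nonneg _ _) hle h0

/-- In a global chart with image `Ω` the space `Ω^n_c(X)` is topologically isomorphic to
`𝓓(Ω)`. -/
def testEquiv (he : e ∈ charts n X) (hs : e.source = univ) (hΩ : e.target = Ω) :
    CompactForm n X ≃L[ℝ] 𝓓(Ω, ℝ) :=
  { testLinearEquiv he hs hΩ with
    continuous_toFun := continuous_toTest he hs hΩ
    continuous_invFun := continuous_ofTest he hs hΩ }

theorem testEquiv_apply (he : e ∈ charts n X) (hs : e.source = univ) (hΩ : e.target = Ω)
    (σ : CompactForm n X) {y : Eu n} (hy : y ∈ e.target) :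
    testEquiv he hs hΩ σ y = coeff e σ.form y :=
  toTest_apply he hs hΩ σ hy

end Iso

/-! ### Transport of spaces of smooth maps -/

section Transport

variable {n : ℕ} {X Y : Type*} [TopologicalSpace X] [ChartedSpace (Eu n) X]
  [TopologicalSpace Y] [ChartedSpace (Eu n) Y]
  {F G : Type*} [AddCommGroup F] [Module ℝ F] [TopologicalSpace F]
  [AddCommGroup G] [Module ℝ G] [TopologicalSpace G]

theorem IsDerivFamily.map {V : Type*} [NormedAddCommGroup V] [NormedSpace ℝ V] {S : Set V}
    {D : List V → V → F} (hD : IsDerivFamily S D) (A : F →L[ℝ] G) :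
    IsDerivFamily S fun l z => A (D l z) := fun l =>
  ⟨A.continuous.comp_continuousOn (hD l).1, fun v x hx => by
    refine ((A.continuous.tendsto _).comp ((hD l).2 v x hx)).congr fun t => ?_
    simp⟩

/-- The curried map `(ε, y) ↦ A (f (ε, h⁻¹ y))`. -/
def transportFun (h : X ≃ₜ Y) (A : F ≃L[ℝ] G) (f : Param → X → F) : Param → Y → G :=
  fun ε y => A (f ε (h.symm y))

theorem transportFun_symm (h : X ≃ₜ Y) (A : F ≃L[ℝ] G) (f : Param → X → F) :
    transportFun h.symm A.symm (transportFun h A f) = f := by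
  funext ε p
  simp [transportFun]

/-- The derivative family of a transported map consists of the images under `A` of the original one,
in the corresponding chart. -/
theorem isDerivFamilyOf_transport (h : X ≃ₜ Y) (A : F ≃L[ℝ] G) {f : Param → X → F}
    {d : OpenPartialHomeomorph Y (Eu n)} {D : List (ℝ × Eu n) → ℝ × Eu n → F}
    (hD : IsDerivFamilyOf f (h.transOpenPartialHomeomorph d) D) :
    IsDerivFamilyOf (transportFun h A f) d fun l z => A (D l z) :=
  ⟨hD.1.map (A : F →L[ℝ] G), fun ε x hx => congrArg A (hD.2 ε x hx)⟩

theorem isDerivFamilyOf_of_transport (h : X ≃ₜ Y) (A : F ≃L[ℝ] G) {f : Param → X → F}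
    {d : OpenPartialHomeomorph Y (Eu n)} {D : List (ℝ × Eu n) → ℝ × Eu n → G}
    (hD : IsDerivFamilyOf (transportFun h A f) d D) :
    IsDerivFamilyOf f (h.transOpenPartialHomeomorph d) fun l z => A.symm (D l z) :=
  ⟨hD.1.map (A.symm : G →L[ℝ] F), fun ε x hx => by
    exact (congrArg A.symm (hD.2 ε x hx)).trans (A.symm_apply_apply _)⟩

variable [IsTopologicalAddGroup F] [ContinuousSMul ℝ F] [IsTopologicalAddGroup G]
  [ContinuousSMul ℝ G]

theorem isSmoothMap_transport {h : X ≃ₜ Y}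
    (hh : ∀ d ∈ charts n Y, h.transOpenPartialHomeomorph d ∈ charts n X) (A : F ≃L[ℝ] G)
    {f : Param → X → F} (hf : IsSmoothMap (n := n) f) :
    IsSmoothMap (n := n) (transportFun h A f) := fun d hd =>
  let ⟨_, hD⟩ := hf _ (hh d hd)
  ⟨_, isDerivFamilyOf_transport h A hD⟩

/-- A homeomorphism that matches the charts and an isomorphism of the target spaces induce a linear
isomorphism of spaces of smooth maps. -/
def transportEquiv (h : X ≃ₜ Y)
    (hh : ∀ d ∈ charts n Y, h.transOpenPartialHomeomorph d ∈ charts n X)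
    (hh' : ∀ c ∈ charts n X, h.symm.transOpenPartialHomeomorph c ∈ charts n Y) (A : F ≃L[ℝ] G) :
    SmoothMaps n X F ≃ₗ[ℝ] SmoothMaps n Y G where
  toFun f := ⟨transportFun h A f.1, isSmoothMap_transport hh A f.2⟩
  map_add' _ _ := Subtype.ext <| funext fun _ => funext fun _ => map_add A _ _
  map_smul' _ _ := Subtype.ext <| funext fun _ => funext fun _ => map_smul A _ _
  invFun f := ⟨transportFun h.symm A.symm f.1, isSmoothMap_transport hh' A.symm f.2⟩
  left_inv f := Subtype.ext (transportFun_symm h A f.1)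
  right_inv f := Subtype.ext (transportFun_symm h.symm A.symm f.1)

theorem isBoundedSet_transport (h : X ≃ₜ Y)
    (hh : ∀ d ∈ charts n Y, h.transOpenPartialHomeomorph d ∈ charts n X)
    (hh' : ∀ c ∈ charts n X, h.symm.transOpenPartialHomeomorph c ∈ charts n Y) (A : F ≃L[ℝ] G)
    {B : Set (SmoothMaps n X F)} (hB : IsBoundedSet B) :
    IsBoundedSet (transportEquiv h hh hh' A '' B) := by
  intro d hd L hL hLs l
  have h1 := hB _ (hh d hd) L hL hLs l
  refine (h1.image (A : F →L[ℝ] G)).subset ?_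
  rintro _ ⟨_, ⟨f, hf, rfl⟩, D, hD, z, hz, rfl⟩
  exact ⟨A.symm (D l z), ⟨f, hf, _, isDerivFamilyOf_of_transport h A hD, z, hz, rfl⟩,
    A.apply_symm_apply _⟩

theorem isBoundedSet_transport_iff (h : X ≃ₜ Y)
    (hh : ∀ d ∈ charts n Y, h.transOpenPartialHomeomorph d ∈ charts n X)
    (hh' : ∀ c ∈ charts n X, h.symm.transOpenPartialHomeomorph c ∈ charts n Y) (A : F ≃L[ℝ] G)
    (B : Set (SmoothMaps n X F)) :
    IsBoundedSet B ↔ IsBoundedSet (transportEquiv h hh hh' A '' B) := by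
  refine ⟨isBoundedSet_transport h hh hh' A, fun hB => ?_⟩
  have h1 := isBoundedSet_transport h.symm hh' hh A.symm hB
  have h2 : transportEquiv h.symm hh' hh A.symm '' (transportEquiv h hh hh' A '' B) = B := by
    rw [image_image]
    refine (image_congr fun f _ => ?_).trans (image_id B)
    exact (transportEquiv h hh hh' A).symm_apply_apply f
  rwa [h2] at h1

end Transport

section GlobalChart

variable {n : ℕ} {X : Type*} [TopologicalSpace X] [ChartedSpace (Eu n) X]
  {e : OpenPartialHomeomorph X (Eu n)} {Ω : Opens (Eu n)}

/-- A global chart, as a homeomorphism onto its image. -/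
def chartHomeo (hs : e.source = univ) (hΩ : e.target = Ω) : X ≃ₜ Ω where
  toFun p := ⟨e p, hΩ.subset (mem_target_of_global hs p)⟩
  invFun x := e.symm x
  left_inv p := symm_apply_of_global hs p
  right_inv x := Subtype.ext (e.right_inv (hΩ.symm.subset x.2))
  continuous_toFun := (continuous_of_source_eq_univ hs).subtype_mk _
  continuous_invFun := by
    have h : ContinuousOn e.symm (Ω : Set (Eu n)) := hΩ ▸ e.continuousOn_symm
    exact h.comp_continuous continuous_subtype_val fun x => x.2

theorem coe_chartHomeo (hs : e.source = univ) (hΩ : e.target = Ω) (p : X) :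
    (chartHomeo hs hΩ p : Eu n) = e p := rfl

theorem chartHomeo_symm_apply (hs : e.source = univ) (hΩ : e.target = Ω) (x : Ω) :
    (chartHomeo hs hΩ).symm x = e.symm x := rfl

variable [IsManifold 𝓘(ℝ, Eu n) ∞ X]

theorem contMDiff_chartHomeo (he : e ∈ charts n X) (hs : e.source = univ) (hΩ : e.target = Ω) :
    ContMDiff 𝓘(ℝ, Eu n) 𝓘(ℝ, Eu n) ∞ (chartHomeo hs hΩ) := by
  rw [← ContMDiff.subtypeVal_comp_iff]
  have h := contMDiffOn_of_mem_maximalAtlas he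
  rw [hs, contMDiffOn_univ] at h
  exact h

theorem contMDiff_chartHomeo_symm (he : e ∈ charts n X) (hs : e.source = univ)
    (hΩ : e.target = Ω) : ContMDiff 𝓘(ℝ, Eu n) 𝓘(ℝ, Eu n) ∞ (chartHomeo hs hΩ).symm := by
  have h := contMDiffOn_symm_of_mem_maximalAtlas he
  rw [hΩ] at h
  exact h.comp_contMDiff contMDiff_subtype_val fun x => x.2

theorem chartHomeo_trans_mem_charts (he : e ∈ charts n X) (hs : e.source = univ)
    (hΩ : e.target = Ω) {d : OpenPartialHomeomorph Ω (Eu n)} (hd : d ∈ charts n Ω) :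
    (chartHomeo hs hΩ).transOpenPartialHomeomorph d ∈ charts n X :=
  (IsManifold.mem_maximalAtlas_iff_contMDiffOn _).2
    ⟨(contMDiffOn_of_mem_maximalAtlas hd).comp (contMDiff_chartHomeo he hs hΩ).contMDiffOn
      fun _ hp => hp,
    (contMDiff_chartHomeo_symm he hs hΩ).comp_contMDiffOn
      (contMDiffOn_symm_of_mem_maximalAtlas hd)⟩

theorem chartHomeo_symm_trans_mem_charts (he : e ∈ charts n X) (hs : e.source = univ)
    (hΩ : e.target = Ω) {c : OpenPartialHomeomorph X (Eu n)} (hc : c ∈ charts n X) :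
    (chartHomeo hs hΩ).symm.transOpenPartialHomeomorph c ∈ charts n Ω :=
  (IsManifold.mem_maximalAtlas_iff_contMDiffOn _).2
    ⟨(contMDiffOn_of_mem_maximalAtlas hc).comp (contMDiff_chartHomeo_symm he hs hΩ).contMDiffOn
      fun _ hp => hp,
    (contMDiff_chartHomeo he hs hΩ).comp_contMDiffOn
      (contMDiffOn_symm_of_mem_maximalAtlas hc)⟩

/-- The isomorphism `C^∞(I × X, Ω^n_c(X)) → C^∞(I × Ω, 𝓓(Ω))` belonging to a global chart. -/
def kernelEquiv (he : e ∈ charts n X) (hs : e.source = univ) (hΩ : e.target = Ω) :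
    SmoothMaps n X (CompactForm n X) ≃ₗ[ℝ] SmoothMaps n Ω 𝓓(Ω, ℝ) :=
  transportEquiv (chartHomeo hs hΩ) (fun _ hd => chartHomeo_trans_mem_charts he hs hΩ hd)
    (fun _ hc => chartHomeo_symm_trans_mem_charts he hs hΩ hc) (testEquiv he hs hΩ)

theorem kernelEquiv_apply (he : e ∈ charts n X) (hs : e.source = univ) (hΩ : e.target = Ω)
    (Φ : SmoothMaps n X (CompactForm n X)) (ε : Param) (x : Ω) :
    (kernelEquiv he hs hΩ Φ).1 ε x = testEquiv he hs hΩ (Φ.1 ε (e.symm x)) := rfl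

theorem isBoundedSet_kernelEquiv_iff (he : e ∈ charts n X) (hs : e.source = univ)
    (hΩ : e.target = Ω) (B : Set (SmoothMaps n X (CompactForm n X))) :
    IsBoundedSet B ↔ IsBoundedSet (kernelEquiv he hs hΩ '' B) :=
  isBoundedSet_transport_iff _ _ _ _ B

end GlobalChart

/-! ### Integration of forms -/

section Integral

variable {n : ℕ} {X : Type*} [TopologicalSpace X] [ChartedSpace (Eu n) X]
  {e : OpenPartialHomeomorph X (Eu n)} {o σ : X → Covec n}

theorem det_transition_pos {e' : OpenPartialHomeomorph X (Eu n)} (he : e ∈ charts n X)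
    (he' : e' ∈ charts n X) (hpos : IsPositiveChart o e) (hpos' : IsPositiveChart o e') {x : Eu n}
    (hx : x ∈ e.target) (hx' : e.symm x ∈ e'.source) : 0 < (fderiv ℝ (e' ∘ e.symm) x).det := by
  have h1 := hpos x hx
  rw [coeff_transform he he' o hx hx'] at h1
  exact pos_of_mul_pos_left h1 (hpos' _ (e'.map_source hx')).le

/-- The change of variables formula, localised by a function `ρ` supported in the domain of `e'`.
Both charts being positive, the determinant of the transition map is its own absolute value. -/
theorem setIntegral_chart_eq {e' : OpenPartialHomeomorph X (Eu n)} (he : e ∈ charts n X)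
    (hs : e.source = univ) (he' : e' ∈ charts n X) (hpos : IsPositiveChart o e)
    (hpos' : IsPositiveChart o e') {ρ : X → ℝ} (hρ : tsupport ρ ⊆ e'.source) (σ : X → Covec n) :
    ∫ x in e'.target, ρ (e'.symm x) * coeff e' σ x =
      ∫ y in e.target, ρ (e.symm y) * coeff e σ y := by
  have hsrc : ∀ x, e'.symm x ∈ e.source := fun x => by simp [hs]
  have hdiff : ∀ x ∈ e'.target,
      HasFDerivWithinAt (e ∘ e'.symm) (fderiv ℝ (e ∘ e'.symm) x) e'.target x := fun x hx =>
    (differentiableAt_transition he' he ⟨hx, hsrc x⟩).hasFDerivAt.hasFDerivWithinAt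
  have hinj : InjOn (e ∘ e'.symm) e'.target := fun x hx y hy hxy =>
    e'.symm.injOn hx hy (e.injOn (hsrc x) (hsrc y) hxy)
  have hsub : (e ∘ e'.symm) '' e'.target ⊆ e.target := by
    rintro _ ⟨x, _, rfl⟩
    exact mem_target_of_global hs _
  have h1 := integral_image_eq_integral_abs_det_fderiv_smul volume e'.open_target.measurableSet
    hdiff hinj fun y => ρ (e.symm y) * coeff e σ y
  have h2 : ∫ y in (e ∘ e'.symm) '' e'.target, ρ (e.symm y) * coeff e σ y =
      ∫ y in e.target, ρ (e.symm y) * coeff e σ y := by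
    refine (setIntegral_eq_of_subset_of_forall_sdiff_eq_zero e.open_target.measurableSet hsub
      fun y hy => ?_).symm
    have : ρ (e.symm y) = 0 := by
      refine image_eq_zero_of_notMem_tsupport fun h => hy.2 ⟨e' (e.symm y), ?_, ?_⟩
      · exact e'.map_source (hρ h)
      · simp only [Function.comp_apply]
        rw [e'.left_inv (hρ h), e.right_inv hy.1]
    rw [this, zero_mul]
  rw [← h2, h1]
  refine setIntegral_congr_fun e'.open_target.measurableSet fun x hx => ?_
  have h3 := det_transition_pos he' he hpos' hpos hx (hsrc x)
  simp only [Function.comp_apply] at h3 ⊢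
  rw [coeff_transform he' he σ hx (hsrc x), abs_of_pos h3, e.left_inv (hsrc x), smul_eq_mul]
  simp only [Function.comp_def]
  ring

theorem integrableOn_mul_coeff (hs : e.source = univ) {ρ : X → ℝ} (hρ : Continuous ρ)
    (hσ : ContinuousOn (coeff e σ) e.target) (hc : HasCompactSupport σ) :
    IntegrableOn (fun y => ρ (e.symm y) * coeff e σ y) e.target := by
  have h1 : ContinuousOn (fun y => ρ (e.symm y) * coeff e σ y) e.target :=
    (hρ.comp_continuousOn e.continuousOn_symm).mul hσ
  have h2 : IntegrableOn (fun y => ρ (e.symm y) * coeff e σ y) (e '' tsupport σ) :=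
    (h1.mono (image_subset_target hs _)).integrableOn_compact (isCompact_image_chart hs hc)
  refine h2.of_forall_sdiff_eq_zero e.open_target.measurableSet fun y hy => ?_
  rw [coeff_eq_zero_of_notMem_tsupport, mul_zero]
  exact fun h => hy.2 ⟨_, h, e.right_inv hy.1⟩

variable [IsManifold 𝓘(ℝ, Eu n) ∞ X]

/-- The integral of a form is the integral of its coefficient in a positive global chart; in
particular it does not depend on the charts and the partition of unity. -/
theorem formIntegral_eq (he : e ∈ charts n X) (hs : e.source = univ) (hpos : IsPositiveChart o e)
    (hσ : ContinuousOn (coeff e σ) e.target) (hc : HasCompactSupport σ) :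
    formIntegral o σ = ∫ y in e.target, coeff e σ y := by
  have hex : ∃ c, HasFormIntegral o σ c := by
    refine ⟨_, 1, fun _ => e, fun _ _ => 1, fun _ => ⟨he, hpos⟩, fun _ => ⟨contMDiff_const, ?_⟩,
      fun p _ => by simp, rfl⟩
    rw [hs]
    exact subset_univ _
  rw [formIntegral, dif_pos hex]
  obtain ⟨N, d, ρ, hd, hρ, hsum, hval⟩ := hex.choose_spec
  rw [hval]
  have h1 : ∀ i, ∫ x in (d i).target, ρ i ((d i).symm x) * coeff (d i) σ x =
      ∫ y in e.target, ρ i (e.symm y) * coeff e σ y := fun i =>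
    setIntegral_chart_eq he hs (hd i).1 hpos (hd i).2 (hρ i).2 σ
  simp only [h1]
  rw [← integral_finsetSum _ fun i _ => integrableOn_mul_coeff hs (hρ i).1.continuous hσ hc]
  refine setIntegral_congr_fun e.open_target.measurableSet fun y hy => ?_
  by_cases h : e.symm y ∈ tsupport σ
  · rw [← Finset.sum_mul, hsum _ h, one_mul]
  · simp [coeff_eq_zero_of_notMem_tsupport h]

variable {Ω : Opens (Eu n)}

theorem coeff_smul_fun (e : OpenPartialHomeomorph X (Eu n)) (f : X → ℝ) (σ : X → Covec n)
    (y : Eu n) : coeff e (fun q => f q • σ q) y = f (e.symm y) * coeff e σ y := rfl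

theorem formIntegral_smul_eq (he : e ∈ charts n X) (hs : e.source = univ) (hΩ : e.target = Ω)
    (hpos : IsPositiveChart o e) {f : X → ℝ} (hf : Continuous f) (σ : CompactForm n X) :
    formIntegral o (fun q => f q • σ.form q) =
      ∫ y in (Ω : Set (Eu n)), f (e.symm y) * testEquiv he hs hΩ σ y := by
  rw [formIntegral_eq he hs hpos, ← hΩ]
  · refine setIntegral_congr_fun e.open_target.measurableSet fun y hy => ?_
    simp only [coeff_smul_fun]
    rw [testEquiv_apply he hs hΩ σ hy]
  · exact (hf.comp_continuousOn e.continuousOn_symm).mul (σ.2.1 e he).continuousOn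
  · exact σ.2.2.smul_left (f := f)

theorem normalized_iff (he : e ∈ charts n X) (hs : e.source = univ) (hΩ : e.target = Ω)
    (hpos : IsPositiveChart o e) (Φ : SmoothMaps n X (CompactForm n X)) :
    Normalized o Φ.1 ↔ LocalNormalized (kernelEquiv he hs hΩ Φ).1 := by
  have key : ∀ ε p, formIntegral o (Φ.1 ε p).form =
      ∫ y in (Ω : Set (Eu n)), (kernelEquiv he hs hΩ Φ).1 ε (chartHomeo hs hΩ p) y := by
    intro ε p
    have h := formIntegral_smul_eq he hs hΩ hpos (f := fun _ => 1) continuous_const (Φ.1 ε p)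
    simp only [one_smul, one_mul] at h
    rw [h, kernelEquiv_apply, coe_chartHomeo, symm_apply_of_global hs]
  constructor
  · intro h ε x
    have := key ε ((chartHomeo hs hΩ).symm x)
    rw [h, Homeomorph.apply_symm_apply] at this
    exact this.symm
  · intro h ε p
    rw [key]
    exact h ε _

theorem approxCondition_iff (he : e ∈ charts n X) (hs : e.source = univ) (hΩ : e.target = Ω)
    (hpos : IsPositiveChart o e) (Φ : SmoothMaps n X (CompactForm n X)) (k : ℕ) :
    ApproxCondition o k Φ.1 ↔ LocalApproxCondition k (kernelEquiv he hs hΩ Φ).1 := by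
  have hsm := contMDiffOn_of_mem_maximalAtlas he
  rw [hs, contMDiffOn_univ] at hsm
  have hsm' := contMDiffOn_symm_of_mem_maximalAtlas he
  rw [hΩ] at hsm'
  constructor
  · intro h f hf K hK
    have hfe : ContMDiff 𝓘(ℝ, Eu n) 𝓘(ℝ, ℝ) ∞ (f ∘ e) :=
      (contMDiffOn_iff_contDiffOn.2 hf).comp_contMDiff hsm fun p =>
        hΩ.subset (mem_target_of_global hs p)
    obtain ⟨ε₀, hε₀, C, hC⟩ := h (f ∘ e) hfe _ (hK.image (chartHomeo hs hΩ).symm.continuous)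
    refine ⟨ε₀, hε₀, C, fun ε hε x hx => ?_⟩
    have h1 := hC ε hε _ (mem_image_of_mem _ hx)
    rw [formIntegral_smul_eq he hs hΩ hpos hfe.continuous] at h1
    have hx' : e (e.symm x) = x := e.right_inv (hΩ.symm.subset x.2)
    have h2 : ∫ y in (Ω : Set (Eu n)), f y * (kernelEquiv he hs hΩ Φ).1 ε x y =
        ∫ y in (Ω : Set (Eu n)), (f ∘ e) (e.symm y) *
          testEquiv he hs hΩ (Φ.1 ε ((chartHomeo hs hΩ).symm x)) y := by
      refine setIntegral_congr_fun Ω.isOpen.measurableSet fun y hy => ?_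
      simp only [Function.comp_apply]
      rw [e.right_inv (hΩ.symm.subset hy)]
      rfl
    rw [h2]
    rw [Function.comp_apply, chartHomeo_symm_apply, hx'] at h1
    exact h1
  · intro h f hf K hK
    have hfe : ContDiffOn ℝ ∞ (f ∘ e.symm) Ω :=
      contMDiffOn_iff_contDiffOn.1 (hf.comp_contMDiffOn hsm')
    obtain ⟨ε₀, hε₀, C, hC⟩ := h (f ∘ e.symm) hfe _ (hK.image (chartHomeo hs hΩ).continuous)
    refine ⟨ε₀, hε₀, C, fun ε hε p hp => ?_⟩
    have h1 := hC ε hε _ (mem_image_of_mem _ hp)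
    rw [formIntegral_smul_eq he hs hΩ hpos hf.continuous]
    rw [kernelEquiv_apply, coe_chartHomeo, Function.comp_apply, symm_apply_of_global hs] at h1
    exact h1

end Integral

/-! ### Riemannian metrics in a global chart -/

section Comparison

variable {n : ℕ} {X : Type*} [TopologicalSpace X] [ChartedSpace (Eu n) X]
  [IsManifold 𝓘(ℝ, Eu n) ∞ X] {e : OpenPartialHomeomorph X (Eu n)}

theorem chartAt_mem_charts (p : X) : chartAt (Eu n) p ∈ charts n X :=
  IsManifold.chart_mem_maximalAtlas p

/-- The norm of a tangent vector at `p` with respect to `g`. -/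
def vecNorm (g : Metric n X) (p : X) (v : Eu n) : ℝ :=
  letI : RiemannianBundle (fun p : X => TangentSpace 𝓘(ℝ, Eu n) p) := ⟨g.toRiemannianMetric⟩
  letI w : TangentSpace 𝓘(ℝ, Eu n) p := v
  ‖w‖

attribute [local instance] normedAddCommGroupTangentSpaceVectorSpace
attribute [local instance] normedSpaceTangentSpaceVectorSpace

theorem vecNorm_nonneg (g : Metric n X) (p : X) (v : Eu n) : 0 ≤ vecNorm g p v := by
  let : RiemannianBundle (fun p : X => TangentSpace 𝓘(ℝ, Eu n) p) := ⟨g.toRiemannianMetric⟩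
  exact norm_nonneg (E := TangentSpace 𝓘(ℝ, Eu n) p) v

theorem exists_bound_fderiv_transition {e' : OpenPartialHomeomorph X (Eu n)} (he : e ∈ charts n X)
    (he' : e' ∈ charts n X) {p : X} (hp : p ∈ e.source) (hp' : p ∈ e'.source) :
    ∃ C : ℝ, 0 < C ∧ ∀ᶠ q in 𝓝 p, ‖fderiv ℝ (e' ∘ e.symm) (e q)‖ ≤ C := by
  have hx : e p ∈ e.target ∩ e.symm ⁻¹' e'.source :=
    ⟨e.map_source hp, by rwa [mem_preimage, e.left_inv hp]⟩
  have h1 : ContinuousAt (fderiv ℝ (e' ∘ e.symm)) (e p) :=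
    ((contDiffOn_transition he he').continuousOn_fderiv_of_isOpen
      (isOpen_transition_source e e') (by simp)).continuousAt
      ((isOpen_transition_source e e').mem_nhds hx)
  have h2 : ContinuousAt (fun q => ‖fderiv ℝ (e' ∘ e.symm) (e q)‖) p :=
    (ContinuousAt.comp (f := e) h1 (e.continuousAt hp)).norm
  refine ⟨‖fderiv ℝ (e' ∘ e.symm) (e p)‖ + 1, by positivity, ?_⟩
  filter_upwards [h2.eventually (gt_mem_nhds (lt_add_one _))] with q hq using hq.le

/-- Near a point, the norm of `g` is equivalent to the Euclidean norm in the chart. -/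
theorem eventually_chartD_compare (g : Metric n X) (he : e ∈ charts n X) {p : X}
    (hp : p ∈ e.source) :
    ∃ C : ℝ, 0 < C ∧ ∀ᶠ q in 𝓝 p, ∀ v : Eu n,
      ‖chartD e q v‖ ≤ C * vecNorm g q v ∧ vecNorm g q v ≤ C * ‖chartD e q v‖ := by
  let : RiemannianBundle (fun p : X => TangentSpace 𝓘(ℝ, Eu n) p) := ⟨g.toRiemannianMetric⟩
  have hcont : IsContinuousRiemannianBundle (Eu n) (fun p : X => TangentSpace 𝓘(ℝ, Eu n) p) :=
    ⟨g.inner, g.contMDiff.continuous, fun _ _ _ => rfl⟩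
  have hM : IsManifold 𝓘(ℝ, Eu n) 1 X := IsManifold.of_le (n := ∞) (by simp)
  set c := chartAt (Eu n) p with hc
  have hcm : c ∈ charts n X := chartAt_mem_charts p
  have hpc : p ∈ c.source := mem_chart_source _ p
  obtain ⟨C1, hC1, h1⟩ := eventually_norm_mfderiv_extChartAt_lt 𝓘(ℝ, Eu n) p
  obtain ⟨C2, hC2, h2⟩ := eventually_norm_mfderivWithin_symm_extChartAt_comp_lt 𝓘(ℝ, Eu n) p
  obtain ⟨C3, hC3, h3⟩ := exists_bound_fderiv_transition hcm he hpc hp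
  obtain ⟨C4, hC4, h4⟩ := exists_bound_fderiv_transition he hcm hp hpc
  refine ⟨C3 * C1 + C2 * C4, by positivity, ?_⟩
  filter_upwards [h1, h2, h3, h4, c.open_source.mem_nhds hpc, e.open_source.mem_nhds hp]
    with q h1 h2 h3 h4 hqc hqe v
  have hv0 : 0 ≤ vecNorm g q v := vecNorm_nonneg g q v
  have hD1 : ‖chartD c q v‖ ≤ C1 * vecNorm g q v := by
    have h := (mfderiv 𝓘(ℝ, Eu n) 𝓘(ℝ, Eu n) (extChartAt 𝓘(ℝ, Eu n) p) q).le_opNorm v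
    have h' : (extChartAt 𝓘(ℝ, Eu n) p : X → Eu n) = c := by
      simp [extChartAt, hc]
    refine (le_of_eq ?_).trans (h.trans (mul_le_mul_of_nonneg_right h1.le hv0))
    rw [h']
    rfl
  have hD2 : vecNorm g q v ≤ C2 * ‖chartD c q v‖ := by
    have key := (ContinuousLinearMap.le_opNorm _ (chartD c q v)).trans
      (mul_le_mul_of_nonneg_right h2.le (norm_nonneg (E := Eu n) (chartD c q v)))
    simp only [mfld_simps, mfderivWithin_univ] at key
    change vecNorm g (c.symm (c q)) (chartDSymm c (c q) (chartD c q v)) ≤ _ at key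
    rwa [c.left_inv hqc, chartDSymm_chartD hcm hqc] at key
  constructor
  · rw [chartD_eq_comp hcm he hqc hqe]
    calc _ ≤ ‖fderiv ℝ (e ∘ c.symm) (c q)‖ * ‖chartD c q v‖ := ContinuousLinearMap.le_opNorm _ _
      _ ≤ C3 * (C1 * vecNorm g q v) := by gcongr
      _ ≤ _ := by nlinarith [mul_nonneg (mul_nonneg hC2.le hC4.le) hv0]
  · have h5 : ‖chartD c q v‖ ≤ C4 * ‖chartD e q v‖ := by
      rw [chartD_eq_comp he hcm hqe hqc]
      exact (ContinuousLinearMap.le_opNorm _ _).trans (by gcongr)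
    calc _ ≤ C2 * (C4 * ‖chartD e q v‖) := hD2.trans (by gcongr)
      _ ≤ _ := by nlinarith [mul_nonneg (mul_nonneg hC3.le hC1.le) (norm_nonneg (chartD e q v))]

/-- On compact sets the norm of `g` is equivalent to the Euclidean norm in the chart. -/
theorem exists_chartD_compare (g : Metric n X) (he : e ∈ charts n X) (hs : e.source = univ)
    {K : Set X} (hK : IsCompact K) :
    ∃ C : ℝ, 0 < C ∧ ∀ q ∈ K, ∀ v : Eu n,
      ‖chartD e q v‖ ≤ C * vecNorm g q v ∧ vecNorm g q v ≤ C * ‖chartD e q v‖ := by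
  have hv0 := vecNorm_nonneg g
  have hmono : ∀ (C C' : ℝ) (q : X) (v : Eu n), C ≤ C' →
      ‖chartD e q v‖ ≤ C * vecNorm g q v ∧ vecNorm g q v ≤ C * ‖chartD e q v‖ →
      ‖chartD e q v‖ ≤ C' * vecNorm g q v ∧ vecNorm g q v ≤ C' * ‖chartD e q v‖ :=
    fun C C' q v hC h => ⟨h.1.trans (mul_le_mul_of_nonneg_right hC (hv0 q v)),
      h.2.trans (mul_le_mul_of_nonneg_right hC (norm_nonneg _))⟩
  refine hK.induction_on (p := fun s => ∃ C : ℝ, 0 < C ∧ ∀ q ∈ s, ∀ v : Eu n,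
      ‖chartD e q v‖ ≤ C * vecNorm g q v ∧ vecNorm g q v ≤ C * ‖chartD e q v‖) ?_ ?_ ?_ ?_
  · exact ⟨1, one_pos, by simp⟩
  · rintro s t hst ⟨C, hC, h⟩
    exact ⟨C, hC, fun q hq => h q (hst hq)⟩
  · rintro s t ⟨C, hC, h⟩ ⟨C', hC', h'⟩
    refine ⟨max C C', lt_max_of_lt_left hC, fun q hq v => ?_⟩
    rcases hq with hq | hq
    · exact hmono _ _ q v (le_max_left _ _) (h q hq v)
    · exact hmono _ _ q v (le_max_right _ _) (h' q hq v)
  · intro p _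
    obtain ⟨C, hC, h⟩ := eventually_chartD_compare g he (p := p) (by simp [hs])
    exact ⟨_, mem_nhdsWithin_of_mem_nhds h, C, hC, fun q hq => hq⟩

/-- The geodesic distance of `g`. -/
def metricEDist (g : Metric n X) (p q : X) : ENNReal :=
  letI : RiemannianBundle (fun p : X => TangentSpace 𝓘(ℝ, Eu n) p) := ⟨g.toRiemannianMetric⟩
  riemannianEDist 𝓘(ℝ, Eu n) p q

theorem mem_metricBall {g : Metric n X} {p q : X} {r : ℝ} :
    q ∈ metricBall g p r ↔ metricEDist g p q < ENNReal.ofReal r := Iff.rfl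

/-- The preimage of a segment under the chart is an admissible path, so its length bounds the
geodesic distance. -/
theorem metricEDist_le (g : Metric n X) (he : e ∈ charts n X) {C : ℝ} {x y : Eu n}
    (hseg : segment ℝ x y ⊆ e.target)
    (hC : ∀ z ∈ segment ℝ x y, ∀ v, vecNorm g (e.symm z) v ≤ C * ‖chartD e (e.symm z) v‖) :
    metricEDist g (e.symm x) (e.symm y) ≤ ENNReal.ofReal (C * ‖y - x‖) := by
  let : RiemannianBundle (fun p : X => TangentSpace 𝓘(ℝ, Eu n) p) := ⟨g.toRiemannianMetric⟩
  let η : ℝ → Eu n := fun t => x + t • (y - x)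
  have hη : ∀ t ∈ Icc (0 : ℝ) 1, η t ∈ segment ℝ x y := fun t ht => by
    rw [segment_eq_image']
    exact ⟨t, ht, rfl⟩
  have hηd : ∀ t, HasDerivAt η (y - x) t := fun t =>
    (((hasDerivAt_id t).smul_const (y - x)).const_add x).congr_deriv (one_smul ℝ _)
  have hηs : ContDiff ℝ 1 η := by fun_prop
  have hγ : ContMDiffOn 𝓘(ℝ, ℝ) 𝓘(ℝ, Eu n) 1 (e.symm ∘ η) (Icc 0 1) :=
    ((contMDiffOn_symm_of_mem_maximalAtlas he).of_le (by simp)).comp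
      (contMDiffOn_iff_contDiffOn.2 hηs.contDiffOn) fun t ht => hseg (hη t ht)
  have h1 : riemannianEDist 𝓘(ℝ, Eu n) (e.symm x) (e.symm y) ≤
      pathELength 𝓘(ℝ, Eu n) (e.symm ∘ η) 0 1 :=
    riemannianEDist_le_pathELength hγ (by simp [η]) (by simp [η]) zero_le_one
  refine h1.trans ?_
  rw [pathELength_eq_lintegral_mfderiv_Ioo]
  have h2 : ∀ t ∈ Ioo (0 : ℝ) 1, ‖mfderiv 𝓘(ℝ, ℝ) 𝓘(ℝ, Eu n) (e.symm ∘ η) t 1‖ₑ ≤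
      ENNReal.ofReal (C * ‖y - x‖) := by
    intro t ht
    have hz := hη t (Ioo_subset_Icc_self ht)
    have h3 : mfderiv 𝓘(ℝ, ℝ) 𝓘(ℝ, Eu n) (e.symm ∘ η) t =
        (mfderiv 𝓘(ℝ, Eu n) 𝓘(ℝ, Eu n) e.symm (η t)).comp
          (mfderiv 𝓘(ℝ, ℝ) 𝓘(ℝ, Eu n) η t) :=
      mfderiv_comp t ((mdifferentiable_of_mem_charts he).mdifferentiableAt_symm (hseg hz))
        (hηd t).differentiableAt.mdifferentiableAt
    have h4 : mfderiv 𝓘(ℝ, ℝ) 𝓘(ℝ, Eu n) η t (1 : ℝ) = y - x :=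
      (congrArg (fun A : ℝ →L[ℝ] Eu n => A 1) mfderiv_eq_fderiv).trans
        (fderiv_apply_one_eq_deriv.trans (hηd t).deriv)
    have h5 : mfderiv 𝓘(ℝ, ℝ) 𝓘(ℝ, Eu n) (e.symm ∘ η) t (1 : ℝ) =
        chartDSymm e (η t) (y - x) := by
      rw [h3]
      exact congrArg (chartDSymm e (η t)) h4
    have h6 := hC (η t) hz (chartDSymm e (η t) (y - x))
    rw [chartD_chartDSymm he (hseg hz)] at h6
    rw [← ofReal_norm]
    refine ENNReal.ofReal_le_ofReal (le_trans (le_of_eq ?_) h6)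
    exact congrArg (vecNorm g (e.symm (η t))) h5
  refine (setLIntegral_mono' measurableSet_Ioo h2).trans ?_
  simp

/-- A path of length less than `r` starting at `p` never leaves the closed ball of radius `δ` in the
chart: as long as it stays inside, the comparison of norms keeps it within distance `C * r ≤ δ`, so
the set of times up to which it stays inside is open as well as closed. -/
theorem chart_dist_lt_of_metricEDist_lt (g : Metric n X) (he : e ∈ charts n X)
    (hs : e.source = univ) {C δ r : ℝ} (hC : 0 < C) (hδ : 0 < δ) {p q : X}
    (hbd : ∀ q, e q ∈ Metric.closedBall (e p) δ → ∀ v, ‖chartD e q v‖ ≤ C * vecNorm g q v)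
    (hr : C * r ≤ δ) (hpq : metricEDist g p q < ENNReal.ofReal r) :
    e q ∈ Metric.ball (e p) (C * r) := by
  let : RiemannianBundle (fun p : X => TangentSpace 𝓘(ℝ, Eu n) p) := ⟨g.toRiemannianMetric⟩
  have hcont := continuous_of_source_eq_univ hs
  have hsm := contMDiffOn_of_mem_maximalAtlas he
  rw [hs, contMDiffOn_univ] at hsm
  obtain ⟨γ, hγ0, hγ1, hγs, hγl, -⟩ := exists_lt_locally_constant_of_riemannianEDist_lt
    (I := 𝓘(ℝ, Eu n)) (x := p) (y := q) hpq zero_lt_one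
  have hγ' : ContDiff ℝ 1 (e ∘ γ) :=
    contMDiff_iff_contDiff.1 ((hsm.of_le (by simp)).comp hγs)
  -- a path that has not left the closed ball yet is short in the chart
  have hclaim : ∀ t ∈ Icc (0 : ℝ) 1, Icc 0 t ⊆ γ ⁻¹' (e ⁻¹' Metric.closedBall (e p) δ) →
      e (γ t) ∈ Metric.ball (e p) (C * r) := by
    intro t ht hsub
    have hr0 : 0 < r := by
      by_contra h
      rw [ENNReal.ofReal_of_nonpos (not_lt.1 h)] at hpq
      exact not_lt_bot hpq
    have h1 : ‖(e ∘ γ) t - (e ∘ γ) 0‖ₑ ≤ ENNReal.ofReal C * pathELength 𝓘(ℝ, Eu n) γ 0 t := by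
      calc ‖(e ∘ γ) t - (e ∘ γ) 0‖ₑ
          ≤ ∫⁻ s in Icc 0 t, ‖derivWithin (e ∘ γ) (Icc 0 t) s‖ₑ :=
            enorm_sub_le_lintegral_derivWithin_Icc_of_contDiffOn_Icc hγ'.contDiffOn ht.1
        _ = ∫⁻ s in Ioo 0 t, ‖derivWithin (e ∘ γ) (Icc 0 t) s‖ₑ := by
            rw [restrict_Ioo_eq_restrict_Icc]
        _ ≤ ∫⁻ s in Ioo 0 t, ENNReal.ofReal C * ‖mfderiv 𝓘(ℝ, ℝ) 𝓘(ℝ, Eu n) γ s 1‖ₑ := by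
            refine setLIntegral_mono' measurableSet_Ioo fun s hst => ?_
            have h2 : derivWithin (e ∘ γ) (Icc 0 t) s = deriv (e ∘ γ) s :=
              derivWithin_of_mem_nhds (Icc_mem_nhds hst.1 hst.2)
            have h3 : mfderiv 𝓘(ℝ, ℝ) 𝓘(ℝ, Eu n) (e ∘ γ) s =
                (mfderiv 𝓘(ℝ, Eu n) 𝓘(ℝ, Eu n) e (γ s)).comp
                  (mfderiv 𝓘(ℝ, ℝ) 𝓘(ℝ, Eu n) γ s) :=
              mfderiv_comp s ((mdifferentiable_of_mem_charts he).mdifferentiableAt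
                (by simp [hs])) (hγs.mdifferentiable (by simp) s)
            have h4 : deriv (e ∘ γ) s =
                chartD e (γ s) (mfderiv 𝓘(ℝ, ℝ) 𝓘(ℝ, Eu n) γ s (1 : ℝ)) := by
              rw [← fderiv_apply_one_eq_deriv, ← mfderiv_eq_fderiv, h3]
              rfl
            have h5 := hbd (γ s) (hsub (Ioo_subset_Icc_self hst))
              (mfderiv 𝓘(ℝ, ℝ) 𝓘(ℝ, Eu n) γ s (1 : ℝ))
            rw [h2, h4, ← ofReal_norm, ← ofReal_norm, ← ENNReal.ofReal_mul hC.le]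
            exact ENNReal.ofReal_le_ofReal h5
        _ = _ := by
            rw [lintegral_const_mul' _ _ ENNReal.ofReal_ne_top,
              pathELength_eq_lintegral_mfderiv_Ioo]
    have h2 : ‖(e ∘ γ) t - (e ∘ γ) 0‖ₑ < ENNReal.ofReal (C * r) := by
      refine h1.trans_lt ?_
      rw [ENNReal.ofReal_mul hC.le]
      refine ENNReal.mul_lt_mul_right (by simpa using hC) ENNReal.ofReal_ne_top ?_
      exact (pathELength_mono le_rfl ht.2).trans_lt hγl
    rw [← ofReal_norm, ENNReal.ofReal_lt_ofReal_iff (by positivity)] at h2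
    rw [mem_ball_iff_norm]
    simpa [hγ0] using h2
  have hclosed : IsClosed (γ ⁻¹' (e ⁻¹' Metric.closedBall (e p) δ) ∩ Icc 0 1) :=
    ((Metric.isClosed_closedBall.preimage hcont).preimage hγs.continuous).inter isClosed_Icc
  have hall : Icc (0 : ℝ) 1 ⊆ γ ⁻¹' (e ⁻¹' Metric.closedBall (e p) δ) := by
    refine hclosed.Icc_subset_of_forall_mem_nhdsGT_of_Icc_subset ?_ ?_
    · simp [hγ0, hδ.le]
    · rintro t ⟨ht0, ht1⟩ hsub
      have h1 : e (γ t) ∈ Metric.ball (e p) δ :=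
        Metric.ball_subset_ball hr (hclaim t ⟨ht0, ht1.le⟩ hsub)
      have h2 : ∀ᶠ s in 𝓝 t, (e ∘ γ) s ∈ Metric.ball (e p) δ :=
        (hcont.comp hγs.continuous).continuousAt (Metric.isOpen_ball.mem_nhds h1)
      exact mem_nhdsWithin_of_mem_nhds (h2.mono fun s hs => Metric.ball_subset_closedBall hs)
  have := hclaim 1 (by simp) hall
  rwa [hγ1] at this

/-- Uniformly on compact sets, small geodesic balls are comparable with Euclidean balls in the
chart. -/
theorem exists_metricBall_compare (g : Metric n X) (he : e ∈ charts n X) (hs : e.source = univ)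
    {K : Set X} (hK : IsCompact K) :
    ∃ δ > (0 : ℝ), ∃ C > (0 : ℝ), ∀ p ∈ K, Metric.closedBall (e p) δ ⊆ e.target ∧
      (∀ r, C * r ≤ δ → metricBall g p r ⊆ e ⁻¹' Metric.ball (e p) (C * r)) ∧
      ∀ r, r ≤ δ → e ⁻¹' Metric.ball (e p) r ⊆ metricBall g p (C * r) := by
  have hK' := isCompact_image_chart hs hK
  obtain ⟨δ, hδ, hδt⟩ := hK'.exists_cthickening_subset_open e.open_target
    (image_subset_target hs K)
  obtain ⟨C, hC, hCb⟩ := exists_chartD_compare g he hs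
    (isCompact_preimage_chart hs hK'.cthickening hδt)
  refine ⟨δ, hδ, C, hC, fun p hp => ?_⟩
  have hsub : Metric.closedBall (e p) δ ⊆ Metric.cthickening δ (e '' K) :=
    Metric.closedBall_subset_cthickening (mem_image_of_mem _ hp) _
  refine ⟨hsub.trans hδt, fun r hr q hq => ?_, fun r hr q hq => ?_⟩
  · exact chart_dist_lt_of_metricEDist_lt g he hs hC hδ
      (fun q hq v => (hCb q (hsub hq) v).1) hr hq
  · have hseg : segment ℝ (e p) (e q) ⊆ Metric.cthickening δ (e '' K) := by
      refine Subset.trans ?_ hsub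
      refine (convex_closedBall (e p) δ).segment_subset (Metric.mem_closedBall_self hδ.le) ?_
      exact Metric.ball_subset_closedBall (Metric.ball_subset_ball hr hq)
    have h1 := metricEDist_le g he (C := C) (hseg.trans hδt) fun z hz v =>
      (hCb (e.symm z) (by rw [mem_preimage, e.right_inv (hδt (hseg hz))]; exact hseg hz) v).2
    rw [symm_apply_of_global hs, symm_apply_of_global hs] at h1
    refine mem_metricBall.2 (h1.trans_lt ?_)
    have h2 : ‖e q - e p‖ < r := mem_ball_iff_norm.1 hq
    rw [ENNReal.ofReal_lt_ofReal_iff (mul_pos hC ((norm_nonneg _).trans_lt h2))]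
    exact mul_lt_mul_of_pos_left h2 hC

/-- On compact sets the norm of an `n`-covector is comparable with its coefficient. -/
theorem exists_covecNorm_compare (g : Metric n X) (he : e ∈ charts n X) (hs : e.source = univ)
    {K : Set X} (hK : IsCompact K) :
    ∃ C : ℝ, 0 < C ∧ ∀ q ∈ K, ∀ σ : X → Covec n,
      covecNorm g q (σ q) ≤ C * |coeff e σ (e q)| ∧
        |coeff e σ (e q)| ≤ C * covecNorm g q (σ q) := by
  let : RiemannianBundle (fun p : X => TangentSpace 𝓘(ℝ, Eu n) p) := ⟨g.toRiemannianMetric⟩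
  obtain ⟨C, hC, hCb⟩ := exists_chartD_compare g he hs hK
  refine ⟨(‖volForm n‖ + 1) * C ^ n, by positivity, fun q hq σ => ?_⟩
  let ν : TangentSpace 𝓘(ℝ, Eu n) q [⋀^Fin n]→L[ℝ] ℝ := σ q
  have hν0 : (0 : ℝ) ≤ ‖ν‖ :=
    norm_nonneg (E := TangentSpace 𝓘(ℝ, Eu n) q [⋀^Fin n]→L[ℝ] ℝ) ν
  have hqs : q ∈ e.source := by simp [hs]
  constructor
  · refine ContinuousAlternatingMap.opNorm_le_bound (f := ν) (by positivity) fun v => ?_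
    have h1 : ν v = coeff e σ (e q) * volForm n (fun i => chartD e q (v i)) :=
      form_eq_coeff he σ hqs v
    rw [h1, norm_mul, Real.norm_eq_abs]
    have h2 : ‖volForm n (fun i => chartD e q (v i))‖ ≤ ‖volForm n‖ * (C ^ n * ∏ i, ‖v i‖) := by
      refine ((volForm n).le_opNorm _).trans ?_
      gcongr
      calc ∏ i, ‖chartD e q (v i)‖ ≤ ∏ i, (C * ‖v i‖) :=
            Finset.prod_le_prod (fun i _ => norm_nonneg _) fun i _ => (hCb q hq (v i)).1
        _ = C ^ n * ∏ i, ‖v i‖ := by simp [Finset.prod_mul_distrib]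
    have h3 : (0 : ℝ) ≤ ∏ i, ‖v i‖ := Finset.prod_nonneg fun i _ => norm_nonneg _
    calc _ ≤ |coeff e σ (e q)| * (‖volForm n‖ * (C ^ n * ∏ i, ‖v i‖)) := by gcongr
      _ ≤ |coeff e σ (e q)| * ((‖volForm n‖ + 1) * (C ^ n * ∏ i, ‖v i‖)) := by
          gcongr
          simp
      _ = _ := by ring
  · let w : Fin n → TangentSpace 𝓘(ℝ, Eu n) q := fun i => chartDSymm e (e q) (stdFrame n i)
    have h1 : coeff e σ (e q) = ν w := by
      rw [coeff_apply, symm_apply_of_global hs]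
      rfl
    have h2 : ∏ i, ‖w i‖ ≤ C ^ n := by
      calc _ ≤ ∏ i : Fin n, C := by
            refine Finset.prod_le_prod (fun i _ => norm_nonneg _) fun i _ => ?_
            have h3 := (hCb q hq (chartDSymm e (e q) (stdFrame n i))).2
            have h4 := chartD_chartDSymm he (e.map_source hqs) (stdFrame n i)
            rw [symm_apply_of_global hs] at h4
            rw [h4] at h3
            refine h3.trans (le_of_eq ?_)
            simp [stdFrame]
        _ = C ^ n := by simp
    rw [h1]
    calc |ν w| ≤ ‖ν‖ * C ^ n :=
          (ν.le_opNorm _).trans (by gcongr)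
      _ ≤ ((‖volForm n‖ + 1) * C ^ n) * ‖ν‖ := by
          have : 0 ≤ ‖volForm n‖ * C ^ n * ‖ν‖ := by positivity
          nlinarith

end Comparison

/-! ### Supports of kernels; the Euclidean metric of a chart -/

section Support

variable {n : ℕ} {X : Type*} [TopologicalSpace X] [ChartedSpace (Eu n) X]
  [IsManifold 𝓘(ℝ, Eu n) ∞ X] {e : OpenPartialHomeomorph X (Eu n)} {Ω : Opens (Eu n)}

theorem tsupport_form_subset (he : e ∈ charts n X) (hs : e.source = univ) (hΩ : e.target = Ω)
    (σ : CompactForm n X) : tsupport σ.form ⊆ e ⁻¹' tsupport (testEquiv he hs hΩ σ) := by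
  have h := tsupport_formOf_subset hs (testEquiv he hs hΩ σ)
  have h' : formOf e (testEquiv he hs hΩ σ) = σ.form :=
    congrArg CompactForm.form ((testEquiv he hs hΩ).symm_apply_apply σ)
  rwa [h'] at h

theorem tsupport_test_subset (he : e ∈ charts n X) (hs : e.source = univ) (hΩ : e.target = Ω)
    (σ : CompactForm n X) : tsupport (testEquiv he hs hΩ σ) ⊆ e '' tsupport σ.form :=
  tsupport_indicator_coeff_subset hs σ.2.2

/-- The support condition does not depend on the metric: geodesic balls and Euclidean balls of
radius proportional to `ε` contain each other, uniformly on compact sets, up to a constant factor.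
-/
theorem supportCondition_iff (he : e ∈ charts n X) (hs : e.source = univ) (hΩ : e.target = Ω)
    (g : Metric n X) (Φ : SmoothMaps n X (CompactForm n X)) :
    SupportCondition g Φ.1 ↔ LocalSupportCondition (kernelEquiv he hs hΩ Φ).1 := by
  constructor
  · intro h K hK
    have hK' := hK.image (chartHomeo hs hΩ).symm.continuous
    obtain ⟨ε₀, hε₀, C, hC, hsupp⟩ := h _ hK'
    obtain ⟨δ, hδ, C', hC', hcmp⟩ := exists_metricBall_compare g he hs hK'
    refine ⟨min ε₀ (δ / (C' * C)), lt_min hε₀ (by positivity), C' * C, by positivity,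
      fun x hx ε hε => ?_⟩
    have hx' : e ((chartHomeo hs hΩ).symm x) = x := e.right_inv (hΩ.symm.subset x.2)
    obtain ⟨h1, h2, -⟩ := hcmp _ (mem_image_of_mem _ hx)
    rw [hx'] at h1 h2
    have h3 : (ε : ℝ) * (C' * C) ≤ δ :=
      (le_div_iff₀ (by positivity)).1 (hε.trans (min_le_right _ _))
    have h4 : C' * (ε * C) ≤ δ := by linarith
    refine ⟨?_, (Metric.ball_subset_closedBall.trans (Metric.closedBall_subset_closedBall h3)).trans
      (h1.trans hΩ.subset)⟩
    refine (tsupport_test_subset he hs hΩ _).trans ?_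
    rintro _ ⟨q, hq, rfl⟩
    have h5 := h2 _ h4 (hsupp _ (mem_image_of_mem _ hx) ε (hε.trans (min_le_left _ _)) hq)
    rwa [mem_preimage, show C' * ((ε : ℝ) * C) = ε * (C' * C) by ring] at h5
  · intro h K hK
    have hK' := hK.image (chartHomeo hs hΩ).continuous
    obtain ⟨ε₀, hε₀, C, hC, hsupp⟩ := h _ hK'
    obtain ⟨δ, hδ, C', hC', hcmp⟩ := exists_metricBall_compare g he hs hK
    refine ⟨min ε₀ (δ / C), lt_min hε₀ (by positivity), C' * C, by positivity,
      fun p hp ε hε => ?_⟩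
    have h1 := (hsupp _ (mem_image_of_mem _ hp) ε (hε.trans (min_le_left _ _))).1
    rw [kernelEquiv_apply, coe_chartHomeo, symm_apply_of_global hs] at h1
    have h3 : (ε : ℝ) * C ≤ δ :=
      (le_div_iff₀ (by positivity)).1 (hε.trans (min_le_right _ _))
    refine (tsupport_form_subset he hs hΩ _).trans ((preimage_mono h1).trans ?_)
    refine ((hcmp p hp).2.2 _ h3).trans (le_of_eq ?_)
    rw [show C' * ((ε : ℝ) * C) = ε * (C' * C) by ring]

/-- The Euclidean inner product as a bilinear map. -/
def euInner (n : ℕ) : Eu n →L[ℝ] Eu n →L[ℝ] ℝ := innerSL ℝ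

/-- The Euclidean inner product of the images of two tangent vectors in the chart. -/
def chartInner (e : OpenPartialHomeomorph X (Eu n)) (p : X) :
    TangentSpace 𝓘(ℝ, Eu n) p →L[ℝ] TangentSpace 𝓘(ℝ, Eu n) p →L[ℝ] ℝ :=
  ((euInner n).bilinearComp (chartD e p) (chartD e p) : Eu n →L[ℝ] Eu n →L[ℝ] ℝ)

theorem contDiffOn_bilinearComp {S : Set (Eu n)} {A : Eu n → Eu n →L[ℝ] Eu n}
    (hA : ContDiffOn ℝ ∞ A S) :
    ContDiffOn ℝ ∞ (fun x => (euInner n).bilinearComp (A x) (A x)) S := by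
  refine contDiffOn_clm_apply.2 fun v => contDiffOn_clm_apply.2 fun w => ?_
  have h1 : ContDiffOn ℝ ∞ (fun x => euInner n (A x v)) S :=
    (euInner n).contDiff.comp_contDiffOn (hA.clm_apply contDiffOn_const)
  exact h1.clm_apply (hA.clm_apply contDiffOn_const)

theorem contMDiff_chartInner (he : e ∈ charts n X) (hs : e.source = univ) :
    ContMDiff 𝓘(ℝ, Eu n) (𝓘(ℝ, Eu n).prod 𝓘(ℝ, Eu n →L[ℝ] Eu n →L[ℝ] ℝ)) ∞
      (fun p : X => TotalSpace.mk' (Eu n →L[ℝ] Eu n →L[ℝ] ℝ) p (chartInner e p)) := by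
  intro p
  rw [contMDiffAt_section]
  set c := chartAt (Eu n) p with hc
  have hcm : c ∈ charts n X := chartAt_mem_charts p
  have hpc : p ∈ c.source := mem_chart_source _ p
  have hdom : c.target ∩ c.symm ⁻¹' e.source = c.target := by simp [hs]
  have h1 : ContDiffOn ℝ ∞ (fderiv ℝ (e ∘ c.symm)) c.target := by
    have := contDiffOn_transition hcm he
    rw [hdom] at this
    exact this.fderiv_of_isOpen c.open_target (by simp)
  have h3 : ContMDiffAt 𝓘(ℝ, Eu n) 𝓘(ℝ, Eu n →L[ℝ] Eu n →L[ℝ] ℝ) ∞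
      (fun q => (euInner n).bilinearComp
      (fderiv ℝ (e ∘ c.symm) (c q)) (fderiv ℝ (e ∘ c.symm) (c q))) p :=
    ((contMDiffOn_iff_contDiffOn.2 (contDiffOn_bilinearComp h1)).comp
      (contMDiffOn_of_mem_maximalAtlas hcm) fun q hq => c.map_source hq).contMDiffAt
      (c.open_source.mem_nhds hpc)
  refine h3.congr_of_eventuallyEq ?_
  filter_upwards [c.open_source.mem_nhds hpc] with q hq
  have hq' : q ∈ (trivializationAt (Eu n) (TangentSpace 𝓘(ℝ, Eu n)) p).baseSet := hq
  ext v w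
  have hsymm : ∀ v : Eu n, ((trivializationAt (Eu n) (TangentSpace 𝓘(ℝ, Eu n)) p).symmL ℝ q v :
      Eu n) = chartDSymm c (c q) v := by
    intro v
    rw [TangentBundle.symmL_trivializationAt hq]
    simp only [mfld_simps, mfderivWithin_univ]
    rfl
  have hD : ∀ v : Eu n, chartD e q (chartDSymm c (c q) v) = fderiv ℝ (e ∘ c.symm) (c q) v := by
    intro v
    have h := chartD_chartDSymm hcm (c.map_source hq) v
    rw [c.left_inv hq] at h
    rw [chartD_eq_comp hcm he hq (by simp [hs]), h]
  rw [hom_trivializationAt_apply]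
  rw [ContinuousLinearMap.inCoordinates]
  have hb : q ∈ (trivializationAt (Eu n →L[ℝ] ℝ)
      (fun x => TangentSpace 𝓘(ℝ, Eu n) x →L[ℝ] ℝ) p).baseSet := by
    rw [hom_trivializationAt_baseSet]
    exact ⟨hq', mem_univ _⟩
  change Trivialization.continuousLinearMapAt ℝ (trivializationAt (Eu n →L[ℝ] ℝ)
    (fun x => TangentSpace 𝓘(ℝ, Eu n) x →L[ℝ] ℝ) p) q (chartInner e q
      (Trivialization.symmL ℝ (trivializationAt (Eu n) (TangentSpace 𝓘(ℝ, Eu n)) p) q v)) w = _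
  rw [Trivialization.continuousLinearMapAt_apply, Trivialization.coe_linearMapAt_of_mem _ hb]
  have hin := congrArg (fun z : X × (Eu n →L[ℝ] ℝ) => z.2 w) (hom_trivializationAt_apply (RingHom.id ℝ)
    (F₁ := Eu n) (E₁ := fun x : X => TangentSpace 𝓘(ℝ, Eu n) x) (F₂ := ℝ)
    (E₂ := Bundle.Trivial X ℝ) p (⟨q, chartInner e q
      (Trivialization.symmL ℝ (trivializationAt (Eu n) (TangentSpace 𝓘(ℝ, Eu n)) p) q v)⟩))
  refine hin.trans ?_
  dsimp only
  rw [ContinuousLinearMap.inCoordinates]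
  simp
  change euInner n (chartD e q (Trivialization.symmL ℝ
      (trivializationAt (Eu n) (TangentSpace 𝓘(ℝ, Eu n)) p) q v))
    (chartD e q (Trivialization.symmL ℝ
      (trivializationAt (Eu n) (TangentSpace 𝓘(ℝ, Eu n)) p) q w)) = _
  rw [← hD, ← hD]
  exact congrArg₂ (fun a b => euInner n (chartD e q a) (chartD e q b)) (hsymm v) (hsymm w)

/-- The Euclidean metric of a global chart, as a Riemannian metric. -/
def chartMetric (he : e ∈ charts n X) (hs : e.source = univ) : Metric n X where
  inner p := chartInner e p
  symm p v w := real_inner_comm (chartD e p w : Eu n) (chartD e p v)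
  pos p v hv := by
    have h0 : (chartD e p v : Eu n) ≠ 0 := fun h => hv <| by
      have := chartDSymm_chartD he (p := p) (by simp [hs]) v
      rw [← this]
      exact (congrArg (chartDSymm e (e p)) h).trans (map_zero _)
    exact real_inner_self_pos.2 h0
  isVonNBounded p := by
    change Bornology.IsVonNBounded ℝ {v : Eu n | inner ℝ (chartD e p v) (chartD e p v) < 1}
    have h1 : Bornology.IsVonNBounded ℝ ((chartDSymm e (e p)) '' Metric.ball (0 : Eu n) 1) :=
      (NormedSpace.isVonNBounded_ball ℝ (Eu n) 1).image _
    refine h1.subset ?_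
    intro v hv
    refine ⟨chartD e p v, ?_, chartDSymm_chartD he (by simp [hs]) v⟩
    rw [mem_ball_zero_iff, ← sq_lt_one_iff₀ (norm_nonneg _), ← real_inner_self_eq_norm_sq]
    exact hv
  contMDiff := contMDiff_chartInner he hs

end Support

/-! ### Joint smoothness -/

section JointSmoothness

variable {E : Type*} [NormedAddCommGroup E] [NormedSpace ℝ E] [FiniteDimensional ℝ E]

/-- Continuous directional derivatives in all directions are additive in the direction. -/
theorem lineDeriv_add_of_continuousOn {S : Set E} (hS : IsOpen S) {f : E → ℝ} {g : E → E → ℝ}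
    (hc : ∀ v, ContinuousOn (g v) S) (hg : ∀ v, ∀ x ∈ S, HasLineDerivAt ℝ f (g v x) x v)
    {x : E} (hx : x ∈ S) (v w : E) : g (v + w) x = g v x + g w x := by
  have h1 := hg (v + w) x hx
  refine h1.unique ?_
  rw [HasLineDerivAt, hasDerivAt_iff_isLittleO_nhds_zero, Asymptotics.isLittleO_iff]
  intro c hc0
  have hv := hg v x hx
  rw [HasLineDerivAt, hasDerivAt_iff_isLittleO_nhds_zero, Asymptotics.isLittleO_iff] at hv
  have hnear : ∀ᶠ z in 𝓝 x, z ∈ S ∧ ‖g w z - g w x‖ ≤ c / 2 := by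
    have h2 := ((hc w).continuousAt (hS.mem_nhds hx)).tendsto
    refine (show ∀ᶠ z in 𝓝 x, z ∈ S from hS.mem_nhds hx).and ?_
    filter_upwards [h2 (Metric.closedBall_mem_nhds _ (half_pos hc0))] with z hz
    rwa [← dist_eq_norm]
  obtain ⟨r, hr, hball⟩ := Metric.eventually_nhds_iff_ball.1 hnear
  have hsmall : ∀ᶠ t : ℝ in 𝓝 0, |t| * (‖v‖ + ‖w‖) < r := by
    have : Continuous fun t : ℝ => |t| * (‖v‖ + ‖w‖) := by fun_prop
    exact this.continuousAt.eventually_lt continuousAt_const (by simpa using hr)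
  filter_upwards [hsmall, hv (half_pos hc0)] with t ht hvt
  -- the mean value inequality on the segment from `x + t v` to `x + t v + t w`
  have key : ‖f (x + t • v + t • w) - f (x + t • v) - t * g w x‖ ≤ c / 2 * ‖t‖ := by
    have hin : ∀ s ∈ Icc (0 : ℝ) 1, x + t • v + (s * t) • w ∈ Metric.ball x r := by
      intro s hs
      rw [mem_ball_iff_norm, add_assoc, add_sub_cancel_left]
      refine lt_of_le_of_lt ((norm_add_le _ _).trans ?_) ht
      rw [norm_smul, norm_smul, norm_mul, Real.norm_eq_abs, Real.norm_eq_abs, abs_of_nonneg hs.1,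
        mul_add]
      gcongr
      exact mul_le_of_le_one_left (abs_nonneg _) hs.2
    have hder : ∀ s ∈ Icc (0 : ℝ) 1, HasDerivWithinAt
        (fun s : ℝ => f (x + t • v + (s * t) • w) - s * (t * g w x))
        (t * (g w (x + t • v + (s * t) • w) - g w x)) (Icc 0 1) s := by
      intro s hs
      have h3 := hg w _ (hball _ (hin s hs)).1
      have h4 : HasDerivAt (fun s' : ℝ => (s' - s) * t) t s := by
        simpa using ((hasDerivAt_id s).sub_const s).mul_const t
      have h5 := HasDerivAt.comp_of_eq s h3 h4 (by simp)
      have h6 : (fun s' : ℝ => f (x + t • v + (s' * t) • w)) =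
          (fun t' : ℝ => f (x + t • v + (s * t) • w + t' • w)) ∘ fun s' => (s' - s) * t := by
        funext s'
        simp only [Function.comp]
        rw [add_assoc (x + t • v), ← add_smul]
        ring_nf
      rw [← h6] at h5
      refine ((h5.sub ((hasDerivAt_id s).mul_const (t * g w x))).congr_deriv ?_).hasDerivWithinAt
      ring
    have hb := Convex.norm_image_sub_le_of_norm_hasDerivWithin_le hder
      (C := c / 2 * ‖t‖) (fun s hs => by
        rw [norm_mul, mul_comm]
        exact mul_le_mul_of_nonneg_right (hball _ (hin s hs)).2 (norm_nonneg _))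
      (convex_Icc 0 1) (left_mem_Icc.2 zero_le_one) (right_mem_Icc.2 zero_le_one)
    simp only [one_mul, zero_mul, zero_smul, add_zero, sub_zero, norm_one, mul_one] at hb
    rwa [sub_right_comm] at hb
  simp only [zero_add, zero_smul, add_zero, smul_eq_mul] at hvt ⊢
  rw [smul_add, ← add_assoc]
  calc ‖f (x + t • v + t • w) - f x - t * (g v x + g w x)‖
      = ‖(f (x + t • v + t • w) - f (x + t • v) - t * g w x) + (f (x + t • v) - f x - t * g v x)‖ := by
        congr 1; ring
    _ ≤ c / 2 * ‖t‖ + c / 2 * ‖t‖ := (norm_add_le _ _).trans (add_le_add key hvt)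
    _ = c * ‖t‖ := by ring

/-- A function with continuous directional derivatives on an open subset of a finite-dimensional
space is differentiable there. -/
theorem exists_hasFDerivAt_of_hasLineDerivAt {S : Set E} (hS : IsOpen S) {f : E → ℝ}
    {g : E → E → ℝ} (hc : ∀ v, ContinuousOn (g v) S)
    (hg : ∀ v, ∀ x ∈ S, HasLineDerivAt ℝ f (g v x) x v) :
    ∃ L : E → E →L[ℝ] ℝ, ∀ x ∈ S, HasFDerivAt f (L x) x ∧ ∀ v, L x v = g v x := by
  classical
  have hlin : ∀ x ∈ S, ∃ A : E →L[ℝ] ℝ, ∀ v, A v = g v x := by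
    intro x hx
    let A : E →ₗ[ℝ] ℝ :=
      { toFun := fun v => g v x
        map_add' := lineDeriv_add_of_continuousOn hS hc hg hx
        map_smul' := fun c v => (hg (c • v) x hx).unique ((hg v x hx).smul c) }
    exact ⟨LinearMap.toContinuousLinearMap A, fun v => rfl⟩
  choose! L hL using hlin
  refine ⟨L, fun x hx => ⟨?_, hL x hx⟩⟩
  have hLc : ContinuousAt L x :=
    ContinuousOn.continuousAt
      (continuousOn_clm_apply.2 fun v => (hc v).congr fun z hz => hL z hz v) (hS.mem_nhds hx)
  rw [hasFDerivAt_iff_isLittleO_nhds_zero, Asymptotics.isLittleO_iff]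
  intro c hc0
  have hnear : ∀ᶠ z in 𝓝 x, z ∈ S ∧ ‖L z - L x‖ ≤ c := by
    refine (show ∀ᶠ z in 𝓝 x, z ∈ S from hS.mem_nhds hx).and ?_
    filter_upwards [hLc.tendsto (Metric.closedBall_mem_nhds _ hc0)] with z hz
    rwa [← dist_eq_norm]
  obtain ⟨r, hr, hball⟩ := Metric.eventually_nhds_iff_ball.1 hnear
  filter_upwards [Metric.ball_mem_nhds (0 : E) hr] with v hv
  have hin : ∀ s ∈ Icc (0 : ℝ) 1, x + s • v ∈ Metric.ball x r := by
    intro s hs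
    rw [mem_ball_iff_norm, add_sub_cancel_left, norm_smul, Real.norm_eq_abs, abs_of_nonneg hs.1]
    exact (mul_le_of_le_one_left (norm_nonneg _) hs.2).trans_lt (mem_ball_zero_iff.1 hv)
  have hder : ∀ s ∈ Icc (0 : ℝ) 1, HasDerivWithinAt (fun s : ℝ => f (x + s • v) - s * L x v)
      (L (x + s • v) v - L x v) (Icc 0 1) s := by
    intro s hs
    have hS' := (hball _ (hin s hs)).1
    have h3 := hg v _ hS'
    rw [← hL _ hS'] at h3
    have h4 : HasDerivAt (fun s' : ℝ => s' - s) 1 s := (hasDerivAt_id s).sub_const s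
    have h5 := HasDerivAt.comp_of_eq s h3 h4 (by simp)
    have h6 : (fun s' : ℝ => f (x + s' • v)) =
        (fun t' : ℝ => f (x + s • v + t' • v)) ∘ fun s' => s' - s := by
      funext s'
      simp only [Function.comp]
      rw [add_assoc x, ← add_smul, add_sub_cancel]
    rw [← h6] at h5
    refine ((h5.sub ((hasDerivAt_id s).mul_const (L x v))).congr_deriv ?_).hasDerivWithinAt
    ring
  have hb := Convex.norm_image_sub_le_of_norm_hasDerivWithin_le hder (C := c * ‖v‖) (fun s hs => by
      rw [← sub_apply]
      exact ((L _ - L x).le_opNorm v).trans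
        (mul_le_mul_of_nonneg_right (hball _ (hin s hs)).2 (norm_nonneg _)))
      (convex_Icc 0 1) (left_mem_Icc.2 zero_le_one) (right_mem_Icc.2 zero_le_one)
  simp only [one_mul, one_smul, zero_mul, zero_smul, add_zero, sub_zero, norm_one, mul_one] at hb
  rwa [sub_right_comm] at hb

variable {E₁ E₂ : Type*} [NormedAddCommGroup E₁] [NormedSpace ℝ E₁] [FiniteDimensional ℝ E₁]
  [NormedAddCommGroup E₂] [NormedSpace ℝ E₂] [FiniteDimensional ℝ E₂]

/-- A family of continuous functions of two variables that is closed under partial derivatives in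
both variables consists of smooth functions. -/
theorem contDiffOn_of_partials {ι : Type*} {S₁ : Set E₁} {S₂ : Set E₂} (h₁ : IsOpen S₁)
    (h₂ : IsOpen S₂) {G : ι → E₁ → E₂ → ℝ} (d₁ : E₁ → ι → ι) (d₂ : E₂ → ι → ι)
    (hc : ∀ i, ContinuousOn (fun z : E₁ × E₂ => G i z.1 z.2) (S₁ ×ˢ S₂))
    (hd₁ : ∀ i v, ∀ x ∈ S₁, ∀ y ∈ S₂, HasLineDerivAt ℝ (fun x' => G i x' y) (G (d₁ v i) x y) x v)
    (hd₂ : ∀ i v, ∀ x ∈ S₁, ∀ y ∈ S₂, HasLineDerivAt ℝ (fun y' => G i x y') (G (d₂ v i) x y) y v)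
    (i : ι) : ContDiffOn ℝ ∞ (fun z : E₁ × E₂ => G i z.1 z.2) (S₁ ×ˢ S₂) := by
  have hS : IsOpen (S₁ ×ˢ S₂) := h₁.prod h₂
  have hL₁ : ∀ i, ∀ y ∈ S₂, ∃ L : E₁ → E₁ →L[ℝ] ℝ, ∀ x ∈ S₁,
      HasFDerivAt (fun x' => G i x' y) (L x) x ∧ ∀ v, L x v = G (d₁ v i) x y := fun i y hy =>
    exists_hasFDerivAt_of_hasLineDerivAt h₁ (g := fun v x => G (d₁ v i) x y)
      (fun v => (hc (d₁ v i)).comp (f := fun x => (x, y)) (by fun_prop) fun x hx => ⟨hx, hy⟩)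
      fun v x hx => hd₁ i v x hx y hy
  have hL₂ : ∀ i, ∀ x ∈ S₁, ∃ L : E₂ → E₂ →L[ℝ] ℝ, ∀ y ∈ S₂,
      HasFDerivAt (fun y' => G i x y') (L y) y ∧ ∀ v, L y v = G (d₂ v i) x y := fun i x hx =>
    exists_hasFDerivAt_of_hasLineDerivAt h₂ (g := fun v y => G (d₂ v i) x y)
      (fun v => (hc (d₂ v i)).comp (f := fun y => (x, y)) (by fun_prop) fun y hy => ⟨hx, hy⟩)
      fun v y hy => hd₂ i v x hx y hy
  choose! L₁ hL₁ using hL₁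
  choose! L₂ hL₂ using hL₂
  -- continuous partial derivatives give differentiability, with partial derivatives in the family
  have hder : ∀ i, ∀ z ∈ S₁ ×ˢ S₂, HasFDerivAt (fun z : E₁ × E₂ => G i z.1 z.2)
      ((L₁ i z.2 z.1).coprod (L₂ i z.1 z.2)) z := by
    intro i z hz
    refine (hasStrictFDerivAt_uncurry_coprod (f := G i) (f₁ := fun x y => L₁ i y x)
      (f₂ := fun x y => L₂ i x y) ?_ ?_ ?_ ?_).hasFDerivAt
    · filter_upwards [hS.mem_nhds hz] with w hw using (hL₁ i w.2 hw.2 w.1 hw.1).1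
    · filter_upwards [hS.mem_nhds hz] with w hw using (hL₂ i w.1 hw.1 w.2 hw.2).1
    · refine ContinuousOn.continuousAt (s := S₁ ×ˢ S₂) (continuousOn_clm_apply.2 fun v =>
        (hc (d₁ v i)).congr fun w hw => (hL₁ i w.2 hw.2 w.1 hw.1).2 v) (hS.mem_nhds hz)
    · refine ContinuousOn.continuousAt (s := S₁ ×ˢ S₂) (continuousOn_clm_apply.2 fun v =>
        (hc (d₂ v i)).congr fun w hw => (hL₂ i w.1 hw.1 w.2 hw.2).2 v) (hS.mem_nhds hz)
  refine contDiffOn_infty.2 fun k => ?_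
  induction k generalizing i with
  | zero => exact contDiffOn_zero.2 (hc i)
  | succ k ih =>
    rw [Nat.cast_succ, contDiffOn_succ_iff_fderiv_of_isOpen hS]
    refine ⟨fun z hz => (hder i z hz).differentiableAt.differentiableWithinAt, by simp, ?_⟩
    refine contDiffOn_clm_apply.2 fun v => ?_
    refine ((ih (d₁ v.1 i)).add (ih (d₂ v.2 i))).congr fun z hz => ?_
    rw [(hder i z hz).fderiv, ContinuousLinearMap.coprod_apply, (hL₁ i z.2 hz.2 z.1 hz.1).2,
      (hL₂ i z.1 hz.1 z.2 hz.2).2]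

variable {n : ℕ} {Ω : Opens (Eu n)}

/-- A smooth map into the space of test functions is a smooth function of both variables. -/
theorem contDiffOn_of_isDerivFamily {U : Set (Eu n)} (hU : IsOpen U)
    {D : List (ℝ × Eu n) → ℝ × Eu n → 𝓓(Ω, ℝ)} (hD : IsDerivFamily (Ioc (0 : ℝ) 1 ×ˢ U) D)
    {ε : ℝ} (hε : ε ∈ Ioc (0 : ℝ) 1) :
    ContDiffOn ℝ ∞ (fun z : Eu n × Eu n => D [] (ε, z.1) z.2) (U ×ˢ univ) := by
  -- the family of all derivatives: first in `x` by `D`, then in `y` by the operators `A`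
  let A : List (Eu n) → 𝓓(Ω, ℝ) →L[ℝ] 𝓓(Ω, ℝ) := fun m =>
    m.foldr (fun w B => (TestFunction.lineDerivCLM ℝ w).comp B) (ContinuousLinearMap.id ℝ _)
  let G : List (Eu n) × List (Eu n) → Eu n → Eu n → ℝ := fun i x y =>
    A i.2 (D (i.1.map fun v => ((0 : ℝ), v)) (ε, x)) y
  have heval : Continuous fun p : 𝓓(Ω, ℝ) × Eu n => p.1 p.2 :=
    (continuous_eval (F := BoundedContinuousFunction (Eu n) ℝ)).comp
      (((TestFunction.toBoundedContinuousFunctionCLM ℝ).continuous.comp continuous_fst).prodMk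
        continuous_snd)
  refine contDiffOn_of_partials (G := G) hU isOpen_univ (fun v i => (v :: i.1, i.2))
    (fun w i => (i.1, w :: i.2)) (fun i => ?_) (fun i v x hx y _ => ?_) (fun i w x hx y _ => ?_)
    ([], [])
  · refine heval.comp_continuousOn (ContinuousOn.prodMk ?_ continuousOn_snd)
    refine (A i.2).continuous.comp_continuousOn ((hD _).1.comp (by fun_prop) fun z hz => ?_)
    exact ⟨hε, hz.1⟩
  · have h1 := (hD (i.1.map fun v => ((0 : ℝ), v))).2 (0, v) (ε, x) ⟨hε, hx⟩
    have hev : Continuous fun f : 𝓓(Ω, ℝ) => A i.2 f y :=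
      heval.comp ((A i.2).continuous.prodMk continuous_const)
    have h2 := hev.continuousAt.tendsto.comp h1
    rw [HasLineDerivAt, hasDerivAt_iff_tendsto_slope_zero]
    have hnb : 𝓝[≠] (0 : ℝ) ≤ 𝓝[{t : ℝ | t ≠ 0 ∧ ((ε, x) : ℝ × Eu n) + t • ((0 : ℝ), v) ∈
        Ioc (0 : ℝ) 1 ×ˢ U}] 0 := by
      refine le_inf inf_le_left (le_principal_iff.2 ?_)
      have hcont : Continuous fun t : ℝ => x + t • v := by fun_prop
      have hn : ∀ᶠ t : ℝ in 𝓝 0, x + t • v ∈ U :=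
        hcont.continuousAt.eventually (hU.mem_nhds (by simpa using hx))
      filter_upwards [self_mem_nhdsWithin, nhdsWithin_le_nhds hn] with t ht ht'
      exact ⟨ht, by simpa using hε, by simpa using ht'⟩
    refine (h2.mono_left hnb).congr fun t => ?_
    simp only [Function.comp, G, map_smul, map_sub, zero_add, zero_smul, add_zero]
    simp
  · have h1 : DifferentiableAt ℝ (A i.2 (D (i.1.map fun v => ((0 : ℝ), v)) (ε, x))) y :=
      ((A i.2 _).contDiff.differentiable (by simp)) y
    have h2 := h1.lineDifferentiableAt.hasLineDerivAt (v := w)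
    rwa [← TestFunction.lineDerivCLM_apply_of_le (𝕜 := ℝ) (k := ⊤) (by simp)] at h2

end JointSmoothness

/-! ### Lie derivatives in coordinates -/

section FlatLie

variable {n : ℕ}

theorem endAction_apply (η : Covec n) (A : Eu n →L[ℝ] Eu n) (v : Fin n → Eu n) :
    endAction η A v = ∑ i, η (Function.update v i (A (v i))) := by
  change (∑ i : Fin n, η.toContinuousMultilinearMap.compContinuousLinearMap
      (Function.update (fun _ => ContinuousLinearMap.id ℝ (Eu n)) i A)) v = _
  rw [_root_.sum_apply]
  refine Finset.sum_congr rfl fun i _ => ?_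
  rw [ContinuousMultilinearMap.compContinuousLinearMap_apply]
  change η _ = η _
  congr 1
  funext k
  by_cases h : k = i
  · subst h; simp
  · simp [h]

/-- Naturality of the Lie derivative under a change of coordinates `τ` relating the vector fields
`Z` and `W`. The second derivatives of `τ` cancel by their symmetry. -/
theorem lieFormFlat_comp {τ W Z : Eu n → Eu n} {η : Eu n → Covec n} {y : Eu n}
    (hτ : ContDiffAt ℝ ∞ τ y) (hZ : DifferentiableAt ℝ Z y) (hW : DifferentiableAt ℝ W (τ y))
    (hη : DifferentiableAt ℝ η (τ y)) (hWZ : ∀ᶠ x in 𝓝 y, W (τ x) = fderiv ℝ τ x (Z x))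
    (v : Fin n → Eu n) :
    lieFormFlat W η (τ y) (fun i => fderiv ℝ τ y (v i)) =
      fderiv ℝ (fun x => η (τ x) (fun i => fderiv ℝ τ x (v i))) y (Z y) +
        ∑ i, η (τ y) (Function.update (fun i => fderiv ℝ τ y (v i)) i
          (fderiv ℝ τ y (fderiv ℝ Z y (v i)))) := by
  have hτ1 : DifferentiableAt ℝ τ y := hτ.differentiableAt (by simp)
  have hτ2 : DifferentiableAt ℝ (fderiv ℝ τ) y :=
    (hτ.fderiv_right (m := ∞) (by simp)).differentiableAt (by simp)
  have hsymm : IsSymmSndFDerivAt ℝ τ y := hτ.isSymmSndFDerivAt (by simpa using ENat.LEInfty.out)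
  have hητ : DifferentiableAt ℝ (fun x => η (τ x)) y := hη.comp y hτ1
  have hWy : W (τ y) = fderiv ℝ τ y (Z y) := hWZ.self_of_nhds
  have h1 : fderiv ℝ (fun x => η (τ x)) y (Z y) = fderiv ℝ η (τ y) (W (τ y)) := by
    rw [hWy]
    exact congrArg (fun A : Eu n →L[ℝ] Covec n => A (Z y)) (fderiv_comp y hη hτ1)
  have h2 : ∀ i, DifferentiableAt ℝ (fun x => fderiv ℝ τ x (v i)) y := fun i =>
    hτ2.clm_apply (differentiableAt_const _)
  have h3 : ∀ i, fderiv ℝ (fun x => fderiv ℝ τ x (v i)) y (Z y) =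
      fderiv ℝ (fderiv ℝ τ) y (Z y) (v i) := by
    intro i
    rw [fderiv_clm_apply hτ2 (differentiableAt_const _)]
    simp
  have h4 : ∀ i, fderiv ℝ W (τ y) (fderiv ℝ τ y (v i)) =
      fderiv ℝ (fderiv ℝ τ) y (Z y) (v i) + fderiv ℝ τ y (fderiv ℝ Z y (v i)) := by
    intro i
    have ha := congrArg (fun A : Eu n →L[ℝ] Eu n => A (v i)) (fderiv_comp y hW hτ1)
    have hb : W ∘ τ =ᶠ[𝓝 y] fun x => fderiv ℝ τ x (Z x) := hWZ
    rw [hb.fderiv_eq, fderiv_clm_apply hτ2 hZ] at ha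
    have hc := ha.symm
    simp only [ContinuousLinearMap.comp_apply, add_apply, ContinuousLinearMap.flip_apply] at hc
    rw [hc, hsymm.eq (v i) (Z y), add_comm]
  have h5 : fderiv ℝ (fun x => η (τ x) (fun i => fderiv ℝ τ x (v i))) y (Z y) =
      fderiv ℝ η (τ y) (W (τ y)) (fun i => fderiv ℝ τ y (v i)) +
        ∑ i, η (τ y) (Function.update (fun i => fderiv ℝ τ y (v i)) i
          (fderiv ℝ (fderiv ℝ τ) y (Z y) (v i))) := by
    have := fderiv_continuousAlternatingMap_apply_apply hητ h2 (Z y)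
    rw [h1] at this
    simpa only [h3] using this
  rw [h5, add_assoc, ← Finset.sum_add_distrib]
  change fderiv ℝ η (τ y) (W (τ y)) _ + endAction (η (τ y)) (fderiv ℝ W (τ y)) _ = _
  rw [endAction_apply]
  congr 1
  refine Finset.sum_congr rfl fun i _ => ?_
  rw [h4, ContinuousAlternatingMap.map_update_add]

/-- The divergence of a vector field, as the factor by which its derivative acts on the standard
volume form. -/
def divergence (Z : Eu n → Eu n) (y : Eu n) : ℝ :=
  endAction (volForm n) (fderiv ℝ Z y) (stdFrame n)

theorem contDiffOn_divergence {S : Set (Eu n)} (hS : IsOpen S) {Z : Eu n → Eu n}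
    (hZ : ContDiffOn ℝ ∞ Z S) : ContDiffOn ℝ ∞ (divergence Z) S := by
  have h : divergence Z = fun y =>
      ∑ i, volForm n (Function.update (stdFrame n) i (fderiv ℝ Z y (stdFrame n i))) :=
    funext fun y => endAction_apply _ _ _
  rw [h]
  refine ContDiffOn.sum fun i _ => ?_
  have h1 : ContDiffOn ℝ ∞ (fderiv ℝ Z) S := hZ.fderiv_of_isOpen hS (by simp)
  exact ((volForm n).toContinuousMultilinearMap.toContinuousLinearMap
    (stdFrame n) i).contDiff.comp_contDiffOn (h1.clm_apply contDiffOn_const)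

theorem divergence_const (v : Eu n) : divergence (fun _ => v) = 0 := by
  funext y
  rw [divergence, endAction_apply]
  simp

end FlatLie

/-! ### Vector fields and Lie derivatives in charts -/

section ChartFields

variable {n : ℕ} {X : Type*} [TopologicalSpace X] [ChartedSpace (Eu n) X]
  [IsManifold 𝓘(ℝ, Eu n) ∞ X] {e : OpenPartialHomeomorph X (Eu n)}

/-- The expression of a vector field in a chart; meaningful on `e.target`. -/
def chartField (e : OpenPartialHomeomorph X (Eu n)) (V : VectorField n X) : Eu n → Eu n := fun x =>
  chartD e (e.symm x) (V (e.symm x))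

/-- The transition map between two charts relates the expressions of a vector field in them. -/
theorem chartField_transition {c : OpenPartialHomeomorph X (Eu n)} (he : e ∈ charts n X)
    (hc : c ∈ charts n X) (V : VectorField n X) {x : Eu n} (hx : x ∈ e.target)
    (hx' : e.symm x ∈ c.source) :
    chartField c V (c (e.symm x)) = fderiv ℝ (c ∘ e.symm) x (chartField e V x) := by
  have h := chartD_eq_comp he hc (e.map_target hx) hx' (V (e.symm x))
  rw [e.right_inv hx] at h
  rw [chartField, c.left_inv hx']
  exact h

/-- In the preferred trivialization of the tangent bundle a tangent vector is represented by its
image under the differential of the preferred chart. -/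
theorem trivialization_eq_chartD {p q : X} (hq : q ∈ (chartAt (Eu n) p).source)
    (v : TangentSpace 𝓘(ℝ, Eu n) q) :
    (trivializationAt (Eu n) (TangentSpace 𝓘(ℝ, Eu n)) p ⟨q, v⟩).2 =
      chartD (chartAt (Eu n) p) q v := by
  have h := congrArg (fun A : TangentSpace 𝓘(ℝ, Eu n) q →L[ℝ] Eu n => A v)
    (TangentBundle.continuousLinearMapAt_trivializationAt (I := 𝓘(ℝ, Eu n)) hq)
  have hb : q ∈ (trivializationAt (Eu n) (TangentSpace 𝓘(ℝ, Eu n)) p).baseSet := hq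
  simp only [Trivialization.continuousLinearMapAt_apply,
    Trivialization.coe_linearMapAt_of_mem _ hb] at h
  refine h.trans ?_
  simp only [mfld_simps]
  rfl

theorem contDiffOn_chartField (he : e ∈ charts n X) (V : VectorField n X) :
    ContDiffOn ℝ ∞ (chartField e V) e.target := by
  intro x hx
  refine ContDiffAt.contDiffWithinAt ?_
  set p := e.symm x with hp
  set c := chartAt (Eu n) p with hc
  have hcm : c ∈ charts n X := chartAt_mem_charts p
  have hpc : p ∈ c.source := mem_chart_source _ p
  have hV := (contMDiffAt_section (E := fun q : X => TangentSpace 𝓘(ℝ, Eu n) q) p).1 (V.contMDiff p)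
  have h1 : ContMDiffAt 𝓘(ℝ, Eu n) 𝓘(ℝ, Eu n) ∞ e.symm x :=
    (contMDiffOn_symm_of_mem_maximalAtlas he).contMDiffAt (e.open_target.mem_nhds hx)
  have h2 := contMDiffAt_iff_contDiffAt.1 (hV.comp x h1)
  have hdom := isOpen_transition_source e c
  have hxd : x ∈ e.target ∩ e.symm ⁻¹' c.source := ⟨hx, hpc⟩
  have h3 : ContDiffAt ℝ ∞ (c ∘ e.symm) x :=
    (contDiffOn_transition he hcm).contDiffAt (hdom.mem_nhds hxd)
  have hdom' := isOpen_transition_source c e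
  have hcx : c p ∈ c.target ∩ c.symm ⁻¹' e.source :=
    ⟨c.map_source hpc, by
      rw [mem_preimage, c.left_inv hpc]
      exact e.map_target hx⟩
  have h4 : ContDiffAt ℝ ∞ (fderiv ℝ (e ∘ c.symm)) (c p) :=
    ((contDiffOn_transition hcm he).fderiv_of_isOpen hdom' (by simp)).contDiffAt
      (hdom'.mem_nhds hcx)
  refine ((h4.comp x h3).clm_apply h2).congr_of_eventuallyEq ?_
  filter_upwards [hdom.mem_nhds hxd] with z hz
  exact (chartD_eq_comp hcm he hz.2 (e.map_target hz.1) _).trans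
    (congrArg _ (trivialization_eq_chartD hz.2 _).symm)

/-- The vector field with constant coefficients in a global chart. -/
def constField (he : e ∈ charts n X) (hs : e.source = univ) (v : Eu n) : VectorField n X where
  toFun p := chartDSymm e (e p) v
  contMDiff_toFun := by
    intro p
    refine (contMDiffAt_section (E := fun q : X => TangentSpace 𝓘(ℝ, Eu n) q)
      (s := fun q => chartDSymm e (e q) v) p).2 ?_
    set c := chartAt (Eu n) p with hc
    have hcm : c ∈ charts n X := chartAt_mem_charts p
    have hpc : p ∈ c.source := mem_chart_source _ p
    have hxd : e p ∈ e.target ∩ e.symm ⁻¹' c.source :=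
      ⟨mem_target_of_global hs p, by rwa [mem_preimage, symm_apply_of_global hs]⟩
    have hdom := isOpen_transition_source e c
    have h1 : ContDiffAt ℝ ∞ (fderiv ℝ (c ∘ e.symm)) (e p) :=
      ((contDiffOn_transition he hcm).fderiv_of_isOpen hdom (by simp)).contDiffAt
        (hdom.mem_nhds hxd)
    have h2 : ContMDiffAt 𝓘(ℝ, Eu n) 𝓘(ℝ, Eu n) ∞ e p :=
      (contMDiffOn_of_mem_maximalAtlas he).contMDiffAt (e.open_source.mem_nhds (by simp [hs]))
    refine ((contMDiffAt_iff_contDiffAt.2 (h1.clm_apply (contDiffAt_const (c := v)))).comp p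
      h2).congr_of_eventuallyEq ?_
    filter_upwards [c.open_source.mem_nhds hpc] with q hq
    refine ((trivialization_eq_chartD hq _).trans
      (chartD_eq_comp he hcm (by simp [hs]) hq _)).trans ?_
    have h3 := chartD_chartDSymm he (mem_target_of_global hs q) v
    rw [symm_apply_of_global hs] at h3
    rw [h3]
    rfl

theorem chartField_constField (he : e ∈ charts n X) (hs : e.source = univ) (v : Eu n) {x : Eu n}
    (hx : x ∈ e.target) : chartField e (constField he hs v) x = v := by
  change chartD e (e.symm x) (chartDSymm e (e (e.symm x)) v) = v
  rw [e.right_inv hx, chartD_chartDSymm he hx]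

/-- The coefficient of a Lie derivative in a chart. -/
theorem coeff_lieForm (he : e ∈ charts n X) (V : VectorField n X) {σ : X → Covec n} {y : Eu n}
    (hy : y ∈ e.target) (hσ : DifferentiableAt ℝ (coeff e σ) y) :
    coeff e (lieForm V σ) y = fderiv ℝ (coeff e σ) y (chartField e V y) +
      coeff e σ y * divergence (chartField e V) y := by
  set p := e.symm y with hp
  set c := chartAt (Eu n) p with hc
  have hcm : c ∈ charts n X := chartAt_mem_charts p
  have hpc : p ∈ c.source := mem_chart_source _ p
  have hpe : p ∈ e.source := e.map_target hy
  have hep : e p = y := e.right_inv hy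
  have hdom := isOpen_transition_source e c
  have hyd : y ∈ e.target ∩ e.symm ⁻¹' c.source := ⟨hy, hpc⟩
  have hdom' := isOpen_transition_source c e
  have hcy : c p ∈ c.target ∩ c.symm ⁻¹' e.source :=
    ⟨c.map_source hpc, by rwa [mem_preimage, c.left_inv hpc]⟩
  have hτ : ContDiffAt ℝ ∞ (c ∘ e.symm) y :=
    (contDiffOn_transition he hcm).contDiffAt (hdom.mem_nhds hyd)
  have hZ : DifferentiableAt ℝ (chartField e V) y :=
    ((contDiffOn_chartField he V).contDiffAt (e.open_target.mem_nhds hy)).differentiableAt (by simp)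
  have hW : DifferentiableAt ℝ (chartField c V) (c p) :=
    ((contDiffOn_chartField hcm V).contDiffAt (c.open_target.mem_nhds hcy.1)).differentiableAt
      (by simp)
  have hη : DifferentiableAt ℝ (pushForm c σ) (c p) := by
    have h1 : DifferentiableAt ℝ (fun x => ((fderiv ℝ (e ∘ c.symm) x).det *
        coeff e σ (e (c.symm x))) • volForm n) (c p) := by
      refine DifferentiableAt.smul_const (DifferentiableAt.mul ?_ ?_) _
      · exact ((contDiffOn_det_transition hcm he).contDiffAt
          (hdom'.mem_nhds hcy)).differentiableAt (by simp)
      · refine DifferentiableAt.comp (c p) (g := coeff e σ) (f := e ∘ c.symm) ?_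
          (differentiableAt_transition hcm he hcy)
        rwa [Function.comp, c.left_inv hpc, hep]
    refine h1.congr_of_eventuallyEq ?_
    filter_upwards [hdom'.mem_nhds hcy] with x hx
    rw [pushForm_eq, coeff_transform hcm he σ hx.1 hx.2]
  have hWZ : ∀ᶠ x in 𝓝 y, chartField c V ((c ∘ e.symm) x) =
      fderiv ℝ (c ∘ e.symm) x (chartField e V x) := by
    filter_upwards [hdom.mem_nhds hyd] with x hx using chartField_transition he hcm V hx.1 hx.2
  have hmain := lieFormFlat_comp hτ hZ hW hη hWZ (stdFrame n)
  have hpull : ∀ x ∈ e.target ∩ e.symm ⁻¹' c.source, ∀ v : Fin n → Eu n,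
      pushForm c σ ((c ∘ e.symm) x) (fun i => fderiv ℝ (c ∘ e.symm) x (v i)) =
        coeff e σ x * volForm n v := by
    intro x hx v
    have h2 : pushForm e σ x v = coeff e σ x * volForm n v := by rw [pushForm_eq]; rfl
    rw [← h2]
    change σ (c.symm (c (e.symm x))) (fun i => chartDSymm c (c (e.symm x)) _) =
      σ (e.symm x) (fun i => chartDSymm e x (v i))
    rw [c.left_inv hx.2]
    congr 1
    funext i
    exact (chartDSymm_eq_comp he hcm hx.1 hx.2 (v i)).symm
  have hL : coeff e (lieForm V σ) y = lieFormFlat (chartField c V) (pushForm c σ) ((c ∘ e.symm) y)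
      (fun i => fderiv ℝ (c ∘ e.symm) y (stdFrame n i)) := by
    rw [coeff_apply]
    change lieFormFlat (chartField c V) (pushForm c σ) (c p)
      (fun i => chartD c p (chartDSymm e y (stdFrame n i))) = _
    congr 1
    funext i
    rw [chartD_eq_comp he hcm hpe hpc, hep, chartD_chartDSymm he hy]
  -- the first term of `hmain` differentiates the coefficient, the second is its divergence factor
  rw [hL, hmain]
  congr 1
  · have h3 : (fun x => pushForm c σ ((c ∘ e.symm) x)
        (fun i => fderiv ℝ (c ∘ e.symm) x (stdFrame n i))) =ᶠ[𝓝 y] coeff e σ := by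
      filter_upwards [hdom.mem_nhds hyd] with x hx
      rw [hpull x hx, volForm_stdFrame, mul_one]
    rw [h3.fderiv_eq]
  · rw [divergence, endAction_apply, Finset.mul_sum]
    refine Finset.sum_congr rfl fun i _ => ?_
    rw [← hpull y hyd]
    congr 1
    funext k
    by_cases h : k = i
    · subst h; simp
    · simp [h]

/-- The derivative of a two-point form along the flow of a vector field, in a chart. -/
theorem coeff_lieFst (he : e ∈ charts n X) (V : VectorField n X)
    {Ψ : X → X → Covec n} {x y : Eu n} (hx : x ∈ e.target) (hy : y ∈ e.target)
    (hΨ : DifferentiableAt ℝ (fun x' => coeff e (Ψ (e.symm x')) y) x) :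
    coeff e (lieFst V Ψ (e.symm x)) y =
      fderiv ℝ (fun x' => coeff e (Ψ (e.symm x')) y) x (chartField e V x) := by
  set p := e.symm x with hp
  have hex : ∃ γ : ℝ → X, γ 0 = p ∧ IsMIntegralCurveAt γ (fun q => V q) 0 :=
    have : IsManifold 𝓘(ℝ, Eu n) 1 X := IsManifold.of_le (n := ∞) (by exact_mod_cast le_top)
    exists_isMIntegralCurveAt_of_contMDiffAt_boundaryless 0
      ((V.contMDiff.of_le (by exact_mod_cast le_top)).contMDiffAt)
  -- a local integral curve exists, so `flowCurve` is one
  set γ := flowCurve V p with hγ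
  have hγ' : γ 0 = p ∧ IsMIntegralCurveAt γ (fun q => V q) 0 := by
    rw [hγ, flowCurve, dif_pos hex]
    exact hex.choose_spec
  have hpe : p ∈ e.source := e.map_target hx
  have hderiv : HasDerivAt (e ∘ γ) (chartField e V x) 0 := by
    have h1 := hγ'.2.hasMFDerivAt
    have h2 : HasMFDerivAt 𝓘(ℝ, Eu n) 𝓘(ℝ, Eu n) e (γ 0) (mfderiv 𝓘(ℝ, Eu n) 𝓘(ℝ, Eu n) e (γ 0)) :=
      ((mdifferentiable_of_mem_charts he).mdifferentiableAt (by rwa [hγ'.1])).hasMFDerivAt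
    have h3 : HasFDerivAt (e ∘ γ) ((chartD e (γ 0)).comp
        ((1 : ℝ →L[ℝ] ℝ).smulRight (V (γ 0) : Eu n))) 0 := (h2.comp (0 : ℝ) h1).hasFDerivAt
    refine h3.hasDerivAt.congr_deriv ?_
    rw [hγ'.1]
    exact congrArg (chartD e p) (one_smul ℝ (V p : Eu n))
  have hcont : ContinuousAt γ 0 := hγ'.2.hasMFDerivAt.1
  -- near `t = 0` the curve stays in the chart domain, where forms are multiples of a fixed one
  have hform : (fun t => Ψ (γ t) (e.symm y)) =ᶠ[𝓝 0] fun t =>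
      coeff e (Ψ (e.symm ((e ∘ γ) t))) y •
        (volForm n).compContinuousLinearMap (chartD e (e.symm y)) := by
    filter_upwards [hcont.eventually (e.open_source.mem_nhds (by rwa [hγ'.1]))] with t ht
    ext v
    rw [form_eq_coeff he _ (e.map_target hy), e.right_inv hy, Function.comp, e.left_inv ht]
    rfl
  have hex0 : (e ∘ γ) 0 = x := by rw [Function.comp, hγ'.1, hp, e.right_inv hx]
  have hd := (hΨ.hasFDerivAt.comp_hasDerivAt_of_eq 0 hderiv hex0.symm).smul_const
    ((volForm n).compContinuousLinearMap (chartD e (e.symm y)))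
  have hL : lieFst V Ψ p (e.symm y) = fderiv ℝ (fun x' => coeff e (Ψ (e.symm x')) y) x
      (chartField e V x) • (volForm n).compContinuousLinearMap (chartD e (e.symm y)) := by
    rw [lieFst, hform.deriv_eq]
    exact hd.deriv
  rw [coeff_apply, hL]
  change _ * volForm n (fun i => chartD e (e.symm y) (chartDSymm e y (stdFrame n i))) = _
  simp only [chartD_chartDSymm he hy]
  rw [volForm_stdFrame, mul_one]

end ChartFields

/-! ### Words in directional derivatives -/

section Words

variable {n : ℕ} {E : Type*} [NormedAddCommGroup E] [NormedSpace ℝ E]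

/-- The derivative of a function in a fixed direction, as an operator. -/
def derivAlong (v : E) (F : E → ℝ) : E → ℝ := fun z => fderiv ℝ F z v

theorem contDiffOn_derivAlong {S : Set E} (hS : IsOpen S) {F : E → ℝ} (hF : ContDiffOn ℝ ∞ F S)
    (v : E) : ContDiffOn ℝ ∞ (derivAlong v F) S :=
  (hF.fderiv_of_isOpen hS (by simp)).clm_apply contDiffOn_const

theorem derivAlong_congr {S : Set E} (hS : IsOpen S) {F G : E → ℝ} (h : EqOn F G S) (v : E) :
    EqOn (derivAlong v F) (derivAlong v G) S := fun z hz => by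
  have h1 : F =ᶠ[𝓝 z] G := by filter_upwards [hS.mem_nhds hz] with z' hz' using h hz'
  rw [derivAlong, derivAlong, h1.fderiv_eq]

theorem differentiableAt_of_contDiffOn {S : Set E} (hS : IsOpen S) {F : E → ℝ}
    (hF : ContDiffOn ℝ ∞ F S) {z : E} (hz : z ∈ S) : DifferentiableAt ℝ F z :=
  (hF.contDiffAt (hS.mem_nhds hz)).differentiableAt (by simp)

theorem derivAlong_add {S : Set E} (hS : IsOpen S) {F G : E → ℝ} (hF : ContDiffOn ℝ ∞ F S)
    (hG : ContDiffOn ℝ ∞ G S) (v : E) :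
    EqOn (derivAlong v (F + G)) (derivAlong v F + derivAlong v G) S := fun z hz => by
  rw [derivAlong, fderiv_add (differentiableAt_of_contDiffOn hS hF hz)
    (differentiableAt_of_contDiffOn hS hG hz)]
  rfl

theorem derivAlong_mul {S : Set E} (hS : IsOpen S) {F G : E → ℝ} (hF : ContDiffOn ℝ ∞ F S)
    (hG : ContDiffOn ℝ ∞ G S) (v : E) :
    EqOn (derivAlong v (F * G)) (derivAlong v F * G + F * derivAlong v G) S := fun z hz => by
  rw [derivAlong, fderiv_mul (differentiableAt_of_contDiffOn hS hF hz)
    (differentiableAt_of_contDiffOn hS hG hz)]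
  simp only [add_apply, smul_apply, smul_eq_mul, Pi.add_apply, Pi.mul_apply, derivAlong]
  ring

theorem derivAlong_comm {S : Set E} (hS : IsOpen S) {F : E → ℝ} (hF : ContDiffOn ℝ ∞ F S)
    (v w : E) : EqOn (derivAlong v (derivAlong w F)) (derivAlong w (derivAlong v F)) S :=
  fun z hz => by
  have h1 : ContDiffAt ℝ ∞ F z := hF.contDiffAt (hS.mem_nhds hz)
  have h2 : DifferentiableAt ℝ (fderiv ℝ F) z :=
    (h1.fderiv_right (m := ∞) (by simp)).differentiableAt (by simp)
  have hs : IsSymmSndFDerivAt ℝ F z := h1.isSymmSndFDerivAt (by simpa using ENat.LEInfty.out)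
  have h3 : ∀ a b : E, derivAlong a (derivAlong b F) z = fderiv ℝ (fderiv ℝ F) z a b := by
    intro a b
    rw [derivAlong]
    change fderiv ℝ (fun z => fderiv ℝ F z b) z a = _
    rw [fderiv_clm_apply h2 (differentiableAt_const _)]
    simp
  rw [h3, h3, hs.eq]

/-- The letters `inl i` and `inr i` stand for the operators `∂_{x_i} + ∂_{y_i}` and `∂_{y_i}`; this
is the direction of differentiation. -/
def letterDir : Fin n ⊕ Fin n → Eu n × Eu n
  | .inl i => (stdFrame n i, stdFrame n i)
  | .inr i => (0, stdFrame n i)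

/-- Iterated derivatives `∂_{x_i} + ∂_{y_i}` and `∂_{y_i}` as described by a word, with the first
letter as the outermost operator. -/
def wordDeriv (w : List (Fin n ⊕ Fin n)) (F : Eu n × Eu n → ℝ) : Eu n × Eu n → ℝ :=
  w.foldr (fun l G => derivAlong (letterDir l) G) F

/-- The number of letters `∂_{y_i}` in a word. -/
def sndCount (w : List (Fin n ⊕ Fin n)) : ℕ := w.countP Sum.isRight

theorem wordDeriv_append (w w' : List (Fin n ⊕ Fin n)) (F : Eu n × Eu n → ℝ) :
    wordDeriv (w ++ w') F = wordDeriv w (wordDeriv w' F) :=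
  List.foldr_append

variable {S : Set (Eu n × Eu n)} {F G : Eu n × Eu n → ℝ}

theorem contDiffOn_wordDeriv (hS : IsOpen S) (hF : ContDiffOn ℝ ∞ F S)
    (w : List (Fin n ⊕ Fin n)) : ContDiffOn ℝ ∞ (wordDeriv w F) S := by
  induction w with
  | nil => exact hF
  | cons l w ih => exact contDiffOn_derivAlong hS ih _

theorem wordDeriv_congr (hS : IsOpen S) (h : EqOn F G S) (w : List (Fin n ⊕ Fin n)) :
    EqOn (wordDeriv w F) (wordDeriv w G) S := by
  induction w with
  | nil => exact h
  | cons l w ih => exact derivAlong_congr hS ih _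

theorem wordDeriv_add (hS : IsOpen S) (hF : ContDiffOn ℝ ∞ F S) (hG : ContDiffOn ℝ ∞ G S)
    (w : List (Fin n ⊕ Fin n)) : EqOn (wordDeriv w (F + G)) (wordDeriv w F + wordDeriv w G) S := by
  induction w with
  | nil => exact fun _ _ => rfl
  | cons l w ih =>
    exact (derivAlong_congr hS ih _).trans (derivAlong_add hS (contDiffOn_wordDeriv hS hF w)
      (contDiffOn_wordDeriv hS hG w) _)

theorem wordDeriv_perm (hS : IsOpen S) (hF : ContDiffOn ℝ ∞ F S) {w w' : List (Fin n ⊕ Fin n)}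
    (h : w.Perm w') : EqOn (wordDeriv w F) (wordDeriv w' F) S := by
  induction h with
  | nil => exact fun _ _ => rfl
  | cons l _ ih => exact derivAlong_congr hS ih _
  | swap l l' w => exact derivAlong_comm hS (contDiffOn_wordDeriv hS hF w) _ _
  | trans _ _ h1 h2 => exact h1.trans h2

/-- One step of the Leibniz rule, for the innermost letter of a word. -/
theorem wordDeriv_concat_mul (hS : IsOpen S) (hF : ContDiffOn ℝ ∞ F S) (hG : ContDiffOn ℝ ∞ G S)
    (w : List (Fin n ⊕ Fin n)) (l : Fin n ⊕ Fin n) :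
    EqOn (wordDeriv (w ++ [l]) (F * G)) (wordDeriv w (derivAlong (letterDir l) F * G) +
      wordDeriv w (F * derivAlong (letterDir l) G)) S := by
  rw [wordDeriv_append]
  refine (wordDeriv_congr hS (derivAlong_mul hS hF hG (letterDir l)) w).trans ?_
  exact wordDeriv_add hS ((contDiffOn_derivAlong hS hF _).mul hG)
    (hF.mul (contDiffOn_derivAlong hS hG _)) w

end Words

/-! ### Orders of growth -/

section Orders

variable {n : ℕ}

/-- The filter of neighbourhoods of `0` in the parameter interval. -/
def smallParam : Filter Param := comap (fun ε : Param => (ε : ℝ)) (𝓝 0)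

theorem eventually_smallParam {p : Param → Prop} :
    (∀ᶠ ε in smallParam, p ε) ↔ ∃ ε₀ > (0 : ℝ), ∀ ε : Param, (ε : ℝ) ≤ ε₀ → p ε := by
  rw [smallParam, eventually_comap, Metric.eventually_nhds_iff]
  constructor
  · rintro ⟨r, hr, h⟩
    refine ⟨r / 2, half_pos hr, fun ε hε => h ?_ ε rfl⟩
    rw [Real.dist_0_eq_abs, abs_of_pos ε.2.1]
    linarith
  · rintro ⟨r, hr, h⟩
    refine ⟨r, hr, fun y hy ε hε => h ε ?_⟩
    rw [Real.dist_0_eq_abs, ← hε, abs_of_pos ε.2.1] at hy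
    exact hy.le

/-- The family `F` is `O(ε^{-j})` on `Ω × Ω`, locally uniformly in the first variable and uniformly
in the second one. -/
def DecayBound (Ω : Set (Eu n)) (j : ℕ) (F : Param → Eu n × Eu n → ℝ) : Prop :=
  ∀ K ⊆ Ω, IsCompact K → ∃ C : ℝ, ∀ᶠ ε : Param in smallParam, ∀ x ∈ K, ∀ y ∈ Ω,
    |F ε (x, y)| ≤ C / (ε : ℝ) ^ j

/-- A family of smooth functions on `Ω × Ω` whose supports shrink to the diagonal linearly in `ε`,
locally uniformly in the first variable. -/
structure Concentrated (Ω : Set (Eu n)) (F : Param → Eu n × Eu n → ℝ) : Prop where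
  smooth : ∀ ε, ContDiffOn ℝ ∞ (F ε) (Ω ×ˢ Ω)
  near : ∀ K ⊆ Ω, IsCompact K → ∃ C : ℝ, ∀ᶠ ε : Param in smallParam, ∀ x ∈ K, ∀ y ∈ Ω,
    F ε (x, y) ≠ 0 → dist y x ≤ C * ε

/-- The family `F` has order `m`: with respect to the operators `∂_{x_i} + ∂_{y_i}` and `∂_{y_i}`,
derivatives with `b` factors of the second kind are `O(ε^{-m-b})`. -/
structure HasOrder (Ω : Set (Eu n)) (m : ℕ) (F : Param → Eu n × Eu n → ℝ) : Prop
    extends Concentrated Ω F where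
  bound : ∀ w, DecayBound Ω (m + sndCount w) fun ε => wordDeriv w (F ε)

variable {Ω : Set (Eu n)} {F G : Param → Eu n × Eu n → ℝ} {j m : ℕ}

theorem DecayBound.congr (h : DecayBound Ω j F) (hFG : ∀ ε, EqOn (G ε) (F ε) (Ω ×ˢ Ω)) :
    DecayBound Ω j G := by
  intro K hK hKc
  obtain ⟨C, hC⟩ := h K hK hKc
  refine ⟨C, hC.mono fun ε hε x hx y hy => ?_⟩
  rw [hFG ε ⟨hK hx, hy⟩]
  exact hε x hx y hy

theorem DecayBound.add (hF : DecayBound Ω j F) (hG : DecayBound Ω j G) :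
    DecayBound Ω j fun ε => F ε + G ε := by
  intro K hK hKc
  obtain ⟨C, hC⟩ := hF K hK hKc
  obtain ⟨C', hC'⟩ := hG K hK hKc
  refine ⟨C + C', ?_⟩
  filter_upwards [hC, hC'] with ε h1 h2 x hx y hy
  rw [add_div]
  exact (abs_add_le _ _).trans (add_le_add (h1 x hx y hy) (h2 x hx y hy))

theorem DecayBound.mono (hF : DecayBound Ω j F) {k : ℕ} (hjk : j ≤ k) : DecayBound Ω k F := by
  intro K hK hKc
  obtain ⟨C, hC⟩ := hF K hK hKc
  refine ⟨|C|, hC.mono fun ε h1 x hx y hy => (h1 x hx y hy).trans ?_⟩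
  refine (div_le_div_of_nonneg_right (le_abs_self C) (pow_nonneg ε.2.1.le _)).trans ?_
  exact div_le_div_of_nonneg_left (abs_nonneg _) (pow_pos ε.2.1 _)
    (pow_le_pow_of_le_one ε.2.1.le ε.2.2 hjk)

theorem Concentrated.congr (h : Concentrated Ω F) (hFG : ∀ ε, EqOn (G ε) (F ε) (Ω ×ˢ Ω)) :
    Concentrated Ω G where
  smooth ε := (h.smooth ε).congr (hFG ε)
  near K hK hKc := by
    obtain ⟨C, hC⟩ := h.near K hK hKc
    refine ⟨C, hC.mono fun ε hε x hx y hy => ?_⟩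
    rw [hFG ε ⟨hK hx, hy⟩]
    exact hε x hx y hy

theorem Concentrated.add (hF : Concentrated Ω F) (hG : Concentrated Ω G) :
    Concentrated Ω fun ε => F ε + G ε where
  smooth ε := (hF.smooth ε).add (hG.smooth ε)
  near K hK hKc := by
    obtain ⟨C, hC⟩ := hF.near K hK hKc
    obtain ⟨C', hC'⟩ := hG.near K hK hKc
    refine ⟨max C C', ?_⟩
    filter_upwards [hC, hC'] with ε h1 h2 x hx y hy hne
    by_cases h : F ε (x, y) = 0
    · have h' : G ε (x, y) ≠ 0 := fun h' => hne (by rw [Pi.add_apply, h, h', add_zero])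
      exact (h2 x hx y hy h').trans (mul_le_mul_of_nonneg_right (le_max_right _ _) ε.2.1.le)
    · exact (h1 x hx y hy h).trans (mul_le_mul_of_nonneg_right (le_max_left _ _) ε.2.1.le)

theorem Concentrated.mul {a : Eu n × Eu n → ℝ} (ha : ContDiffOn ℝ ∞ a (Ω ×ˢ Ω))
    (hF : Concentrated Ω F) : Concentrated Ω fun ε => a * F ε where
  smooth ε := ha.mul (hF.smooth ε)
  near K hK hKc := by
    obtain ⟨C, hC⟩ := hF.near K hK hKc
    exact ⟨C, hC.mono fun ε h x hx y hy hne => h x hx y hy (right_ne_zero_of_mul hne)⟩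

theorem Concentrated.derivAlong (hΩ : IsOpen Ω) (hF : Concentrated Ω F) (v : Eu n × Eu n) :
    Concentrated Ω fun ε => derivAlong v (F ε) where
  smooth ε := contDiffOn_derivAlong (hΩ.prod hΩ) (hF.smooth ε) v
  near K hK hKc := by
    -- the bound on a neighbourhood of `K` is needed to control derivatives at points of `K`
    obtain ⟨K', hK'c, hKK', hK'⟩ := exists_compact_between hKc hΩ hK
    obtain ⟨C, hC⟩ := hF.near K' hK' hK'c
    refine ⟨C, hC.mono fun ε h x hx y hy hne => ?_⟩
    by_contra! hlt
    refine hne ?_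
    have h0 : F ε =ᶠ[𝓝 (x, y)] fun _ => 0 := by
      have h1 : ∀ᶠ z : Eu n × Eu n in 𝓝 (x, y), C * ε < dist z.2 z.1 :=
        continuousAt_const.eventually_lt (by fun_prop) hlt
      have h2 : ∀ᶠ z : Eu n × Eu n in 𝓝 (x, y), z ∈ interior K' ×ˢ Ω :=
        (isOpen_interior.prod hΩ).mem_nhds ⟨hKK' hx, hy⟩
      filter_upwards [h1, h2] with z hz1 hz2
      by_contra hz
      exact absurd (h z.1 (interior_subset hz2.1) z.2 hz2.2 hz) (not_le.2 hz1)
    rw [SmoothingKernel.derivAlong, h0.fderiv_eq]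
    simp

/-- For `x` in a compact set, the supports of a concentrated family lie in a neighbourhood of the
diagonal over this set which is compact in `Ω × Ω`. -/
theorem Concentrated.exists_near (hΩ : IsOpen Ω) (hF : Concentrated Ω F) {K : Set (Eu n)}
    (hK : K ⊆ Ω) (hKc : IsCompact K) :
    ∃ δ > 0, ∃ C > 0, IsCompact (Metric.cthickening δ K) ∧ Metric.cthickening δ K ⊆ Ω ∧
      ∀ᶠ ε : Param in smallParam, ∀ x ∈ K, ∀ y ∈ Ω, F ε (x, y) ≠ 0 →
        dist y x ≤ C * ε ∧ dist y x ≤ δ := by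
  obtain ⟨δ, hδ, hδΩ⟩ := hKc.exists_cthickening_subset_open hΩ hK
  obtain ⟨C, hC⟩ := hF.near K hK hKc
  refine ⟨δ, hδ, max C 1, by positivity, hKc.cthickening, hδΩ, ?_⟩
  have h1 : ∀ᶠ ε : Param in smallParam, (ε : ℝ) ≤ δ / max C 1 :=
    eventually_smallParam.2 ⟨_, by positivity, fun _ h => h⟩
  filter_upwards [hC, h1] with ε hε hε' x hx y hy hne
  have h2 : dist y x ≤ max C 1 * ε :=
    (hε x hx y hy hne).trans (mul_le_mul_of_nonneg_right (le_max_left _ _) ε.2.1.le)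
  refine ⟨h2, h2.trans ?_⟩
  rw [le_div_iff₀ (by positivity)] at hε'
  linarith

theorem mem_cthickening_of_dist_le {δ : ℝ} {K : Set (Eu n)} {x y : Eu n} (hx : x ∈ K)
    (h : dist y x ≤ δ) : y ∈ Metric.cthickening δ K :=
  Metric.closedBall_subset_cthickening hx δ h

theorem DecayBound.mul (hΩ : IsOpen Ω) {a : Eu n × Eu n → ℝ} (ha : ContinuousOn a (Ω ×ˢ Ω))
    (hF : Concentrated Ω F) (hb : DecayBound Ω j F) : DecayBound Ω j fun ε => a * F ε := by
  intro K hK hKc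
  obtain ⟨δ, hδ, C, hC0, hc, hcΩ, hnear⟩ := hF.exists_near hΩ hK hKc
  obtain ⟨C', hC'⟩ := hb K hK hKc
  obtain ⟨A, hA⟩ := (hKc.prod hc).exists_bound_of_continuousOn (ha.mono (prod_mono hK hcΩ))
  refine ⟨|A| * |C'|, ?_⟩
  filter_upwards [hnear, hC'] with ε h1 h2 x hx y hy
  rw [Pi.mul_apply, abs_mul, mul_div_assoc]
  by_cases hne : F ε (x, y) = 0
  · rw [hne, abs_zero, mul_zero]
    have := ε.2.1
    positivity
  · refine mul_le_mul ?_ ((h2 x hx y hy).trans ?_) (abs_nonneg _) (abs_nonneg _)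
    · exact (hA (x, y) ⟨hx, mem_cthickening_of_dist_le hx (h1 x hx y hy hne).2⟩).trans
        (le_abs_self A)
    · exact div_le_div_of_nonneg_right (le_abs_self _) (pow_nonneg ε.2.1.le _)

/-- A factor that vanishes on the diagonal gains one power of `ε`. -/
theorem DecayBound.mul_of_diagonal (hΩ : IsOpen Ω) {a : Eu n × Eu n → ℝ}
    (ha : ContDiffOn ℝ ∞ a (Ω ×ˢ Ω)) (ha0 : ∀ x ∈ Ω, a (x, x) = 0)
    (hF : Concentrated Ω F) (hb : DecayBound Ω (j + 1) F) : DecayBound Ω j fun ε => a * F ε := by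
  intro K hK hKc
  obtain ⟨δ, hδ, C, hC0, hc, hcΩ, hnear⟩ := hF.exists_near hΩ hK hKc
  obtain ⟨C', hC'⟩ := hb K hK hKc
  have hS : IsOpen (Ω ×ˢ Ω) := hΩ.prod hΩ
  obtain ⟨A, hA⟩ := (hKc.prod hc).exists_bound_of_continuousOn
    ((ha.continuousOn_fderiv_of_isOpen hS (by simp)).mono (prod_mono hK hcΩ))
  refine ⟨|A| * C * |C'|, ?_⟩
  filter_upwards [hnear, hC'] with ε h1 h2 x hx y hy
  have hε := ε.2.1
  rw [Pi.mul_apply, abs_mul]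
  by_cases hne : F ε (x, y) = 0
  · rw [hne, abs_zero, mul_zero]
    positivity
  · obtain ⟨h3, h4⟩ := h1 x hx y hy hne
    have hconv : Convex ℝ (({x} : Set (Eu n)) ×ˢ Metric.closedBall x δ) :=
      (convex_singleton x).prod (convex_closedBall x δ)
    have hsub : ({x} : Set (Eu n)) ×ˢ Metric.closedBall x δ ⊆ K ×ˢ Metric.cthickening δ K :=
      prod_mono (singleton_subset_iff.2 hx) (Metric.closedBall_subset_cthickening hx δ)
    have hlip := hconv.norm_image_sub_le_of_norm_fderiv_le (f := a) (C := |A|)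
      (fun z hz => differentiableAt_of_contDiffOn hS ha (prod_mono hK hcΩ (hsub hz)))
      (fun z hz => (hA z (hsub hz)).trans (le_abs_self A))
      (x := (x, x)) (y := (x, y)) ⟨rfl, Metric.mem_closedBall_self hδ.le⟩ ⟨rfl, h4⟩
    rw [ha0 x (hK hx), sub_zero, Prod.mk_sub_mk, sub_self, Prod.norm_mk, norm_zero,
      max_eq_right (norm_nonneg _), ← dist_eq_norm] at hlip
    have h5 : |a (x, y)| ≤ |A| * (C * ε) :=
      hlip.trans (mul_le_mul_of_nonneg_left h3 (abs_nonneg _))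
    have h6 : |F ε (x, y)| ≤ |C'| / (ε : ℝ) ^ (j + 1) :=
      (h2 x hx y hy).trans (div_le_div_of_nonneg_right (le_abs_self _) (pow_nonneg hε.le _))
    refine (mul_le_mul h5 h6 (abs_nonneg _) (by positivity)).trans (le_of_eq ?_)
    field_simp
    ring

theorem HasOrder.congr (h : HasOrder Ω m F) (hΩ : IsOpen Ω)
    (hFG : ∀ ε, EqOn (G ε) (F ε) (Ω ×ˢ Ω)) : HasOrder Ω m G where
  toConcentrated := h.toConcentrated.congr hFG
  bound w := (h.bound w).congr fun ε => wordDeriv_congr (hΩ.prod hΩ) (hFG ε) w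

theorem HasOrder.add (hΩ : IsOpen Ω) (hF : HasOrder Ω m F) (hG : HasOrder Ω m G) :
    HasOrder Ω m fun ε => F ε + G ε where
  toConcentrated := hF.toConcentrated.add hG.toConcentrated
  bound w := ((hF.bound w).add (hG.bound w)).congr fun ε =>
    wordDeriv_add (hΩ.prod hΩ) (hF.smooth ε) (hG.smooth ε) w

theorem HasOrder.mono (hF : HasOrder Ω m F) {m' : ℕ} (h : m ≤ m') : HasOrder Ω m' F where
  toConcentrated := hF.toConcentrated
  bound w := (hF.bound w).mono (Nat.add_le_add_right h _)

theorem HasOrder.derivAlong_inl (hΩ : IsOpen Ω) (hF : HasOrder Ω m F) (i : Fin n) :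
    HasOrder Ω m fun ε => derivAlong (letterDir (.inl i)) (F ε) where
  toConcentrated := hF.toConcentrated.derivAlong hΩ _
  bound w := by
    have h := hF.bound (w ++ [.inl i])
    simpa [wordDeriv_append, sndCount, wordDeriv] using h

theorem HasOrder.derivAlong_inr (hΩ : IsOpen Ω) (hF : HasOrder Ω m F) (i : Fin n) :
    HasOrder Ω (m + 1) fun ε => derivAlong (letterDir (.inr i)) (F ε) where
  toConcentrated := hF.toConcentrated.derivAlong hΩ _
  bound w := by
    have h := hF.bound (w ++ [.inr i])
    have e : m + sndCount (w ++ [Sum.inr i]) = m + 1 + sndCount w := by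
      simp [sndCount]; omega
    rw [e] at h
    simpa [wordDeriv_append, wordDeriv] using h

theorem HasOrder.mul (hΩ : IsOpen Ω) {a : Eu n × Eu n → ℝ} (ha : ContDiffOn ℝ ∞ a (Ω ×ˢ Ω))
    (hF : HasOrder Ω m F) : HasOrder Ω m fun ε => a * F ε where
  toConcentrated := hF.toConcentrated.mul ha
  bound w := by
    have hS : IsOpen (Ω ×ˢ Ω) := hΩ.prod hΩ
    induction w using List.reverseRecOn generalizing a F m with
    | nil => exact DecayBound.mul hΩ ha.continuousOn hF.toConcentrated (hF.bound [])
    | append_singleton w l ih =>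
      refine DecayBound.congr (DecayBound.add ?_ ?_) fun ε =>
        wordDeriv_concat_mul hS ha (hF.smooth ε) w l
      · exact (ih (contDiffOn_derivAlong hS ha _) hF).mono (by simp [sndCount])
      · rcases l with i | i
        · exact (ih ha (hF.derivAlong_inl hΩ i)).mono (by simp [sndCount])
        · exact (ih ha (hF.derivAlong_inr hΩ i)).mono (by simp [sndCount]; omega)

theorem derivAlong_inl_diagonal (hΩ : IsOpen Ω) {a : Eu n × Eu n → ℝ}
    (ha : ContDiffOn ℝ ∞ a (Ω ×ˢ Ω)) (ha0 : ∀ x ∈ Ω, a (x, x) = 0) (i : Fin n) :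
    ∀ x ∈ Ω, derivAlong (letterDir (.inl i)) a (x, x) = 0 := by
  intro x hx
  have h1 : HasFDerivAt (fun x' : Eu n => (x', x')) ((ContinuousLinearMap.id ℝ (Eu n)).prod
      (ContinuousLinearMap.id ℝ (Eu n))) x := (hasFDerivAt_id x).prodMk (hasFDerivAt_id x)
  have h2 := (differentiableAt_of_contDiffOn (hΩ.prod hΩ) ha (z := (x, x))
    ⟨hx, hx⟩).hasFDerivAt.comp (f := fun x' : Eu n => (x', x')) x h1
  have h3 : (a ∘ fun x' : Eu n => (x', x')) =ᶠ[𝓝 x] fun _ => 0 := by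
    filter_upwards [hΩ.mem_nhds hx] with z hz using ha0 z hz
  have h4 := h2.fderiv.symm.trans (h3.fderiv_eq.trans (fderiv_const_apply _))
  exact congrArg (fun A : Eu n →L[ℝ] ℝ => A (stdFrame n i)) h4

/-- A factor that vanishes on the diagonal lowers the order by one. -/
theorem HasOrder.mul_of_diagonal (hΩ : IsOpen Ω) {a : Eu n × Eu n → ℝ}
    (ha : ContDiffOn ℝ ∞ a (Ω ×ˢ Ω)) (ha0 : ∀ x ∈ Ω, a (x, x) = 0)
    (hF : HasOrder Ω (m + 1) F) : HasOrder Ω m fun ε => a * F ε where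
  toConcentrated := hF.toConcentrated.mul ha
  bound w := by
    have hS : IsOpen (Ω ×ˢ Ω) := hΩ.prod hΩ
    induction w using List.reverseRecOn generalizing a F m with
    | nil => exact DecayBound.mul_of_diagonal hΩ ha ha0 hF.toConcentrated (hF.bound [])
    | append_singleton w l ih =>
      refine DecayBound.congr (DecayBound.add ?_ ?_) fun ε =>
        wordDeriv_concat_mul hS ha (hF.smooth ε) w l
      · rcases l with i | i
        · exact (ih (contDiffOn_derivAlong hS ha _) (derivAlong_inl_diagonal hΩ ha ha0 i)
            hF).mono (by simp [sndCount])
        -- a derivative of the factor in `y` need not vanish on the diagonal, but such a derivative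
        -- also allows one more power of `1 / ε`
        · exact ((hF.mul hΩ (contDiffOn_derivAlong hS ha (letterDir (.inr i)))).bound w).mono
            (by simp [sndCount]; omega)
      · rcases l with i | i
        · exact (ih ha ha0 (hF.derivAlong_inl hΩ i)).mono (by simp [sndCount])
        · exact (ih ha ha0 (hF.derivAlong_inr hΩ i)).mono (by simp [sndCount]; omega)

theorem HasOrder.zero : HasOrder Ω m fun _ => (0 : Eu n × Eu n → ℝ) where
  smooth _ := contDiffOn_const
  near _ _ _ := ⟨0, Eventually.of_forall fun _ _ _ _ _ h => absurd rfl h⟩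
  bound w := by
    have h : wordDeriv w (0 : Eu n × Eu n → ℝ) = 0 := by
      induction w with
      | nil => rfl
      | cons l w ih =>
        change derivAlong _ (wordDeriv w 0) = 0
        rw [ih]
        funext z
        simp [derivAlong]
    simp only [h]
    exact fun _ _ _ => ⟨0, Eventually.of_forall fun _ _ _ _ _ => by simp⟩

theorem HasOrder.sum (hΩ : IsOpen Ω) {ι : Type*} (s : Finset ι)
    {H : ι → Param → Eu n × Eu n → ℝ} (h : ∀ i ∈ s, HasOrder Ω m (H i)) :
    HasOrder Ω m fun ε => ∑ i ∈ s, H i ε := by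
  classical
  induction s using Finset.induction_on with
  | empty => simpa using HasOrder.zero
  | insert i s hi ih =>
    simp only [Finset.sum_insert hi]
    exact (h i (Finset.mem_insert_self i s)).add hΩ
      (ih fun k hk => h k (Finset.mem_insert_of_mem hk))

end Orders

/-! ### Lie derivatives of functions of two variables -/

section FlatOperators

variable {n : ℕ} {Ω : Set (Eu n)} {m : ℕ}

/-- The derivative of a function of two variables in the first variable along a vector field. -/
def flatLieFst (Z : Eu n → Eu n) (F : Eu n × Eu n → ℝ) : Eu n × Eu n → ℝ := fun z =>
  fderiv ℝ F z (Z z.1, 0)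

/-- The Lie derivative in the second variable of a function of two variables, regarded as the
coefficient of an `n`-form in this variable. -/
def flatLieSnd (Z : Eu n → Eu n) (F : Eu n × Eu n → ℝ) : Eu n × Eu n → ℝ := fun z =>
  fderiv ℝ F z (0, Z z.2) + F z * divergence Z z.2

theorem eq_sum_coord (v : Eu n) : v = ∑ i, v i • stdFrame n i := by
  have h := (EuclideanSpace.basisFun (Fin n) ℝ).sum_repr v
  simpa [stdFrame] using h.symm

theorem contDiffOn_flatLieFst (hΩ : IsOpen Ω) {Z : Eu n → Eu n} (hZ : ContDiffOn ℝ ∞ Z Ω)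
    {F : Eu n × Eu n → ℝ} (hF : ContDiffOn ℝ ∞ F (Ω ×ˢ Ω)) :
    ContDiffOn ℝ ∞ (flatLieFst Z F) (Ω ×ˢ Ω) :=
  (hF.fderiv_of_isOpen (hΩ.prod hΩ) (by simp)).clm_apply
    ((hZ.comp contDiffOn_fst fun _ hz => hz.1).prodMk contDiffOn_const)

theorem contDiffOn_flatLieSnd (hΩ : IsOpen Ω) {Z : Eu n → Eu n} (hZ : ContDiffOn ℝ ∞ Z Ω)
    {F : Eu n × Eu n → ℝ} (hF : ContDiffOn ℝ ∞ F (Ω ×ˢ Ω)) :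
    ContDiffOn ℝ ∞ (flatLieSnd Z F) (Ω ×ˢ Ω) :=
  ((hF.fderiv_of_isOpen (hΩ.prod hΩ) (by simp)).clm_apply
    (contDiffOn_const.prodMk (hZ.comp contDiffOn_snd fun _ hz => hz.2))).add
    (hF.mul ((contDiffOn_divergence hΩ hZ).comp contDiffOn_snd fun _ hz => hz.2))

theorem flatLieSnd_eq_sum (Z : Eu n → Eu n) (F : Eu n × Eu n → ℝ) :
    flatLieSnd Z F = ∑ i, (fun z : Eu n × Eu n => Z z.2 i) * derivAlong (letterDir (.inr i)) F +
      (fun z : Eu n × Eu n => divergence Z z.2) * F := by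
  funext z
  rw [Pi.add_apply, Finset.sum_apply, Pi.mul_apply, flatLieSnd, mul_comm (F z)]
  congr 1
  have h : ((0 : Eu n), Z z.2) = ∑ i, Z z.2 i • letterDir (.inr i) := by
    conv_lhs => rw [eq_sum_coord (Z z.2)]
    ext1 <;> simp [letterDir, Prod.fst_sum, Prod.snd_sum]
  rw [h, map_sum]
  exact Finset.sum_congr rfl fun i _ => map_smul _ _ _

/-- In the sum of the Lie derivatives in both variables, the derivatives in the second variable
appear with coefficients that vanish on the diagonal. -/
theorem flatLieSum_eq_sum (Z : Eu n → Eu n) (F : Eu n × Eu n → ℝ) :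
    flatLieFst Z F + flatLieSnd Z F =
      ∑ i, (fun z : Eu n × Eu n => Z z.1 i) * derivAlong (letterDir (.inl i)) F +
      ∑ i, (fun z : Eu n × Eu n => Z z.2 i - Z z.1 i) * derivAlong (letterDir (.inr i)) F +
      (fun z : Eu n × Eu n => divergence Z z.2) * F := by
  funext z
  simp only [Pi.add_apply, Finset.sum_apply, Pi.mul_apply, flatLieSnd, flatLieFst]
  rw [← add_assoc, mul_comm (F z), ← map_add]
  congr 1
  have h : ((Z z.1, 0) + (0, Z z.2) : Eu n × Eu n) = ∑ i, Z z.1 i • letterDir (.inl i) +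
      ∑ i, (Z z.2 i - Z z.1 i) • letterDir (.inr i) := by
    conv_lhs => rw [eq_sum_coord (Z z.1), eq_sum_coord (Z z.2)]
    ext1
    · simp [letterDir, Prod.fst_sum]
    · simp [letterDir, Prod.snd_sum, ← Finset.sum_add_distrib, ← add_smul]
  rw [h, map_add, map_sum, map_sum]
  congr 1 <;> exact Finset.sum_congr rfl fun i _ => map_smul _ _ _

theorem contDiffOn_coord {Z : Eu n → Eu n} (hZ : ContDiffOn ℝ ∞ Z Ω) (i : Fin n) :
    ContDiffOn ℝ ∞ (fun x => Z x i) Ω :=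
  (EuclideanSpace.proj (𝕜 := ℝ) i).contDiff.comp_contDiffOn hZ

theorem HasOrder.flatLieSnd (hΩ : IsOpen Ω) {Z : Eu n → Eu n} (hZ : ContDiffOn ℝ ∞ Z Ω)
    {F : Param → Eu n × Eu n → ℝ} (hF : HasOrder Ω m F) :
    HasOrder Ω (m + 1) fun ε => flatLieSnd Z (F ε) := by
  simp only [flatLieSnd_eq_sum]
  refine HasOrder.add hΩ (HasOrder.sum hΩ _ fun i _ => ?_) ?_
  · exact (hF.derivAlong_inr hΩ i).mul hΩ
      ((contDiffOn_coord hZ i).comp contDiffOn_snd fun _ hz => hz.2)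
  · exact (hF.mul hΩ
      ((contDiffOn_divergence hΩ hZ).comp contDiffOn_snd fun _ hz => hz.2)).mono (Nat.le_succ m)

theorem HasOrder.flatLieSum (hΩ : IsOpen Ω) {Z : Eu n → Eu n} (hZ : ContDiffOn ℝ ∞ Z Ω)
    {F : Param → Eu n × Eu n → ℝ} (hF : HasOrder Ω m F) :
    HasOrder Ω m fun ε => flatLieFst Z (F ε) + SmoothingKernel.flatLieSnd Z (F ε) := by
  have hf : ∀ i, ContDiffOn ℝ ∞ (fun z : Eu n × Eu n => Z z.1 i) (Ω ×ˢ Ω) := fun i =>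
    (contDiffOn_coord hZ i).comp contDiffOn_fst fun _ hz => hz.1
  have hs : ∀ i, ContDiffOn ℝ ∞ (fun z : Eu n × Eu n => Z z.2 i) (Ω ×ˢ Ω) := fun i =>
    (contDiffOn_coord hZ i).comp contDiffOn_snd fun _ hz => hz.2
  simp only [flatLieSum_eq_sum]
  refine HasOrder.add hΩ (HasOrder.add hΩ (HasOrder.sum hΩ _ fun i _ => ?_)
    (HasOrder.sum hΩ _ fun i _ => ?_)) ?_
  · exact (hF.derivAlong_inl hΩ i).mul hΩ (hf i)
  · exact (hF.derivAlong_inr hΩ i).mul_of_diagonal hΩ ((hs i).sub (hf i)) fun x _ => sub_self _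
  · exact hF.mul hΩ ((contDiffOn_divergence hΩ hZ).comp contDiffOn_snd fun _ hz => hz.2)

/-- The counterpart of `iteratedLie` for functions of two variables. -/
def flatIteratedLie (θ ζ : List (Eu n → Eu n)) (F : Eu n × Eu n → ℝ) : Eu n × Eu n → ℝ :=
  θ.foldr flatLieSnd (ζ.foldr (fun Z G => flatLieFst Z G + flatLieSnd Z G) F)

theorem HasOrder.flatIteratedLie (hΩ : IsOpen Ω) {θ ζ : List (Eu n → Eu n)}
    (hθ : ∀ Z ∈ θ, ContDiffOn ℝ ∞ Z Ω) (hζ : ∀ Z ∈ ζ, ContDiffOn ℝ ∞ Z Ω)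
    {F : Param → Eu n × Eu n → ℝ} (hF : HasOrder Ω m F) :
    HasOrder Ω (m + θ.length) fun ε => flatIteratedLie θ ζ (F ε) := by
  induction θ with
  | nil =>
    induction ζ with
    | nil => exact hF
    | cons Z ζ ih =>
      exact (ih fun Z' h => hζ Z' (List.mem_cons_of_mem _ h)).flatLieSum hΩ
        (hζ Z List.mem_cons_self)
  | cons Z θ ih =>
    exact (ih fun Z' h => hθ Z' (List.mem_cons_of_mem _ h)).flatLieSnd hΩ
      (hθ Z List.mem_cons_self)

end FlatOperators

/-! ### Multi-indices -/

section MultiIndices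

variable {n : ℕ}

/-- The list in which the index `i` occurs `α i` times, in increasing order. -/
def indexList (α : Fin n → ℕ) : List (Fin n) :=
  (List.finRange n).flatMap fun i => List.replicate (α i) i

theorem multiPower_eq_foldr {G : Type*} (op : Fin n → G → G) (α : Fin n → ℕ) (ψ : G) :
    multiPower op α ψ = (indexList α).foldr op ψ := by
  have h : ∀ l : List (Fin n), l.foldr (fun i χ => (op i)^[α i] χ) ψ =
      (l.flatMap fun i => List.replicate (α i) i).foldr op ψ := by
    intro l
    induction l with
    | nil => rfl
    | cons i l ih =>
      rw [List.flatMap_cons, List.foldr_append, ← ih, List.foldr_cons]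
      generalize l.foldr (fun i χ => (op i)^[α i] χ) ψ = χ
      induction α i with
      | zero => rfl
      | succ k ihk => rw [Function.iterate_succ_apply', ihk, List.replicate_succ, List.foldr_cons]
  exact h _

theorem sum_map_finRange (f : Fin n → ℕ) : ((List.finRange n).map f).sum = ∑ i, f i := by
  rw [← List.ofFn_eq_map, List.sum_ofFn]

theorem count_indexList (α : Fin n → ℕ) (i : Fin n) : (indexList α).count i = α i := by
  rw [indexList, List.count_flatMap]
  have h : List.count i ∘ (fun j => List.replicate (α j) j) = fun j => if j = i then α i else 0 := by
    funext j
    simp only [Function.comp, List.count_replicate, beq_iff_eq]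
    split_ifs with h
    · rw [h]
    · rfl
  rw [h, sum_map_finRange]
  simp

theorem length_indexList (α : Fin n → ℕ) : (indexList α).length = ∑ i, α i := by
  rw [indexList, List.length_flatMap]
  simp [sum_map_finRange]

theorem perm_indexList_count (a : List (Fin n)) : a.Perm (indexList fun i => a.count i) :=
  List.perm_iff_count.2 fun i => (count_indexList (fun i => a.count i) i).symm

theorem exists_perm_append (w : List (Fin n ⊕ Fin n)) :
    ∃ a b : List (Fin n), w.Perm (b.map Sum.inr ++ a.map Sum.inl) := by
  induction w with
  | nil => exact ⟨[], [], List.Perm.nil⟩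
  | cons l w ih =>
    obtain ⟨a, b, h⟩ := ih
    rcases l with i | i
    · exact ⟨i :: a, b, (h.cons _).trans List.perm_middle.symm⟩
    · exact ⟨a, i :: b, h.cons _⟩

theorem sndCount_append (a b : List (Fin n)) :
    sndCount (b.map Sum.inr ++ a.map Sum.inl) = b.length := by
  induction b with
  | nil => induction a <;> simp_all [sndCount]
  | cons i b ih =>
    rw [List.map_cons, List.cons_append, sndCount, List.countP_cons_of_pos (by rfl)]
    exact congrArg (· + 1) ih

end MultiIndices

/-! ### Partial derivatives as words -/

section PartialDerivatives

variable {n : ℕ} {Ω : Set (Eu n)} {F : Eu n × Eu n → ℝ} {ψ : Eu n → Eu n → ℝ}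

theorem partialFst_eq (hΩ : IsOpen Ω) (hF : ContDiffOn ℝ ∞ F (Ω ×ˢ Ω))
    (h : ∀ x ∈ Ω, ∀ y ∈ Ω, ψ x y = F (x, y)) (i : Fin n) {x y : Eu n} (hx : x ∈ Ω) (hy : y ∈ Ω) :
    partialFst i ψ x y = fderiv ℝ F (x, y) (stdFrame n i, 0) := by
  have h1 := (differentiableAt_of_contDiffOn (hΩ.prod hΩ) hF (z := (x, y)) ⟨hx, hy⟩).hasFDerivAt
  have h2 : HasFDerivAt (fun x' => F (x', y)) _ x := h1.comp x (hasFDerivAt_prodMk_left x y)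
  have h3 : (fun x' => ψ x' y) =ᶠ[𝓝 x] fun x' => F (x', y) := by
    filter_upwards [hΩ.mem_nhds hx] with z hz using h z hz y hy
  rw [partialFst, h3.lineDeriv_eq, h2.differentiableAt.lineDeriv_eq_fderiv, h2.fderiv]
  simp

theorem partialSnd_eq (hΩ : IsOpen Ω) (hF : ContDiffOn ℝ ∞ F (Ω ×ˢ Ω))
    (h : ∀ x ∈ Ω, ∀ y ∈ Ω, ψ x y = F (x, y)) (i : Fin n) {x y : Eu n} (hx : x ∈ Ω) (hy : y ∈ Ω) :
    partialSnd i ψ x y = derivAlong (letterDir (.inr i)) F (x, y) := by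
  have h1 := (differentiableAt_of_contDiffOn (hΩ.prod hΩ) hF (z := (x, y)) ⟨hx, hy⟩).hasFDerivAt
  have h2 : HasFDerivAt (fun y' => F (x, y')) _ y := h1.comp y (hasFDerivAt_prodMk_right x y)
  have h3 : (fun y' => ψ x y') =ᶠ[𝓝 y] fun y' => F (x, y') := by
    filter_upwards [hΩ.mem_nhds hy] with z hz using h x hx z hz
  rw [partialSnd, h3.lineDeriv_eq, h2.differentiableAt.lineDeriv_eq_fderiv, h2.fderiv]
  simp [derivAlong, letterDir]

theorem partialSum_eq (hΩ : IsOpen Ω) (hF : ContDiffOn ℝ ∞ F (Ω ×ˢ Ω))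
    (h : ∀ x ∈ Ω, ∀ y ∈ Ω, ψ x y = F (x, y)) (i : Fin n) {x y : Eu n} (hx : x ∈ Ω) (hy : y ∈ Ω) :
    partialSum i ψ x y = derivAlong (letterDir (.inl i)) F (x, y) := by
  change partialFst i ψ x y + partialSnd i ψ x y = _
  rw [partialFst_eq hΩ hF h i hx hy, partialSnd_eq hΩ hF h i hx hy, derivAlong, derivAlong,
    ← map_add]
  simp [letterDir]

theorem foldr_partialSum_eq (hΩ : IsOpen Ω) (hF : ContDiffOn ℝ ∞ F (Ω ×ˢ Ω))
    (h : ∀ x ∈ Ω, ∀ y ∈ Ω, ψ x y = F (x, y)) (a : List (Fin n)) :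
    ∀ x ∈ Ω, ∀ y ∈ Ω, a.foldr partialSum ψ x y = wordDeriv (a.map Sum.inl) F (x, y) := by
  induction a with
  | nil => exact h
  | cons i a ih =>
    exact fun x hx y hy =>
      partialSum_eq hΩ (contDiffOn_wordDeriv (hΩ.prod hΩ) hF _) ih i hx hy

theorem foldr_partialSnd_eq (hΩ : IsOpen Ω) (hF : ContDiffOn ℝ ∞ F (Ω ×ˢ Ω))
    (h : ∀ x ∈ Ω, ∀ y ∈ Ω, ψ x y = F (x, y)) (b : List (Fin n)) :
    ∀ x ∈ Ω, ∀ y ∈ Ω, b.foldr partialSnd ψ x y = wordDeriv (b.map Sum.inr) F (x, y) := by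
  induction b with
  | nil => exact h
  | cons i b ih =>
    exact fun x hx y hy =>
      partialSnd_eq hΩ (contDiffOn_wordDeriv (hΩ.prod hΩ) hF _) ih i hx hy

theorem multiPower_eq_wordDeriv (hΩ : IsOpen Ω) (hF : ContDiffOn ℝ ∞ F (Ω ×ˢ Ω))
    (h : ∀ x ∈ Ω, ∀ y ∈ Ω, ψ x y = F (x, y)) (α β : Fin n → ℕ) :
    ∀ x ∈ Ω, ∀ y ∈ Ω, multiPower partialSnd β (multiPower partialSum α ψ) x y =
      wordDeriv ((indexList β).map Sum.inr ++ (indexList α).map Sum.inl) F (x, y) := by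
  rw [multiPower_eq_foldr, multiPower_eq_foldr, wordDeriv_append]
  exact foldr_partialSnd_eq hΩ (contDiffOn_wordDeriv (hΩ.prod hΩ) hF _)
    (foldr_partialSum_eq hΩ hF h _) _

end PartialDerivatives

/-! ### The local conditions in terms of words -/

section LocalCondition

variable {n : ℕ} {Ω : Opens (Eu n)} {ψ : Param → Ω → 𝓓(Ω, ℝ)} {F : Param → Eu n × Eu n → ℝ}

theorem exists_opens_compact {K : Set (Eu n)} (hK : K ⊆ Ω) (hKc : IsCompact K) :
    ∃ K' : Set Ω, IsCompact K' ∧ Subtype.val '' K' = K :=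
  ⟨Subtype.val ⁻¹' K, (Topology.IsInducing.subtypeVal.isCompact_preimage_iff
    (by simpa using hK)).2 hKc, Subtype.image_preimage_coe _ _ |>.trans (inter_eq_right.2 hK)⟩

/-- As mixed partial derivatives commute, it suffices to bound the derivatives along words in which
all letters `∂_{y_i}` stand in front. -/
theorem wordDeriv_bound_of_append (hF : ∀ ε, ContDiffOn ℝ ∞ (F ε) ((Ω : Set (Eu n)) ×ˢ Ω))
    (h : ∀ a b : List (Fin n), DecayBound (Ω : Set (Eu n)) (n + b.length) fun ε =>
      wordDeriv (b.map Sum.inr ++ a.map Sum.inl) (F ε)) (w : List (Fin n ⊕ Fin n)) :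
    DecayBound (Ω : Set (Eu n)) (n + sndCount w) fun ε => wordDeriv w (F ε) := by
  obtain ⟨a, b, hab⟩ := exists_perm_append w
  have hcount : sndCount w = b.length := (hab.countP_eq _).trans (sndCount_append a b)
  rw [hcount]
  exact (h a b).congr fun ε => wordDeriv_perm (Ω.isOpen.prod Ω.isOpen) (hF ε) hab

theorem localDerivCondition_iff (hF : ∀ ε, ContDiffOn ℝ ∞ (F ε) ((Ω : Set (Eu n)) ×ˢ Ω))
    (hψ : ∀ ε, ∀ x y : Ω, ψ ε x y = F ε (x, y)) :
    LocalDerivCondition ψ ↔ ∀ w, DecayBound (Ω : Set (Eu n)) (n + sndCount w) fun ε =>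
      wordDeriv w (F ε) := by
  have hψ' : ∀ ε, ∀ x ∈ (Ω : Set (Eu n)), ∀ y ∈ (Ω : Set (Eu n)),
      toTwoPoint (ψ ε) x y = F ε (x, y) := fun ε x hx y hy => by
    rw [toTwoPoint, dif_pos (show x ∈ Ω from hx)]
    exact hψ ε ⟨x, hx⟩ ⟨y, hy⟩
  have hS := Ω.isOpen.prod Ω.isOpen
  constructor
  · intro h
    refine wordDeriv_bound_of_append hF fun a b K hK hKc => ?_
    obtain ⟨K', hK'c, hK'⟩ := exists_opens_compact hK hKc
    obtain ⟨ε₀, hε₀, C, hC⟩ := h K' hK'c (fun i => a.count i) (fun i => b.count i)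
    refine ⟨C, eventually_smallParam.2 ⟨ε₀, hε₀, fun ε hε x hx y hy => ?_⟩⟩
    rw [← hK'] at hx
    obtain ⟨x, hx, rfl⟩ := hx
    have h1 := hC ε hε x hx ⟨y, hy⟩
    rw [multiPower_eq_wordDeriv Ω.isOpen (hF ε) (hψ' ε) _ _ x x.2 y hy] at h1
    rw [← length_indexList, ← (perm_indexList_count b).length_eq] at h1
    have h2 := wordDeriv_perm hS (hF ε) (((perm_indexList_count b).map Sum.inr).append
      ((perm_indexList_count a).map Sum.inl)) (x := ((x : Eu n), y)) ⟨x.2, hy⟩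
    rwa [← h2] at h1
  · intro h K hKc α β
    obtain ⟨C, hC⟩ := h ((indexList β).map Sum.inr ++ (indexList α).map Sum.inl)
      (Subtype.val '' K) (by rintro _ ⟨x, -, rfl⟩; exact x.2) (hKc.image continuous_subtype_val)
    rw [eventually_smallParam] at hC
    obtain ⟨ε₀, hε₀, hC⟩ := hC
    refine ⟨ε₀, hε₀, C, fun ε hε x hx y => ?_⟩
    rw [multiPower_eq_wordDeriv Ω.isOpen (hF ε) (hψ' ε) _ _ x x.2 y y.2, ← length_indexList]
    have h1 := hC ε hε x (mem_image_of_mem _ hx) y y.2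
    rwa [sndCount_append] at h1

/-- The support condition says that nonzero values at `(x, y)` occur only for `‖x - y‖ ≤ C ε`. -/
theorem concentrated_of_localSupportCondition
    (hF : ∀ ε, ContDiffOn ℝ ∞ (F ε) ((Ω : Set (Eu n)) ×ˢ Ω))
    (hψ : ∀ ε, ∀ x y : Ω, ψ ε x y = F ε (x, y)) (h : LocalSupportCondition ψ) :
    Concentrated (Ω : Set (Eu n)) F where
  smooth := hF
  near K hK hKc := by
    obtain ⟨K', hK'c, hK'⟩ := exists_opens_compact hK hKc
    obtain ⟨ε₀, hε₀, C, hC, hsupp⟩ := h K' hK'c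
    refine ⟨C, eventually_smallParam.2 ⟨ε₀, hε₀, fun ε hε x hx y hy hne => ?_⟩⟩
    rw [← hK'] at hx
    obtain ⟨x, hx, rfl⟩ := hx
    rw [← hψ ε x ⟨y, hy⟩] at hne
    have h1 := (hsupp x hx ε hε).1 (subset_tsupport _ (Function.mem_support.2 hne))
    rw [mul_comm]
    exact (Metric.mem_ball.1 h1).le

end LocalCondition

/-! ### The condition on derivatives -/

section TwoPointForms

variable {n : ℕ} {X : Type*} [TopologicalSpace X] [ChartedSpace (Eu n) X]
  [IsManifold 𝓘(ℝ, Eu n) ∞ X] {e : OpenPartialHomeomorph X (Eu n)}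

/-- The coefficient of a two-point form in a chart, as a function of both points. -/
def twoPointCoeff (e : OpenPartialHomeomorph X (Eu n)) (Ψ : X → X → Covec n) :
    Eu n × Eu n → ℝ := fun z => coeff e (Ψ (e.symm z.1)) z.2

variable {Ψ : X → X → Covec n} {G : Eu n × Eu n → ℝ}

theorem twoPointCoeff_lieSnd (he : e ∈ charts n X) (V : VectorField n X)
    (hG : ContDiffOn ℝ ∞ G (e.target ×ˢ e.target))
    (h : EqOn (twoPointCoeff e Ψ) G (e.target ×ˢ e.target)) :
    EqOn (twoPointCoeff e (lieSnd V Ψ)) (flatLieSnd (chartField e V) G)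
      (e.target ×ˢ e.target) := by
  rintro ⟨x, y⟩ ⟨hx, hy⟩
  have h1 := (differentiableAt_of_contDiffOn (e.open_target.prod e.open_target) hG (z := (x, y))
    ⟨hx, hy⟩).hasFDerivAt
  have h2 : HasFDerivAt (fun y' => G (x, y')) _ y := h1.comp y (hasFDerivAt_prodMk_right x y)
  have h3 : coeff e (Ψ (e.symm x)) =ᶠ[𝓝 y] fun y' => G (x, y') := by
    filter_upwards [e.open_target.mem_nhds hy] with z hz using h (x := (x, z)) ⟨hx, hz⟩
  have h4 := h2.congr_of_eventuallyEq h3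
  refine (coeff_lieForm he V hy h4.differentiableAt).trans ?_
  rw [h4.fderiv, h3.self_of_nhds]
  simp [flatLieSnd]

theorem twoPointCoeff_lieFst (he : e ∈ charts n X) (V : VectorField n X)
    (hG : ContDiffOn ℝ ∞ G (e.target ×ˢ e.target))
    (h : EqOn (twoPointCoeff e Ψ) G (e.target ×ˢ e.target)) :
    EqOn (twoPointCoeff e (lieFst V Ψ)) (flatLieFst (chartField e V) G)
      (e.target ×ˢ e.target) := by
  rintro ⟨x, y⟩ ⟨hx, hy⟩
  have h1 := (differentiableAt_of_contDiffOn (e.open_target.prod e.open_target) hG (z := (x, y))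
    ⟨hx, hy⟩).hasFDerivAt
  have h2 : HasFDerivAt (fun x' => G (x', y)) _ x := h1.comp x (hasFDerivAt_prodMk_left x y)
  have h3 : (fun x' => coeff e (Ψ (e.symm x')) y) =ᶠ[𝓝 x] fun x' => G (x', y) := by
    filter_upwards [e.open_target.mem_nhds hx] with z hz using h (x := (z, y)) ⟨hz, hy⟩
  have h4 := h2.congr_of_eventuallyEq h3
  refine (coeff_lieFst he V hx hy h4.differentiableAt).trans ?_
  rw [h4.fderiv]
  simp [flatLieFst]

theorem contDiffOn_flatIteratedLie {Ω : Set (Eu n)} (hΩ : IsOpen Ω) {θ ζ : List (Eu n → Eu n)}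
    (hθ : ∀ Z ∈ θ, ContDiffOn ℝ ∞ Z Ω) (hζ : ∀ Z ∈ ζ, ContDiffOn ℝ ∞ Z Ω)
    (hG : ContDiffOn ℝ ∞ G (Ω ×ˢ Ω)) : ContDiffOn ℝ ∞ (flatIteratedLie θ ζ G) (Ω ×ˢ Ω) := by
  induction θ with
  | nil =>
    induction ζ with
    | nil => exact hG
    | cons Z ζ ih =>
      have h1 := ih fun Z' h => hζ Z' (List.mem_cons_of_mem _ h)
      have h2 := hζ Z List.mem_cons_self
      exact (contDiffOn_flatLieFst hΩ h2 h1).add (contDiffOn_flatLieSnd hΩ h2 h1)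
  | cons Z θ ih =>
    exact contDiffOn_flatLieSnd hΩ (hθ Z List.mem_cons_self)
      (ih fun Z' h => hθ Z' (List.mem_cons_of_mem _ h))

theorem contDiffOn_of_mem_map_chartField (he : e ∈ charts n X) (l : List (VectorField n X)) :
    ∀ Z ∈ l.map (chartField e), ContDiffOn ℝ ∞ Z e.target := by
  intro Z hZ
  obtain ⟨V, -, rfl⟩ := List.mem_map.1 hZ
  exact contDiffOn_chartField he V

theorem twoPointCoeff_iteratedLie (he : e ∈ charts n X) (θ ζ : List (VectorField n X))
    (hΨ : ContDiffOn ℝ ∞ (twoPointCoeff e Ψ) (e.target ×ˢ e.target)) :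
    EqOn (twoPointCoeff e (iteratedLie θ ζ Ψ))
      (flatIteratedLie (θ.map (chartField e)) (ζ.map (chartField e)) (twoPointCoeff e Ψ))
      (e.target ×ˢ e.target) := by
  have hsm : ∀ θ ζ : List (VectorField n X), ContDiffOn ℝ ∞ (flatIteratedLie (θ.map (chartField e))
      (ζ.map (chartField e)) (twoPointCoeff e Ψ)) (e.target ×ˢ e.target) := fun θ ζ =>
    contDiffOn_flatIteratedLie e.open_target (contDiffOn_of_mem_map_chartField he θ)
      (contDiffOn_of_mem_map_chartField he ζ) hΨ
  induction θ with
  | nil =>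
    induction ζ with
    | nil => exact fun _ _ => rfl
    | cons V ζ ih =>
      exact fun z hz => congrArg₂ (· + ·) (twoPointCoeff_lieFst he V (hsm [] ζ) ih hz)
        (twoPointCoeff_lieSnd he V (hsm [] ζ) ih hz)
  | cons V θ ih => exact twoPointCoeff_lieSnd he V (hsm θ ζ) ih

theorem flatLieSnd_eq_derivAlong {Ω : Set (Eu n)} (hΩ : IsOpen Ω) {Z : Eu n → Eu n} {i : Fin n}
    (hZ : ∀ x ∈ Ω, Z x = stdFrame n i) {H : Eu n × Eu n → ℝ} (h : EqOn H G (Ω ×ˢ Ω)) :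
    EqOn (flatLieSnd Z H) (derivAlong (letterDir (.inr i)) G) (Ω ×ˢ Ω) := by
  rintro z hz
  have h1 : Z =ᶠ[𝓝 z.2] fun _ => stdFrame n i := by
    filter_upwards [hΩ.mem_nhds hz.2] with y hy using hZ y hy
  have h2 : divergence Z z.2 = 0 := by
    rw [divergence, h1.fderiv_eq]
    exact congrFun (divergence_const (stdFrame n i)) z.2
  rw [← derivAlong_congr (hΩ.prod hΩ) h _ hz, flatLieSnd, h2, mul_zero, add_zero, hZ _ hz.2]
  rfl

theorem flatLieSum_eq_derivAlong {Ω : Set (Eu n)} (hΩ : IsOpen Ω) {Z : Eu n → Eu n} {i : Fin n}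
    (hZ : ∀ x ∈ Ω, Z x = stdFrame n i) {H : Eu n × Eu n → ℝ} (h : EqOn H G (Ω ×ˢ Ω)) :
    EqOn (flatLieFst Z H + flatLieSnd Z H) (derivAlong (letterDir (.inl i)) G) (Ω ×ˢ Ω) := by
  rintro z hz
  have h1 : fderiv ℝ H z = fderiv ℝ G z := by
    refine Filter.EventuallyEq.fderiv_eq ?_
    filter_upwards [(hΩ.prod hΩ).mem_nhds hz] with z' hz' using h hz'
  rw [Pi.add_apply, flatLieSnd_eq_derivAlong hΩ hZ h hz, flatLieFst, derivAlong, derivAlong, h1,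
    ← map_add, hZ _ hz.1]
  simp [letterDir]

/-- For constant fields the Lie derivatives are the partial derivatives `∂_{x_i} + ∂_{y_i}` and
`∂_{y_i}`. -/
theorem flatIteratedLie_eq_wordDeriv {Ω : Set (Eu n)} (hΩ : IsOpen Ω) {Z : Fin n → Eu n → Eu n}
    (hZ : ∀ i, ∀ x ∈ Ω, Z i x = stdFrame n i) (a b : List (Fin n)) :
    EqOn (flatIteratedLie (b.map Z) (a.map Z) G)
      (wordDeriv (b.map Sum.inr ++ a.map Sum.inl) G) (Ω ×ˢ Ω) := by
  induction b with
  | nil =>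
    induction a with
    | nil => exact fun _ _ => rfl
    | cons i a ih => exact flatLieSum_eq_derivAlong hΩ (hZ i) ih
  | cons i b ih => exact flatLieSnd_eq_derivAlong hΩ (hZ i) ih

theorem Concentrated.wordDeriv {Ω : Set (Eu n)} (hΩ : IsOpen Ω) {F : Param → Eu n × Eu n → ℝ}
    (hF : Concentrated Ω F) (w : List (Fin n ⊕ Fin n)) :
    Concentrated Ω fun ε => wordDeriv w (F ε) := by
  induction w with
  | nil => exact hF
  | cons l w ih => exact ih.derivAlong hΩ _

theorem covecNorm_nonpos_of_eq_zero (g : Metric n X) (he : e ∈ charts n X) (hs : e.source = univ)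
    {σ : X → Covec n} {q : X} (h : coeff e σ (e q) = 0) : covecNorm g q (σ q) ≤ 0 := by
  obtain ⟨C, -, hC⟩ := exists_covecNorm_compare g he hs (isCompact_singleton (x := q))
  simpa [h] using (hC q rfl σ).1

variable {Ω : Opens (Eu n)}

/-- From order `n` of the coefficient to the condition on Lie derivatives: `L_θ` raises the order by
one and `L'_ζ + L_ζ` keeps it. The supports lie in a fixed compact set for small `ε`, where the norm
of `g` is comparable with the coefficient. -/
theorem derivCondition_of_hasOrder (g : Metric n X) (he : e ∈ charts n X) (hs : e.source = univ)
    {Φ : Param → X → CompactForm n X}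
    (h : HasOrder e.target n fun ε => twoPointCoeff e fun p => (Φ ε p).form) :
    DerivCondition g Φ := by
  intro K hK θ ζ
  have hord := h.flatIteratedLie e.open_target (contDiffOn_of_mem_map_chartField he θ)
    (contDiffOn_of_mem_map_chartField he ζ)
  rw [List.length_map] at hord
  have hK1 := isCompact_image_chart hs hK
  obtain ⟨δ, hδ, C, -, hc, hct, hnear⟩ :=
    hord.exists_near e.open_target (image_subset_target hs K) hK1
  obtain ⟨C₁, hC₁⟩ := hord.bound [] _ (image_subset_target hs K) hK1
  obtain ⟨C₂, hC₂, hcmp⟩ := exists_covecNorm_compare g he hs (isCompact_preimage_chart hs hc hct)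
  obtain ⟨ε₀, hε₀, hall⟩ := eventually_smallParam.1 (hnear.and hC₁)
  refine ⟨ε₀, hε₀, C₂ * |C₁|, fun ε hε p hp q => ?_⟩
  obtain ⟨hn, hb⟩ := hall ε hε
  have hpos := ε.2.1
  have hq := mem_target_of_global hs q
  have heq := twoPointCoeff_iteratedLie he θ ζ (h.smooth ε) (x := (e p, e q))
    ⟨mem_target_of_global hs p, hq⟩
  rw [twoPointCoeff, symm_apply_of_global hs] at heq
  -- for small `ε`, a point `q` with nonzero value lies in the compact set where `hcmp` applies
  by_cases h0 : coeff e (iteratedLie θ ζ (fun p' => (Φ ε p').form) p) (e q) = 0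
  · exact (covecNorm_nonpos_of_eq_zero g he hs h0).trans (by positivity)
  · have hqc := mem_cthickening_of_dist_le (mem_image_of_mem e hp)
      (hn _ (mem_image_of_mem e hp) _ hq (heq ▸ h0)).2
    refine ((hcmp q hqc _).1).trans ?_
    rw [mul_div_assoc, heq]
    refine mul_le_mul_of_nonneg_left ((hb _ (mem_image_of_mem e hp) _ hq).trans ?_) hC₂.le
    exact div_le_div_of_nonneg_right (le_abs_self _) (pow_nonneg hpos.le _)

/-- The condition on Lie derivatives, applied to the constant fields of the chart, bounds the
partial derivatives of the coefficient. -/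
theorem bound_of_derivCondition (g : Metric n X) (he : e ∈ charts n X) (hs : e.source = univ)
    {Φ : Param → X → CompactForm n X}
    (h : Concentrated e.target fun ε => twoPointCoeff e fun p => (Φ ε p).form)
    (hD : DerivCondition g Φ) (a b : List (Fin n)) :
    DecayBound e.target (n + b.length) fun ε => wordDeriv (b.map Sum.inr ++ a.map Sum.inl)
      (twoPointCoeff e fun p => (Φ ε p).form) := by
  intro K hK hKc
  let V : Fin n → VectorField n X := fun i => constField he hs (stdFrame n i)
  have hw := h.wordDeriv e.open_target (b.map Sum.inr ++ a.map Sum.inl)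
  obtain ⟨δ, hδ, C, -, hc, hct, hnear⟩ := hw.exists_near e.open_target hK hKc
  obtain ⟨C₂, hC₂, hcmp⟩ := exists_covecNorm_compare g he hs (isCompact_preimage_chart hs hc hct)
  obtain ⟨ε₀, hε₀, C₁, hC₁⟩ := hD (e ⁻¹' K) (isCompact_preimage_chart hs hKc hK) (b.map V) (a.map V)
  refine ⟨C₂ * |C₁|, ?_⟩
  filter_upwards [hnear, eventually_smallParam.2 ⟨ε₀, hε₀, fun _ h => h⟩] with ε hn hε x hx y hy
  have hpos := ε.2.1
  have hex : e (e.symm x) = x := e.right_inv (hK hx)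
  have hey : e (e.symm y) = y := e.right_inv hy
  by_cases h0 : wordDeriv (b.map Sum.inr ++ a.map Sum.inl)
      (twoPointCoeff e fun p => (Φ ε p).form) (x, y) = 0
  · rw [h0, abs_zero]
    positivity
  · have h1 := twoPointCoeff_iteratedLie he (b.map V) (a.map V) (h.smooth ε) (x := (x, y))
      ⟨hK hx, hy⟩
    rw [List.map_map, List.map_map, flatIteratedLie_eq_wordDeriv e.open_target
      (Z := chartField e ∘ V) (fun i z hz => chartField_constField he hs _ hz) a b
      (x := (x, y)) ⟨hK hx, hy⟩] at h1
    have h2 := (hcmp (e.symm y) (by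
      rw [mem_preimage, hey]
      exact mem_cthickening_of_dist_le hx (hn x hx y hy h0).2)
      (iteratedLie (b.map V) (a.map V) (fun p => (Φ ε p).form) (e.symm x))).2
    rw [hey] at h2
    rw [← h1]
    refine h2.trans ?_
    rw [mul_div_assoc]
    have h3 := hC₁ ε hε (e.symm x) (by rwa [mem_preimage, hex]) (e.symm y)
    rw [List.length_map] at h3
    refine mul_le_mul_of_nonneg_left (h3.trans ?_) hC₂.le
    exact div_le_div_of_nonneg_right (le_abs_self _) (pow_nonneg hpos.le _)

theorem contDiffOn_twoPointCoeff (he : e ∈ charts n X) (hs : e.source = univ) (hΩ : e.target = Ω)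
    (Φ : SmoothMaps n X (CompactForm n X)) (ε : Param) :
    ContDiffOn ℝ ∞ (twoPointCoeff e fun p => (Φ.1 ε p).form) (e.target ×ˢ e.target) := by
  obtain ⟨D, hD, hD'⟩ := Φ.2 e he
  have h1 := contDiffOn_of_isDerivFamily e.open_target
    (hD.map (testEquiv he hs hΩ : CompactForm n X →L[ℝ] 𝓓(Ω, ℝ))) ε.2
  refine (h1.mono (prod_mono_right (subset_univ _))).congr fun z hz => ?_
  change _ = testEquiv he hs hΩ (D [] ((ε : ℝ), z.1)) z.2
  rw [hD' ε z.1 hz.1, testEquiv_apply he hs hΩ _ hz.2]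
  rfl

/-- Under the support condition the coefficient of a kernel is concentrated at the diagonal, and
both conditions on derivatives say that it has order `n`. -/
theorem derivCondition_iff (he : e ∈ charts n X) (hs : e.source = univ) (hΩ : e.target = Ω)
    (g : Metric n X) (Φ : SmoothMaps n X (CompactForm n X)) (hsupp : SupportCondition g Φ.1) :
    DerivCondition g Φ.1 ↔ LocalDerivCondition (kernelEquiv he hs hΩ Φ).1 := by
  have hsm := contDiffOn_twoPointCoeff he hs hΩ Φ
  have hψ : ∀ ε, ∀ x y : Ω, (kernelEquiv he hs hΩ Φ).1 ε x y =
      twoPointCoeff e (fun p => (Φ.1 ε p).form) (x, y) := fun ε x y => by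
    rw [kernelEquiv_apply, testEquiv_apply he hs hΩ _ (hΩ.symm.subset y.2)]
    rfl
  rw [hΩ] at hsm
  have hconc := concentrated_of_localSupportCondition hsm hψ
    ((supportCondition_iff he hs hΩ g Φ).1 hsupp)
  rw [localDerivCondition_iff hsm hψ]
  constructor
  · intro hD
    refine wordDeriv_bound_of_append hsm ?_
    rw [← hΩ] at hconc ⊢
    exact bound_of_derivCondition g he hs hconc hD
  · intro hb
    have : HasOrder (Ω : Set (Eu n)) n fun ε => twoPointCoeff e fun p => (Φ.1 ε p).form :=
      ⟨hconc, hb⟩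
    rw [← hΩ] at this
    exact derivCondition_of_hasOrder g he hs this

end TwoPointForms

/-! ### The chart domain as a manifold -/

section ChartDomain

variable {n : ℕ} {M : Type*} [TopologicalSpace M] [ChartedSpace (Eu n) M]
  {φ : OpenPartialHomeomorph M (Eu n)}

theorem chartOnDomain_source (hne : φ.source.Nonempty) : (chartOnDomain φ hne).source = univ := by
  refine (OpenPartialHomeomorph.subtypeRestr_source (s := chartDomain φ) φ hne.to_subtype).trans ?_
  exact eq_univ_of_forall fun p => p.2

theorem chartOnDomain_target (hne : φ.source.Nonempty) :
    (chartOnDomain φ hne).target = φ.target := by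
  refine (φ.subtypeRestr_target_subset hne.to_subtype).antisymm fun x hx => ?_
  let p : chartDomain φ := ⟨φ.symm x, φ.map_target hx⟩
  have h : φ p ∈ (chartOnDomain φ hne).target :=
    φ.map_subtype_source hne.to_subtype (x := p) p.2
  rwa [show φ p = x from φ.right_inv hx] at h

theorem chartOnDomain_symm_apply (hne : φ.source.Nonempty) {x : Eu n} (hx : x ∈ φ.target) :
    ((chartOnDomain φ hne).symm x : M) = φ.symm x :=
  φ.subtypeRestr_symm_apply hne.to_subtype ((chartOnDomain_target hne).symm.subset hx)

variable [IsManifold 𝓘(ℝ, Eu n) ∞ M]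

theorem chartOnDomain_mem_charts (hφ : φ ∈ charts n M) (hne : φ.source.Nonempty) :
    chartOnDomain φ hne ∈ charts n (chartDomain φ) := by
  refine (IsManifold.mem_maximalAtlas_iff_contMDiffOn _).2 ⟨?_, ?_⟩
  · exact (contMDiffOn_of_mem_maximalAtlas hφ).comp contMDiff_subtype_val.contMDiffOn
      fun p _ => p.2
  · rw [chartOnDomain_target]
    intro x hx
    rw [← ContMDiffWithinAt.subtypeVal_comp_iff]
    exact (contMDiffOn_symm_of_mem_maximalAtlas hφ x hx).congr
      (fun y hy => chartOnDomain_symm_apply hne hy) (chartOnDomain_symm_apply hne hx)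

theorem coeff_restrictForm (hφ : φ ∈ charts n M) (hne : φ.source.Nonempty) (o : M → Covec n)
    {x : Eu n} (hx : x ∈ φ.target) :
    coeff (chartOnDomain φ hne) (restrictForm (chartDomain φ) o) x = coeff φ o x := by
  have hmem := chartOnDomain_mem_charts hφ hne
  have hx' : x ∈ (chartOnDomain φ hne).target := (chartOnDomain_target hne).symm.subset hx
  have h1 : (fun y => ((chartOnDomain φ hne).symm y : M)) =ᶠ[𝓝 x] φ.symm := by
    filter_upwards [φ.open_target.mem_nhds hx] with y hy using chartOnDomain_symm_apply hne hy
  have h2 := mfderiv_comp x (I := 𝓘(ℝ, Eu n)) (I' := 𝓘(ℝ, Eu n)) (I'' := 𝓘(ℝ, Eu n))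
    (g := (Subtype.val : chartDomain φ → M)) (f := (chartOnDomain φ hne).symm)
    (contMDiff_subtype_val.mdifferentiable (n := ∞) (by simp) _)
    ((mdifferentiable_of_mem_charts hmem).mdifferentiableAt_symm hx')
  have h3 := h1.mfderiv_eq (I := 𝓘(ℝ, Eu n)) (I' := 𝓘(ℝ, Eu n))
  have h4 : ∀ v : Eu n, (mfderiv 𝓘(ℝ, Eu n) 𝓘(ℝ, Eu n) (Subtype.val : chartDomain φ → M)
      ((chartOnDomain φ hne).symm x) : Eu n →L[ℝ] Eu n) (chartDSymm (chartOnDomain φ hne) x v) =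
      chartDSymm φ x v := fun v =>
    congrArg (fun A : Eu n →L[ℝ] Eu n => A v) (h2.symm.trans h3)
  rw [coeff_apply, coeff_apply, ← chartOnDomain_symm_apply hne hx]
  exact congrArg _ (funext fun i => h4 (stdFrame n i))

end ChartDomain

end SmoothingKernel

end

/-! ### The correspondence of smoothing kernels -/

theorem mainTheorem3 {n : ℕ} {M : Type*} [TopologicalSpace M] [T2Space M] [ParacompactSpace M]
    [ChartedSpace (SmoothingKernel.Eu n) M] [IsManifold 𝓘(ℝ, SmoothingKernel.Eu n) ∞ M]
    (o : M → SmoothingKernel.Covec n) (ho : SmoothingKernel.IsOrientationForm o)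
    (φ : OpenPartialHomeomorph M (SmoothingKernel.Eu n))
    (hφ : φ ∈ SmoothingKernel.charts n M) (hne : φ.source.Nonempty)
    (hpos : SmoothingKernel.IsPositiveChart o φ) :
    ∃ T : SmoothingKernel.SmoothMaps n (SmoothingKernel.chartDomain φ)
          (SmoothingKernel.CompactForm n (SmoothingKernel.chartDomain φ)) ≃ₗ[ℝ]
        SmoothingKernel.SmoothMaps n (SmoothingKernel.chartImage φ)
          𝓓(SmoothingKernel.chartImage φ, ℝ),
      (∀ Φ ε, ∀ x y : SmoothingKernel.chartImage φ,
        (T Φ).1 ε x y = SmoothingKernel.localExpression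
          (SmoothingKernel.chartOnDomain φ hne) Φ.1 ε x y) ∧
      (∀ B, SmoothingKernel.IsBoundedSet B ↔ SmoothingKernel.IsBoundedSet (T '' B)) ∧
      (∀ k : ℕ,
        T '' SmoothingKernel.globalKernels
            (SmoothingKernel.restrictForm (SmoothingKernel.chartDomain φ) o) k =
          SmoothingKernel.localKernels (SmoothingKernel.chartImage φ) k) ∧
      (∀ Φ,
        (SmoothingKernel.Normalized
            (SmoothingKernel.restrictForm (SmoothingKernel.chartDomain φ) o) Φ.1 ↔
          SmoothingKernel.LocalNormalized (T Φ).1) ∧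
        (∀ k : ℕ, SmoothingKernel.ApproxCondition
            (SmoothingKernel.restrictForm (SmoothingKernel.chartDomain φ) o) k Φ.1 ↔
          SmoothingKernel.LocalApproxCondition k (T Φ).1) ∧
        ∀ g : SmoothingKernel.Metric n (SmoothingKernel.chartDomain φ),
          (SmoothingKernel.SupportCondition g Φ.1 ↔
            SmoothingKernel.LocalSupportCondition (T Φ).1) ∧
          (SmoothingKernel.SupportCondition g Φ.1 →
            (SmoothingKernel.DerivCondition g Φ.1 ↔
              SmoothingKernel.LocalDerivCondition (T Φ).1))) := by
  have he := SmoothingKernel.chartOnDomain_mem_charts hφ hne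
  have hs := SmoothingKernel.chartOnDomain_source hne
  have hΩ : (SmoothingKernel.chartOnDomain φ hne).target = SmoothingKernel.chartImage φ :=
    SmoothingKernel.chartOnDomain_target hne
  have hp : SmoothingKernel.IsPositiveChart
      (SmoothingKernel.restrictForm (SmoothingKernel.chartDomain φ) o)
      (SmoothingKernel.chartOnDomain φ hne) := fun x hx => by
    have hx' : x ∈ φ.target := hΩ.subset hx
    rw [SmoothingKernel.coeff_restrictForm hφ hne o hx']
    exact hpos x hx'
  refine ⟨SmoothingKernel.kernelEquiv he hs hΩ, fun Φ ε x y => ?_, fun B =>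
    SmoothingKernel.isBoundedSet_kernelEquiv_iff he hs hΩ B, fun k => ?_, fun Φ => ⟨
    SmoothingKernel.normalized_iff he hs hΩ hp Φ, fun k =>
    SmoothingKernel.approxCondition_iff he hs hΩ hp Φ k, fun g => ⟨
    SmoothingKernel.supportCondition_iff he hs hΩ g Φ, fun h =>
    SmoothingKernel.derivCondition_iff he hs hΩ g Φ h⟩⟩⟩
  · rw [SmoothingKernel.kernelEquiv_apply,
      SmoothingKernel.testEquiv_apply he hs hΩ _ (hΩ.symm.subset y.2)]
    rfl
  · -- a Riemannian metric exists, so that the conditions for all metrics imply the local ones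
    let g₀ := SmoothingKernel.chartMetric he hs
    have key : ∀ Φ, Φ ∈ SmoothingKernel.globalKernels
        (SmoothingKernel.restrictForm (SmoothingKernel.chartDomain φ) o) k ↔
        SmoothingKernel.kernelEquiv he hs hΩ Φ ∈
          SmoothingKernel.localKernels (SmoothingKernel.chartImage φ) k := by
      intro Φ
      refine and_congr (SmoothingKernel.normalized_iff he hs hΩ hp Φ) (and_congr ?_
        (imp_congr_right fun _ => SmoothingKernel.approxCondition_iff he hs hΩ hp Φ k))
      constructor
      · intro h
        exact ⟨(SmoothingKernel.supportCondition_iff he hs hΩ g₀ Φ).1 (h g₀).1,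
          (SmoothingKernel.derivCondition_iff he hs hΩ g₀ Φ (h g₀).1).1 (h g₀).2⟩
      · rintro ⟨h1, h2⟩ g
        have h3 := (SmoothingKernel.supportCondition_iff he hs hΩ g Φ).2 h1
        exact ⟨h3, (SmoothingKernel.derivCondition_iff he hs hΩ g Φ h3).2 h2⟩
    ext ψ
    constructor
    · rintro ⟨Φ, hΦ, rfl⟩
      exact (key Φ).1 hΦ
    · intro hψ
      obtain ⟨Φ, rfl⟩ := (SmoothingKernel.kernelEquiv he hs hΩ).surjective ψ
      exact ⟨Φ, (key Φ).2 hψ, rfl⟩
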